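/- Theorem 4.1 (thm:edge). Let $m\ge 1$, and let $S=[0,1]^m$ carry Lebesgue measure and the torus metric $d(x,y)=\min\{\|x-y+u\|_q : u\in\{-1,0,1\}^m\}$ derived from an $L_q$ norm, $1\le q\le\infty$; let $c_m$ be the volume of the unit ball of this norm in $\mathbb R^m$. Let $p\in[0,1]$ and $A_1,A_2>0$. The spatial preferred attachment (SPA) process starts with the null graph $G_0$. In step $t\ge1$ a new vertex $v_t$, placed uniformly at random in $S$ (independently of the past), is added to $G_{t-1}$, and, independently for each vertex $u$ of $G_{t-1}$ such that $v_t$ lies in the sphere of influence $S(u,t-1)$, the directed link $(v_t,u)$ is created with probability $p$. Here, for $t\ge 1$, $S(u,t)$ is the ball centred at $u$ of volume $\frac{A_1\deg^-(u,t)+A_2}{t}$, where $\deg^-(u,t)$ is the in-degree of $u$ in $G_t$, and $S(u,t)=S$ if this number is greater than $1$. For $\alpha\in\mathbb R$ let $e(\alpha)$ be the number of edges $(v,w)$ of $G_n$ with $$d(v,w)\ \ge\ r_\alpha=\left(\frac{n^{-\alpha}}{c_m}\right)^{1/m}.$$ Assume $\frac12<pA_1<1$. Then asymptotically almost surely, as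 $n\to\infty$, $$e(\alpha)=\begin{cases}(1+o(1))\,\dfrac{pA_2}{1-pA_1}\,n & \text{if }\alpha>1,\\[2mm] (1+o(1))\,C\,n^{2-\frac1{pA_1}+\alpha\frac{1-pA_1}{pA_1}} & \text{if } 1-\dfrac{pA_1}{4pA_1+2}<\alpha<1,\end{cases}$$ where $$C=\frac{\Gamma\left(\frac{A_2}{A_1}+\frac1{pA_1}\right)}{\Gamma\left(\frac{A_2}{A_1}\right)}\cdot\frac{A_1^{\frac{1-pA_1}{pA_1}}}{1-pA_1}\left(\frac{(1-pA_1)^3}{2pA_1-1}+1-(pA_1)(1-pA_1)\right).$$ That is, for every $\varepsilon>0$ the probability that $e(\alpha)$ differs from the stated main term by at most $\varepsilon$ times that term tends to $1$. -/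

import Mathlib

open MeasureTheory Filter Topology
open scoped ENNReal

noncomputable section

namespace SPA

/-- The unit hypercube in `ℝ ^ m`. Its `volume` is Lebesgue measure, i.e. the uniform
distribution. -/
abbrev Cube (m : ℕ) : Type := Fin m → unitInterval

/-- The torus metric on the unit hypercube derived from the `L_q` norm: the minimum of
`‖x - y + u‖_q` over `u ∈ {-1, 0, 1} ^ m`. -/
def torusDist {m : ℕ} (q : ℝ≥0∞) (x y : Cube m) : ℝ :=
  ⨅ u : Fin m → ({-1, 0, 1} : Set ℝ),
    ‖WithLp.toLp q (fun i => (x i : ℝ) - (y i : ℝ) + (u i : ℝ))‖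

/-- The ball of radius `r` about `x` in the torus metric. -/
def torusBall {m : ℕ} (q : ℝ≥0∞) (x : Cube m) (r : ℝ) : Set (Cube m) :=
  {y | torusDist q x y ≤ r}

/-- The constant `c_m`: the volume of the unit ball of the `L_q` norm on `ℝ ^ m`. -/
def unitBallVolume (m : ℕ) (q : ℝ≥0∞) : ℝ :=
  volume.real {x : Fin m → ℝ | ‖WithLp.toLp q x‖ ≤ 1}

/-- The radius of the torus ball about `x` whose volume is `V` (meant for `0 ≤ V ≤ 1`): the volume
of a ball is a continuous function of its radius, so the infimum below is attained with equality. -/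
def radiusOfVolume {m : ℕ} (q : ℝ≥0∞) (x : Cube m) (V : ℝ) : ℝ :=
  sInf {r : ℝ | 0 ≤ r ∧ V ≤ volume.real (torusBall q x r)}

open Classical in
/-- The ball about `x` of volume `V`, and the whole cube if `V > 1`. -/
def ballOfVolume {m : ℕ} (q : ℝ≥0∞) (x : Cube m) (V : ℝ) : Set (Cube m) :=
  if 1 < V then Set.univ else torusBall q x (radiusOfVolume q x V)

/-- The randomness of the process: a position for every vertex `v_t`, and a number in `[0, 1]` for
every ordered pair of vertices, which serves as the coin that decides on a possible link. -/
abbrev Sample (m : ℕ) : Type := (ℕ → Cube m) × (ℕ × ℕ → unitInterval)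

/-- All positions and all coins are independent and uniformly distributed. -/
def law (m : ℕ) : Measure (Sample m) :=
  (Measure.infinitePi fun _ : ℕ => (volume : Measure (Cube m))).prod
    (Measure.infinitePi fun _ : ℕ × ℕ => (volume : Measure unitInterval))

/-- The in-degree of vertex `s` in the directed graph with edge set `E`; the pair `(t, s)` is the
link from `v_t` to `v_s`. -/
def inDegree (E : Finset (ℕ × ℕ)) (s : ℕ) : ℕ := (E.filter fun e => e.2 = s).card

open Classical in
/-- The edge set of the graph `G_t` of the spatial preferred attachment process with parameters
`p`, `A₁`, `A₂`, whose vertices are `v_1, …, v_t`. In step `t + 1` the vertex `v_{t+1}` is added; it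
links to `v_s`, `1 ≤ s ≤ t`, if it lies in the sphere of influence of `v_s` at time `t`, the ball of
volume `(A₁ deg⁻(v_s, t) + A₂) / t` about `v_s`, and if the coin of the pair shows success, which
has probability `p`. -/
def edges {m : ℕ} (q : ℝ≥0∞) (p A₁ A₂ : ℝ) (ω : Sample m) : ℕ → Finset (ℕ × ℕ)
  | 0 => ∅
  | t + 1 =>
    edges q p A₁ A₂ ω t ∪
      ((Finset.Icc 1 t).filter fun s =>
        ω.1 (t + 1) ∈ ballOfVolume q (ω.1 s)
            ((A₁ * (inDegree (edges q p A₁ A₂ ω t) s : ℝ) + A₂) / (t : ℝ)) ∧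
          (ω.2 (t + 1, s) : ℝ) < p).image fun s => (t + 1, s)

/-- The threshold `r_α = (n ^ (-α) / c_m) ^ (1 / m)` for the length of a long edge. -/
def longRadius (m : ℕ) (q : ℝ≥0∞) (α : ℝ) (n : ℕ) : ℝ :=
  ((n : ℝ) ^ (-α) / unitBallVolume m q) ^ (1 / (m : ℝ))

open Classical in
/-- The number `e(α)` of long edges of `G_n`. -/
def longEdges {m : ℕ} (q : ℝ≥0∞) (p A₁ A₂ α : ℝ) (n : ℕ) (ω : Sample m) : ℕ :=
  ((edges q p A₁ A₂ ω n).filter fun e =>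
    longRadius m q α n ≤ torusDist q (ω.1 e.1) (ω.1 e.2)).card

/-- Asymptotically almost surely `X n = (1 + o(1)) f n`: for every `ε > 0`, the probability that
`X n` is within the factor `1 ± ε` of `f n` tends to one. -/
def AASEquivalent {Ω : Type*} [MeasurableSpace Ω] (μ : Measure Ω) (X : ℕ → Ω → ℝ) (f : ℕ → ℝ) :
    Prop :=
  ∀ ε : ℝ, 0 < ε →
    Tendsto (fun n => μ {ω | |X n ω - f n| ≤ ε * f n}) atTop (𝓝 1)

/-- The constant in the middle range. -/
def midConstant (p A₁ A₂ : ℝ) : ℝ :=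
  Real.Gamma (A₂ / A₁ + 1 / (p * A₁)) / Real.Gamma (A₂ / A₁) *
    (A₁ ^ ((1 - p * A₁) / (p * A₁)) / (1 - p * A₁)) *
      ((1 - p * A₁) ^ 3 / (2 * (p * A₁) - 1) + 1 - (p * A₁) * (1 - p * A₁))

end SPA

end

/-! Write a = p·A₁, b = A₂/A₁ and s = 1/a − 1. The radius of a torus ball of given volume does not
depend on its centre. Hence, given the first t steps, v_{t+1} links to a vertex of in-degree k with
probability p·min(1, (A₁k + A₂)/t), and does so over a distance at least R with probability
p·(min(1, (A₁k + A₂)/t) − ν)₊, where ν is the volume of the R-ball. Both depend on k alone. So each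
single in-degree is a Markov chain, although different in-degrees are dependent, and `value` solves
its backward recursion for the expected number of future long in-links. The theorem then follows by
the second moment method.

Concentration. The long edges present at time t, plus the `value` of all present vertices, minus a
deterministic sequence, form a martingale (`base_add_condMean`), so the variance is at most the sum
of the second moments of the increments. One link is worth at most `growth n / growth (t + 1)`
(`valueDiff_bounds`), so the square of the number of spheres hit by v_{t+1} has to be controlled.
Each pair of hit spheres is charged to the larger one: centres of smaller hit spheres lie within
twice its radius, and outside rare events there are only O(k + log n) of them (`card_hit_le`). This
leaves second moments of in-degrees, of order (t/u)^{2a}, and the sum over u converges because 2a >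
1. The total is of order n^{2a} log² n (`exists_variance_bound`).

Mean. Instead of following the in-degree of every vertex through time, the recursion for `value` is
averaged over the limiting in-degree distribution `frac`. Stationarity of `frac` makes the averaged
recursion telescope (`lim_value_step`, `potentialMean_eq`), and the mean is p·∑_{t<n} (excess(tν) −
excess(t)) up to O(n^a), where excess(θ) is the mean of (A₁k + A₂ − θ)₊ under `frac`
(`exists_mean_bound`).

Asymptotics. For R = r_α one has ν = n^{-α}. The tails of `frac` are quotients of Gamma functions,
so excess(θ) ~ κ·θ^{-s} at infinity (`tendsto_excess`), while excess(0) = A₂/(1 − a). For α > 1 all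
arguments tn^{-α} tend to 0 and the sum is about n·excess(0); for α < 1 the power law applies to
most terms and gives the exponent 1 − s + αs. This exceeds a precisely when α > 1 − a, which the
assumed range implies. -/

noncomputable section

namespace SPA

/-! ### The torus as a group, and the volumes of its balls. -/

section

open scoped Pointwise

/-- The `L_q` norm is monotone in the norms of the coordinates. -/
lemma norm_toLp_mono {ι : Type*} [Fintype ι] {E F : Type*} [NormedAddCommGroup E]
    [NormedAddCommGroup F] {q : ℝ≥0∞} (hq : 1 ≤ q) {f : ι → E} {g : ι → F}
    (h : ∀ i, ‖f i‖ ≤ ‖g i‖) :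
    ‖(WithLp.toLp q f : PiLp q fun _ : ι => E)‖ ≤ ‖(WithLp.toLp q g : PiLp q fun _ : ι => F)‖ := by
  rcases eq_or_ne q ⊤ with rfl | hq'
  · rw [PiLp.norm_eq_ciSup, PiLp.norm_eq_ciSup]
    exact ciSup_mono (Set.finite_range _).bddAbove h
  · have h0 : 0 < q.toReal := ENNReal.toReal_pos (by positivity) hq'
    rw [PiLp.norm_eq_sum h0, PiLp.norm_eq_sum h0]
    apply Real.rpow_le_rpow (Finset.sum_nonneg fun i _ => by positivity) _ (by positivity)
    exact Finset.sum_le_sum fun i _ => Real.rpow_le_rpow (norm_nonneg _) (h i) h0.le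

lemma norm_toLp_congr {ι : Type*} [Fintype ι] {E F : Type*} [NormedAddCommGroup E]
    [NormedAddCommGroup F] {q : ℝ≥0∞} (hq : 1 ≤ q) {f : ι → E} {g : ι → F}
    (h : ∀ i, ‖f i‖ = ‖g i‖) :
    ‖(WithLp.toLp q f : PiLp q fun _ : ι => E)‖ = ‖(WithLp.toLp q g : PiLp q fun _ : ι => F)‖ :=
  le_antisymm (norm_toLp_mono hq fun i => (h i).le) (norm_toLp_mono hq fun i => (h i).ge)

/-- Each coordinate is bounded by the `L_q` norm. -/
lemma norm_coord_le_toLp {ι : Type*} [Fintype ι] {E : Type*} [NormedAddCommGroup E]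
    {q : ℝ≥0∞} (hq : 1 ≤ q) (f : ι → E) (i : ι) :
    ‖f i‖ ≤ ‖(WithLp.toLp q f : PiLp q fun _ : ι => E)‖ := by
  have : Fact (1 ≤ q) := ⟨hq⟩
  exact PiLp.norm_apply_le (WithLp.toLp q f : PiLp q fun _ : ι => E) i

instance : IsProbabilityMeasure (volume : Measure UnitAddCircle) := ⟨UnitAddCircle.measure_univ⟩

instance {m : ℕ} : IsProbabilityMeasure (volume : Measure (Fin m → UnitAddCircle)) :=
  inferInstanceAs (IsProbabilityMeasure (Measure.pi fun _ => volume))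

/-- The `L_q` norm on the torus, as a function on tuples. -/
def torusNorm {m : ℕ} (q : ℝ≥0∞) (z : Fin m → UnitAddCircle) : ℝ :=
  ‖(WithLp.toLp q z : PiLp q fun _ : Fin m => UnitAddCircle)‖

/-- The difference of two points of the cube in the torus. -/
def torusDiff {m : ℕ} (x y : Cube m) : Fin m → UnitAddCircle :=
  fun i => ((x i : ℝ) : UnitAddCircle) - ((y i : ℝ) : UnitAddCircle)

lemma circle_norm_le (z : ℝ) (u : ℝ) (hu : u ∈ ({-1, 0, 1} : Set ℝ)) :
    ‖(z : UnitAddCircle)‖ ≤ |z + u| := by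
  rw [UnitAddCircle.norm_eq]
  simp only [Set.mem_insert_iff, Set.mem_singleton_iff] at hu
  rcases hu with rfl | rfl | rfl
  · have := round_le z 1
    rwa [Int.cast_one, sub_eq_add_neg] at this
  · simpa using round_le z 0
  · simpa using round_le z (-1)

/-- Coordinates of the cube differ by at most 1, so the nearest integer to a difference is −1, 0 or
1: three shifts per coordinate suffice. -/
lemma circle_norm_attained (z : ℝ) (hz : |z| ≤ 1) :
    ∃ u ∈ ({-1, 0, 1} : Set ℝ), |z + u| = ‖(z : UnitAddCircle)‖ := by
  refine ⟨-(round z : ℝ), ?_, by rw [UnitAddCircle.norm_eq, sub_eq_add_neg]⟩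
  have h1 := abs_sub_round z
  rw [abs_le] at h1 hz
  have h2 : ((-2 : ℤ) : ℝ) < round z := by push_cast; linarith
  have h3 : (round z : ℝ) < ((2 : ℤ) : ℝ) := by push_cast; linarith
  have h2 := Int.cast_lt.mp h2
  have h3 := Int.cast_lt.mp h3
  have : round z = -1 ∨ round z = 0 ∨ round z = 1 := by omega
  rcases this with h | h | h <;> simp [h]

/-- The `L_q` norm is monotone in each coordinate, so the best shift can be chosen coordinate by
coordinate, which gives the quotient norm of the circle. The triangle inequality and translation
invariance then come from the group structure. -/
lemma torusDist_eq {m : ℕ} {q : ℝ≥0∞} (hq : 1 ≤ q) (x y : Cube m) :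
    torusDist q x y = torusNorm q (torusDiff x y) := by
  unfold torusDist torusNorm torusDiff
  have hcoe : ∀ i, ((x i : ℝ) : UnitAddCircle) - ((y i : ℝ) : UnitAddCircle)
      = (((x i : ℝ) - (y i : ℝ) : ℝ) : UnitAddCircle) := fun i => by simp
  have hle : ∀ i, |(x i : ℝ) - (y i : ℝ)| ≤ 1 := fun i => by
    have := (x i).2; have := (y i).2
    simp only [Set.mem_Icc] at *
    rw [abs_le]; constructor <;> linarith
  choose u hu hu' using fun i => circle_norm_attained _ (hle i)
  apply le_antisymm
  · refine (ciInf_le ⟨0, ?_⟩ fun i => ⟨u i, hu i⟩).trans (norm_toLp_mono hq fun i => ?_)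
    · rintro _ ⟨v, rfl⟩
      have : Fact (1 ≤ q) := ⟨hq⟩
      exact norm_nonneg (WithLp.toLp q _ : PiLp q fun _ : Fin m => ℝ)
    · rw [hcoe, ← hu', Real.norm_eq_abs]
  · have : Nonempty (Fin m → ({-1, 0, 1} : Set ℝ)) := ⟨fun _ => ⟨0, by simp⟩⟩
    refine le_ciInf fun v => norm_toLp_mono hq fun i => ?_
    rw [hcoe, Real.norm_eq_abs]
    exact circle_norm_le _ _ (v i).2

lemma torusNorm_nonneg {m : ℕ} {q : ℝ≥0∞} (hq : 1 ≤ q) (z : Fin m → UnitAddCircle) :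
    0 ≤ torusNorm q z := by
  have : Fact (1 ≤ q) := ⟨hq⟩
  exact norm_nonneg (WithLp.toLp q z : PiLp q fun _ : Fin m => UnitAddCircle)

lemma continuous_torusNorm {m : ℕ} {q : ℝ≥0∞} (hq : 1 ≤ q) :
    Continuous (torusNorm q : (Fin m → UnitAddCircle) → ℝ) := by
  have : Fact (1 ≤ q) := ⟨hq⟩
  unfold torusNorm
  exact continuous_norm.comp (PiLp.continuous_toLp q _)

lemma measurable_torusDiff {m : ℕ} :
    Measurable fun z : Cube m × Cube m => torusDiff z.1 z.2 := by
  have : Continuous fun z : Cube m × Cube m => torusDiff z.1 z.2 := by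
    refine continuous_pi fun i => ?_
    have h : Continuous fun x : ℝ => (x : UnitAddCircle) := AddCircle.continuous_mk' 1
    exact (h.comp (by fun_prop)).sub (h.comp (by fun_prop))
  exact this.measurable

lemma measurable_torusDist {m : ℕ} {q : ℝ≥0∞} (hq : 1 ≤ q) :
    Measurable fun z : Cube m × Cube m => torusDist q z.1 z.2 := by
  simp_rw [torusDist_eq hq]
  exact (continuous_torusNorm hq).measurable.comp measurable_torusDiff

lemma measurable_torusDist_right {m : ℕ} {q : ℝ≥0∞} (hq : 1 ≤ q) (x : Cube m) :
    Measurable fun y : Cube m => torusDist q x y :=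
  (measurable_torusDist hq).comp (g := fun z : Cube m × Cube m => torusDist q z.1 z.2)
    (f := fun y : Cube m => (x, y)) (measurable_const.prodMk measurable_id)

lemma torusDist_comm {m : ℕ} {q : ℝ≥0∞} (hq : 1 ≤ q) (x y : Cube m) :
    torusDist q x y = torusDist q y x := by
  rw [torusDist_eq hq, torusDist_eq hq]
  exact norm_toLp_congr hq fun i => norm_sub_rev _ _

lemma torusDist_triangle {m : ℕ} {q : ℝ≥0∞} (hq : 1 ≤ q) (x y z : Cube m) :
    torusDist q x z ≤ torusDist q x y + torusDist q y z := by
  have : Fact (1 ≤ q) := ⟨hq⟩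
  rw [torusDist_eq hq, torusDist_eq hq, torusDist_eq hq]
  have : torusDiff x z = torusDiff x y + torusDiff y z := by
    funext i; simp [torusDiff]
  unfold torusNorm
  rw [this, WithLp.toLp_add]
  exact norm_add_le _ _

lemma measurePreserving_unitInterval_circle (x : ℝ) :
    MeasurePreserving (fun y : unitInterval => (x : UnitAddCircle) - ((y : ℝ) : UnitAddCircle)) := by
  have h1 : MeasurePreserving (Subtype.val : unitInterval → ℝ) volume
      (volume.restrict (Set.Icc (0 : ℝ) 1)) := measurePreserving_subtype_coe measurableSet_Icc
  have h2 := UnitAddCircle.measurePreserving_mk 0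
  rw [zero_add, restrict_Ioc_eq_restrict_Icc] at h2
  exact (Measure.measurePreserving_sub_left volume (x : UnitAddCircle)).comp (h2.comp h1)

/-- Valid for every centre `x`: this is why ball volumes do not depend on the centre. -/
lemma measurePreserving_torusDiff {m : ℕ} (x : Cube m) :
    MeasurePreserving (fun y : Cube m => torusDiff x y) :=
  measurePreserving_pi (fun _ => volume) (fun _ => volume)
    fun i => measurePreserving_unitInterval_circle (x i)

/-- The volume of the torus ball of radius `r`. -/
def ballVolume (m : ℕ) (q : ℝ≥0∞) (r : ℝ) : ℝ :=
  volume.real {z : Fin m → UnitAddCircle | torusNorm q z ≤ r}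

lemma volume_torusBall {m : ℕ} {q : ℝ≥0∞} (hq : 1 ≤ q) (x : Cube m) (r : ℝ) :
    volume.real (torusBall q x r) = ballVolume m q r := by
  have hS : MeasurableSet {z : Fin m → UnitAddCircle | torusNorm q z ≤ r} :=
    measurableSet_le (continuous_torusNorm hq).measurable measurable_const
  rw [ballVolume, measureReal_def, measureReal_def,
    ← (measurePreserving_torusDiff x).measure_preimage hS.nullMeasurableSet]
  simp only [torusBall, torusDist_eq hq, Set.preimage_ofPred_eq]

/-- The half-open box that represents the torus. -/
def box (m : ℕ) : Set (Fin m → ℝ) := Set.univ.pi fun _ => Set.Ioc (-(1 / 2)) (1 / 2)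

/-- On the box the circle norm of a coordinate is its absolute value. The intersection with the box
accounts for the wrap-around and permits scaling arguments in ℝ^m. -/
lemma ballVolume_eq_box {m : ℕ} {q : ℝ≥0∞} (hq : 1 ≤ q) (r : ℝ) :
    ballVolume m q r = volume.real ({z : Fin m → ℝ | ‖WithLp.toLp q z‖ ≤ r} ∩ box m) := by
  have h2 := UnitAddCircle.measurePreserving_mk (-(1 / 2))
  rw [show -(1 / 2 : ℝ) + 1 = 1 / 2 by norm_num] at h2
  have h3 := measurePreserving_pi (fun _ : Fin m => volume.restrict (Set.Ioc (-(1 / 2 : ℝ)) (1 / 2)))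
    (fun _ => volume) fun _ => h2
  have hS : MeasurableSet {z : Fin m → UnitAddCircle | torusNorm q z ≤ r} :=
    measurableSet_le (continuous_torusNorm hq).measurable measurable_const
  have : Fact (1 ≤ q) := ⟨hq⟩
  rw [ballVolume, measureReal_def, measureReal_def]
  change (Measure.pi (fun _ : Fin m => (volume : Measure UnitAddCircle)) _).toReal = _
  rw [← h3.measure_preimage hS.nullMeasurableSet, ← Measure.restrict_pi_pi,
    Measure.restrict_apply' (MeasurableSet.univ_pi fun _ => measurableSet_Ioc)]
  congr 2
  ext z
  simp only [Set.mem_inter_iff, Set.preimage_ofPred_eq, Set.mem_ofPred_eq, box, and_congr_left_iff]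
  intro hz
  rw [torusNorm, norm_toLp_congr hq (g := z)]
  intro i
  have := hz i (Set.mem_univ _)
  simp only [Set.mem_Ioc] at this
  rw [Real.norm_eq_abs]
  refine (AddCircle.norm_coe_eq_abs_iff (p := 1) one_ne_zero).mpr ?_
  rw [abs_le]; norm_num; constructor <;> linarith

lemma ballVolume_mono {m : ℕ} {q : ℝ≥0∞} {r s : ℝ} (h : r ≤ s) :
    ballVolume m q r ≤ ballVolume m q s :=
  measureReal_mono fun _ hz => le_trans hz h

lemma ballVolume_nonneg {m : ℕ} {q : ℝ≥0∞} (r : ℝ) : 0 ≤ ballVolume m q r := measureReal_nonneg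

lemma ballVolume_le_one {m : ℕ} {q : ℝ≥0∞} (r : ℝ) : ballVolume m q r ≤ 1 := measureReal_le_one

lemma box_volume_lt_top (m : ℕ) (s : Set (Fin m → ℝ)) : volume (s ∩ box m) < ⊤ := by
  refine (measure_mono Set.inter_subset_right).trans_lt ?_
  rw [box, volume_pi_pi]
  exact ENNReal.prod_lt_top fun i _ => by simp

lemma norm_toLp_smul {m : ℕ} {q : ℝ≥0∞} (hq : 1 ≤ q) (c : ℝ) (z : Fin m → ℝ) :
    ‖WithLp.toLp q (c • z)‖ = |c| * ‖WithLp.toLp q z‖ := by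
  have : Fact (1 ≤ q) := ⟨hq⟩
  rw [WithLp.toLp_smul]
  exact norm_smul c (WithLp.toLp q z : PiLp q fun _ : Fin m => ℝ)

/-- The box is star-shaped about 0, so shrinking by `l` maps the larger truncated ball into the
smaller one. This inequality is the source of the continuity of the volume, of the doubling bound
and of `unitBallVolume_pos`. -/
lemma ballVolume_mul_le {m : ℕ} {q : ℝ≥0∞} (hq : 1 ≤ q) {l r : ℝ} (hl : 1 ≤ l) :
    ballVolume m q (l * r) ≤ l ^ m * ballVolume m q r := by
  have hl0 : 0 < l := by linarith
  rw [ballVolume_eq_box hq, ballVolume_eq_box hq]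
  have : {z : Fin m → ℝ | ‖WithLp.toLp q z‖ ≤ l * r} ∩ box m
      ⊆ l • ({z : Fin m → ℝ | ‖WithLp.toLp q z‖ ≤ r} ∩ box m) := by
    rintro z ⟨hz, hz'⟩
    rw [Set.mem_smul_set_iff_inv_smul_mem₀ hl0.ne']
    refine ⟨?_, fun i _ => ?_⟩
    · simp only [Set.mem_ofPred_eq] at hz ⊢
      rw [norm_toLp_smul hq, abs_of_pos (by positivity), inv_mul_le_iff₀ hl0]
      exact hz
    · have := hz' i (Set.mem_univ _)
      simp only [Set.mem_Ioc, Pi.smul_apply, smul_eq_mul] at this ⊢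
      rw [lt_inv_mul_iff₀ hl0, inv_mul_le_iff₀ hl0]
      constructor <;> nlinarith
  have hfin : volume (l • ({z : Fin m → ℝ | ‖WithLp.toLp q z‖ ≤ r} ∩ box m)) ≠ ⊤ := by
    rw [Measure.addHaar_smul]
    exact ENNReal.mul_ne_top (by simp) (box_volume_lt_top m _).ne
  refine (measureReal_mono this hfin).trans ?_
  rw [measureReal_def, Measure.addHaar_smul, ENNReal.toReal_mul,
    ENNReal.toReal_ofReal (abs_nonneg _), Module.finrank_fin_fun, abs_of_pos (by positivity),
    measureReal_def]

lemma ballVolume_le_pow {m : ℕ} {q : ℝ≥0∞} (hq : 1 ≤ q) {r : ℝ} (hr : 0 ≤ r) :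
    ballVolume m q r ≤ (2 * r) ^ m := by
  rw [ballVolume_eq_box hq]
  have : {z : Fin m → ℝ | ‖WithLp.toLp q z‖ ≤ r} ∩ box m ⊆ Set.univ.pi fun _ => Set.Icc (-r) r := by
    rintro z ⟨hz, -⟩ i -
    have := (norm_coord_le_toLp hq z i).trans hz
    rwa [Real.norm_eq_abs, abs_le] at this
  refine (measureReal_mono this ?_).trans ?_
  · rw [volume_pi_pi]
    exact (ENNReal.prod_lt_top fun i _ => by simp).ne
  · rw [measureReal_def, volume_pi_pi]
    simp only [Real.volume_Icc, Finset.prod_const, Finset.card_univ, Fintype.card_fin,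
      ENNReal.toReal_pow]
    rw [ENNReal.toReal_ofReal (by linarith), sub_neg_eq_add, ← two_mul]

lemma ballVolume_eq_unit {m : ℕ} {q : ℝ≥0∞} (hq : 1 ≤ q) {r : ℝ} (hr : 0 < r) (hr' : r < 1 / 2) :
    ballVolume m q r = unitBallVolume m q * r ^ m := by
  rw [ballVolume_eq_box hq, unitBallVolume]
  have : {z : Fin m → ℝ | ‖WithLp.toLp q z‖ ≤ r} ∩ box m
      = r • {z : Fin m → ℝ | ‖WithLp.toLp q z‖ ≤ 1} := by
    ext z
    rw [Set.mem_smul_set_iff_inv_smul_mem₀ hr.ne']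
    simp only [Set.mem_inter_iff, Set.mem_ofPred_eq]
    rw [norm_toLp_smul hq, abs_of_pos (by positivity), inv_mul_le_iff₀ hr, mul_one]
    refine ⟨fun h => h.1, fun h => ⟨h, fun i _ => ?_⟩⟩
    have := (norm_coord_le_toLp hq z i).trans h
    rw [Real.norm_eq_abs, abs_le] at this
    exact ⟨by linarith, by linarith⟩
  rw [this, measureReal_def, Measure.addHaar_smul, ENNReal.toReal_mul,
    ENNReal.toReal_ofReal (abs_nonneg _), Module.finrank_fin_fun, abs_of_pos (by positivity),
    measureReal_def, mul_comm]

lemma exists_ballVolume_eq_one {m : ℕ} {q : ℝ≥0∞} (hq : 1 ≤ q) :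
    ∃ r : ℝ, 0 ≤ r ∧ ballVolume m q r = 1 := by
  refine ⟨torusNorm q (fun _ : Fin m => ((1 / 2 : ℝ) : UnitAddCircle)), torusNorm_nonneg hq _, ?_⟩
  have : {z : Fin m → UnitAddCircle | torusNorm q z
      ≤ torusNorm q (fun _ : Fin m => ((1 / 2 : ℝ) : UnitAddCircle))} = Set.univ := by
    refine Set.eq_univ_of_forall fun z => norm_toLp_mono hq fun i => ?_
    have h1 := AddCircle.norm_le_half_period (1 : ℝ) (x := z i) one_ne_zero
    have h2 : ‖((1 / 2 : ℝ) : UnitAddCircle)‖ = |1 / 2| :=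
      (AddCircle.norm_coe_eq_abs_iff (p := 1) one_ne_zero).mpr (by norm_num)
    rw [h2]; norm_num at h1 ⊢; exact h1
  rw [ballVolume, this, measureReal_def, measure_univ, ENNReal.toReal_one]

lemma ballVolume_neg {m : ℕ} {q : ℝ≥0∞} (hq : 1 ≤ q) {r : ℝ} (hr : r < 0) :
    ballVolume m q r = 0 := by
  have : {z : Fin m → UnitAddCircle | torusNorm q z ≤ r} = ∅ :=
    Set.eq_empty_of_forall_notMem fun z hz => absurd (torusNorm_nonneg hq z) (by
      have : torusNorm q z ≤ r := hz
      linarith)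
  rw [ballVolume, this]; simp

/-- Otherwise the ball of radius 1/4 would be null, and by dilation so would every larger ball,
although one of them fills the torus. -/
lemma unitBallVolume_pos {m : ℕ} {q : ℝ≥0∞} (hq : 1 ≤ q) : 0 < unitBallVolume m q := by
  obtain ⟨r, hr, h1⟩ := exists_ballVolume_eq_one (m := m) hq
  by_contra h
  have h0 := ballVolume_eq_unit (m := m) hq (r := 1 / 4) (by norm_num) (by norm_num)
  have h2 : ballVolume m q (1 / 4) ≤ 0 := by
    rw [h0]; exact mul_nonpos_of_nonpos_of_nonneg (not_lt.mp h) (by positivity)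
  have h3 := ballVolume_mul_le (m := m) hq (l := 1 + 4 * r) (r := 1 / 4) (by linarith)
  have h4 : ballVolume m q r ≤ ballVolume m q ((1 + 4 * r) * (1 / 4)) := ballVolume_mono (by linarith)
  have : (1 + 4 * r) ^ m * ballVolume m q (1 / 4) ≤ 0 :=
    mul_nonpos_of_nonneg_of_nonpos (by positivity) h2
  linarith

/-- The common radius of the torus balls of volume `V`. -/
def radius (m : ℕ) (q : ℝ≥0∞) (V : ℝ) : ℝ := sInf {r : ℝ | 0 ≤ r ∧ V ≤ ballVolume m q r}

lemma radiusOfVolume_eq {m : ℕ} {q : ℝ≥0∞} (hq : 1 ≤ q) (x : Cube m) (V : ℝ) :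
    radiusOfVolume q x V = radius m q V := by
  simp only [radiusOfVolume, radius, volume_torusBall hq]

lemma radius_nonneg {m : ℕ} {q : ℝ≥0∞} (V : ℝ) : 0 ≤ radius m q V :=
  Real.sInf_nonneg fun _ h => h.1

lemma le_ballVolume_of_radius_lt {m : ℕ} {q : ℝ≥0∞} (hq : 1 ≤ q) {V r : ℝ} (hV : V ≤ 1)
    (h : radius m q V < r) : V ≤ ballVolume m q r := by
  obtain ⟨R, hR, h1⟩ := exists_ballVolume_eq_one (m := m) hq
  have hne : {r : ℝ | 0 ≤ r ∧ V ≤ ballVolume m q r}.Nonempty := ⟨R, hR, by rw [h1]; exact hV⟩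
  obtain ⟨s, hs, hsr⟩ := exists_lt_of_csInf_lt hne h
  exact hs.2.trans (ballVolume_mono hsr.le)

lemma ballVolume_lt_of_lt_radius {m : ℕ} {q : ℝ≥0∞} {V r : ℝ} (hr : 0 ≤ r)
    (h : r < radius m q V) : ballVolume m q r < V := by
  by_contra hV
  have hb : BddBelow {r : ℝ | 0 ≤ r ∧ V ≤ ballVolume m q r} := ⟨0, fun _ h => h.1⟩
  exact absurd (csInf_le hb ⟨hr, not_lt.mp hV⟩) (not_le.mpr h)

lemma radius_mono {m : ℕ} {q : ℝ≥0∞} (hq : 1 ≤ q) {V W : ℝ} (h : V ≤ W) (hW : W ≤ 1) :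
    radius m q V ≤ radius m q W := by
  obtain ⟨R, hR, h1⟩ := exists_ballVolume_eq_one (m := m) hq
  have hb : BddBelow {r : ℝ | 0 ≤ r ∧ V ≤ ballVolume m q r} := ⟨0, fun _ h => h.1⟩
  exact csInf_le_csInf hb ⟨R, hR, by rw [h1]; exact hW⟩ fun r hr => ⟨hr.1, h.trans hr.2⟩

lemma tendsto_pow_mul_one (m : ℕ) (c : ℝ) :
    Tendsto (fun l : ℝ => l ^ m * c) (𝓝[>] 1) (𝓝 c) := by
  have : ContinuousAt (fun l : ℝ => l ^ m * c) 1 := by fun_prop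
  have := this.tendsto
  simp only [one_pow, one_mul] at this
  exact this.mono_left nhdsWithin_le_nhds

lemma radius_pos {m : ℕ} (hm : 1 ≤ m) {q : ℝ≥0∞} (hq : 1 ≤ q) {V : ℝ} (hV : 0 < V) (hV1 : V ≤ 1) :
    0 < radius m q V := by
  refine (radius_nonneg V).lt_of_ne fun h => ?_
  have key : ∀ r : ℝ, 0 < r → V ≤ (2 * r) ^ m := fun r hr =>
    (le_ballVolume_of_radius_lt hq hV1 (by rw [← h]; exact hr)).trans (ballVolume_le_pow hq hr.le)
  have h1 := key (V / 4) (by positivity)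
  have h2 : (2 * (V / 4)) ^ m ≤ (2 * (V / 4)) ^ 1 :=
    pow_le_pow_of_le_one (by positivity) (by linarith) hm
  rw [pow_one] at h2
  linarith

/-- Equality could fail only at a jump of the volume. Comparison of the radius ρ with ρ/l and with
lρ bounds a jump by the factor l^m, and l → 1. -/
lemma ballVolume_radius {m : ℕ} (hm : 1 ≤ m) {q : ℝ≥0∞} (hq : 1 ≤ q) {V : ℝ} (hV : 0 < V)
    (hV1 : V ≤ 1) : ballVolume m q (radius m q V) = V := by
  have hρ := radius_pos hm hq hV hV1
  apply le_antisymm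
  · refine ge_of_tendsto (tendsto_pow_mul_one m V) ?_
    filter_upwards [self_mem_nhdsWithin] with l hl
    have hl : 1 < l := hl
    have h1 : radius m q V / l < radius m q V := div_lt_self hρ hl
    have h2 := (ballVolume_lt_of_lt_radius (div_nonneg hρ.le (by linarith)) h1).le
    calc ballVolume m q (radius m q V) = ballVolume m q (l * (radius m q V / l)) := by
          rw [mul_div_cancel₀ _ (by linarith : l ≠ 0)]
      _ ≤ l ^ m * ballVolume m q (radius m q V / l) := ballVolume_mul_le hq hl.le
      _ ≤ l ^ m * V := by gcongr
  · refine ge_of_tendsto (tendsto_pow_mul_one m (ballVolume m q (radius m q V))) ?_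
    filter_upwards [self_mem_nhdsWithin] with l hl
    have hl : 1 < l := hl
    exact (le_ballVolume_of_radius_lt hq hV1 (lt_mul_of_one_lt_left hρ hl)).trans
      (ballVolume_mul_le hq hl.le)

/-- Open and closed torus balls have the same volume. -/
lemma volume_torusDist_lt {m : ℕ} (hm : 1 ≤ m) {q : ℝ≥0∞} (hq : 1 ≤ q) (x : Cube m) (r : ℝ) :
    volume.real {y | torusDist q x y < r} = ballVolume m q r := by
  have hmeas : Measurable fun y : Cube m => torusDist q x y :=
    measurable_torusDist_right hq x
  apply le_antisymm
  · rw [← volume_torusBall hq x]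
    exact measureReal_mono fun y hy => (show torusDist q x y < r from hy).le
  · rcases lt_trichotomy r 0 with hr | rfl | hr
    · rw [ballVolume_neg hq hr]; exact measureReal_nonneg
    · refine (ballVolume_le_pow hq le_rfl).trans ?_
      rw [mul_zero, zero_pow (by omega)]; exact measureReal_nonneg
    · refine ge_of_tendsto (tendsto_pow_mul_one m (volume.real {y | torusDist q x y < r})) ?_
      filter_upwards [self_mem_nhdsWithin] with l hl
      have hl : 1 < l := hl
      calc ballVolume m q r = ballVolume m q (l * (r / l)) := by
            rw [mul_div_cancel₀ _ (by linarith : l ≠ 0)]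
        _ ≤ l ^ m * ballVolume m q (r / l) := ballVolume_mul_le hq hl.le
        _ ≤ _ := by
          rw [← volume_torusBall hq x]
          gcongr
          · simp
          · intro y hy
            exact lt_of_le_of_lt hy (div_lt_self hr hl)

lemma mem_ballOfVolume {m : ℕ} {q : ℝ≥0∞} (hq : 1 ≤ q) (x y : Cube m) (V : ℝ) :
    y ∈ ballOfVolume q x V ↔ 1 < V ∨ torusDist q x y ≤ radius m q V := by
  unfold ballOfVolume
  split_ifs with h
  · simp [h]
  · simp only [h, torusBall, Set.mem_ofPred_eq, radiusOfVolume_eq hq, false_or]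

lemma volume_ballOfVolume {m : ℕ} (hm : 1 ≤ m) {q : ℝ≥0∞} (hq : 1 ≤ q) (x : Cube m) {V : ℝ}
    (hV : 0 < V) : volume.real (ballOfVolume q x V) = min 1 V := by
  unfold ballOfVolume
  split_ifs with h
  · rw [min_eq_left h.le]; simp
  · rw [volume_torusBall hq, radiusOfVolume_eq hq, ballVolume_radius hm hq hV (not_lt.mp h),
      min_eq_right (not_lt.mp h)]

lemma measurableSet_ballOfVolume {m : ℕ} {q : ℝ≥0∞} (hq : 1 ≤ q) (x : Cube m) (V : ℝ) :
    MeasurableSet (ballOfVolume q x V) := by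
  have hmeas : Measurable fun y : Cube m => torusDist q x y :=
    measurable_torusDist_right hq x
  unfold ballOfVolume
  split_ifs with h
  · exact MeasurableSet.univ
  · exact measurableSet_le hmeas measurable_const

/-- The volume of the part of a sphere of influence that is far from its centre. -/
lemma volume_ballOfVolume_far {m : ℕ} (hm : 1 ≤ m) {q : ℝ≥0∞} (hq : 1 ≤ q) (x : Cube m) {V : ℝ}
    (hV : 0 < V) (R : ℝ) :
    volume.real (ballOfVolume q x V ∩ {y | R ≤ torusDist q x y})
      = max 0 (min 1 V - ballVolume m q R) := by
  have hmeas : Measurable fun y : Cube m => torusDist q x y :=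
    measurable_torusDist_right hq x
  have hopen : MeasurableSet {y | torusDist q x y < R} := measurableSet_lt hmeas measurable_const
  have heq : ballOfVolume q x V ∩ {y | R ≤ torusDist q x y}
      = ballOfVolume q x V \ {y | torusDist q x y < R} := by
    ext y; simp [not_lt]
  -- If the open `R`-ball lies inside the sphere of influence, the volumes subtract. In the only
  -- other case the far part is empty and the maximum is 0.
  have hsub : {y | torusDist q x y < R} ⊆ ballOfVolume q x V →
      volume.real (ballOfVolume q x V ∩ {y | R ≤ torusDist q x y})
        = max 0 (min 1 V - ballVolume m q R) := fun h => by
    have h1 := measureReal_mono (μ := volume) h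
    rw [volume_torusDist_lt hm hq, volume_ballOfVolume hm hq x hV] at h1
    rw [heq, measureReal_sdiff h hopen, volume_torusDist_lt hm hq, volume_ballOfVolume hm hq x hV,
      max_eq_right (by linarith)]
  by_cases h1 : 1 < V
  · exact hsub fun y _ => (mem_ballOfVolume hq x y V).mpr (Or.inl h1)
  · rcases le_or_gt R (radius m q V) with hR | hR
    · exact hsub fun y hy => (mem_ballOfVolume hq x y V).mpr
        (Or.inr ((show torusDist q x y < R from hy).le.trans hR))
    · have he : ballOfVolume q x V ∩ {y | R ≤ torusDist q x y} = ∅ := by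
        refine Set.eq_empty_of_forall_notMem fun y hy => ?_
        rcases (mem_ballOfVolume hq x y V).mp hy.1 with h | h
        · exact h1 h
        · have : R ≤ torusDist q x y := hy.2
          linarith
      have h2 := ballVolume_radius hm hq hV (not_lt.mp h1)
      have h3 := ballVolume_mono (m := m) (q := q) hR.le
      rw [he, measureReal_empty, min_eq_right (not_lt.mp h1), max_eq_left (by linarith)]

/-- The torus ball of radius `r_α` has volume `n ^ (-α)`, for large `n`. -/
lemma eventually_ballVolume_longRadius {m : ℕ} (hm : 1 ≤ m) {q : ℝ≥0∞} (hq : 1 ≤ q) {α : ℝ}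
    (hα : 0 < α) :
    ∀ᶠ n : ℕ in atTop, ballVolume m q (longRadius m q α n) = (n : ℝ) ^ (-α) := by
  have hc := unitBallVolume_pos (m := m) hq
  have hm' : (0 : ℝ) < 1 / m := by positivity
  have hlim : Tendsto (fun n : ℕ => longRadius m q α n) atTop (𝓝 0) := by
    have h1 : Tendsto (fun n : ℕ => (n : ℝ) ^ (-α)) atTop (𝓝 0) :=
      (tendsto_rpow_neg_atTop hα).comp tendsto_natCast_atTop_atTop
    have h2 := (h1.div_const (unitBallVolume m q)).rpow_const (p := 1 / (m : ℝ)) (Or.inr hm'.le)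
    rwa [zero_div, Real.zero_rpow hm'.ne'] at h2
  filter_upwards [hlim.eventually_lt_const (show (0 : ℝ) < 1 / 2 by norm_num),
    eventually_ge_atTop 1] with n hn hn1
  have hn0 : (0 : ℝ) < n := by exact_mod_cast hn1
  have hb : 0 < (n : ℝ) ^ (-α) / unitBallVolume m q := div_pos (Real.rpow_pos_of_pos hn0 _) hc
  rw [ballVolume_eq_unit hq (by unfold longRadius; exact Real.rpow_pos_of_pos hb _) hn, longRadius, ← Real.rpow_natCast,
    ← Real.rpow_mul hb.le, one_div_mul_cancel (by positivity), Real.rpow_one,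
    mul_div_cancel₀ _ hc.ne']

end

/-! ### Parameters, and resampling of the randomness after time t. -/

/-- The parameters of the process, in the supercritical range. -/
structure Params where
  m : ℕ
  hm : 1 ≤ m
  q : ℝ≥0∞
  hq : 1 ≤ q
  p : ℝ
  A₁ : ℝ
  A₂ : ℝ
  hp₀ : 0 ≤ p
  hp₁ : p ≤ 1
  hA₁ : 0 < A₁
  hA₂ : 0 < A₂
  hlow : 1 / 2 < p * A₁
  hhigh : p * A₁ < 1

instance {m : ℕ} : IsProbabilityMeasure (law m) := by unfold law; infer_instance

/-- Combine the first family on the index set `S` with the second family off `S`. -/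
lemma measurePreserving_piecewise {ι X : Type*} [MeasurableSpace X] (μ : Measure X)
    [IsProbabilityMeasure μ] (S : Set ι) [DecidablePred (· ∈ S)] :
    MeasurePreserving (fun z : (ι → X) × (ι → X) => S.piecewise z.1 z.2)
      ((Measure.infinitePi fun _ : ι => μ).prod (Measure.infinitePi fun _ : ι => μ))
      (Measure.infinitePi fun _ : ι => μ) := by
  have hmeas : Measurable fun z : (ι → X) × (ι → X) => S.piecewise z.1 z.2 := by
    refine measurable_pi_lambda _ fun i => ?_
    by_cases h : i ∈ S
    · simp only [Set.piecewise_eq_of_mem _ _ _ h]; fun_prop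
    · simp only [Set.piecewise_eq_of_notMem _ _ _ h]; fun_prop
  refine ⟨hmeas, Measure.eq_infinitePi _ fun s t ht => ?_⟩
  rw [Measure.map_apply hmeas (MeasurableSet.pi s.countable_toSet fun i _ => ht i)]
  have : (fun z : (ι → X) × (ι → X) => S.piecewise z.1 z.2) ⁻¹' (Set.pi (↑s) t)
      = (Set.pi (↑(s.filter (· ∈ S))) t) ×ˢ (Set.pi (↑(s.filter (· ∉ S))) t) := by
    ext z
    simp only [Set.mem_preimage, Set.mem_pi, Set.mem_prod, Finset.coe_filter, Set.mem_ofPred_eq,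
      Finset.mem_coe]
    constructor
    · intro h
      exact ⟨fun i hi => by simpa [hi.2] using h i hi.1, fun i hi => by simpa [hi.2] using h i hi.1⟩
    · intro h i hi
      by_cases hS : i ∈ S
      · simpa [hS] using h.1 i ⟨hi, hS⟩
      · simpa [hS] using h.2 i ⟨hi, hS⟩
  rw [this, Measure.prod_prod, Measure.infinitePi_pi _ fun i _ => ht i,
    Measure.infinitePi_pi _ fun i _ => ht i, Finset.prod_filter_mul_prod_filter_not]

lemma measurePreserving_prod_shuffle {α β γ δ : Type*} [MeasurableSpace α] [MeasurableSpace β]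
    [MeasurableSpace γ] [MeasurableSpace δ] (μ : Measure α) (ν : Measure β) (ρ : Measure γ)
    (σ : Measure δ) [SFinite μ] [SFinite ν] [SFinite ρ] [SFinite σ] :
    MeasurePreserving (fun z : (α × β) × (γ × δ) => ((z.1.1, z.2.1), (z.1.2, z.2.2)))
      ((μ.prod ν).prod (ρ.prod σ)) ((μ.prod ρ).prod (ν.prod σ)) := by
  have h1 := measurePreserving_prodAssoc μ ν (ρ.prod σ)
  have h2 := (MeasurePreserving.id μ).prod ((measurePreserving_prodAssoc ν ρ σ).symm)
  have h3 := (MeasurePreserving.id μ).prod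
    ((Measure.measurePreserving_swap (μ := ν) (ν := ρ)).prod (MeasurePreserving.id σ))
  have h4 := (MeasurePreserving.id μ).prod (measurePreserving_prodAssoc ρ ν σ)
  have h5 := (measurePreserving_prodAssoc μ ρ (ν.prod σ)).symm
  exact h5.comp (h4.comp (h3.comp (h2.comp h1)))

/-- Keep the randomness of the first `t` steps from `ω` and take the rest from `ω'`. -/
def splice {m : ℕ} (t : ℕ) (ω ω' : Sample m) : Sample m :=
  ((Set.Iic t).piecewise ω.1 ω'.1, {e : ℕ × ℕ | e.1 ≤ t}.piecewise ω.2 ω'.2)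

lemma splice_pos_of_le {m t i : ℕ} (ω ω' : Sample m) (h : i ≤ t) :
    (splice t ω ω').1 i = ω.1 i := by
  simp [splice, h]

lemma splice_pos_of_lt {m t i : ℕ} (ω ω' : Sample m) (h : t < i) :
    (splice t ω ω').1 i = ω'.1 i := by
  simp [splice, h]

lemma splice_coin_of_le {m t i j : ℕ} (ω ω' : Sample m) (h : i ≤ t) :
    (splice t ω ω').2 (i, j) = ω.2 (i, j) := by
  simp [splice, h]

lemma splice_coin_of_lt {m t i j : ℕ} (ω ω' : Sample m) (h : t < i) :
    (splice t ω ω').2 (i, j) = ω'.2 (i, j) := by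
  simp [splice, h]

/-- Integrating out the second sample is therefore the same as conditioning on the first `t` steps;
`condMean` is built on this. -/
lemma measurePreserving_splice {m : ℕ} (t : ℕ) :
    MeasurePreserving (fun z : Sample m × Sample m => splice t z.1 z.2)
      ((law m).prod (law m)) (law m) := by
  have h1 := measurePreserving_piecewise (volume : Measure (Cube m)) (Set.Iic t)
  have h2 := measurePreserving_piecewise (volume : Measure unitInterval) {e : ℕ × ℕ | e.1 ≤ t}
  exact (h1.prod h2).comp (measurePreserving_prod_shuffle _ _ _ _)

lemma volume_coin_lt {p : ℝ} (hp₀ : 0 ≤ p) (hp₁ : p ≤ 1) :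
    volume.real {c : unitInterval | (c : ℝ) < p} = p := by
  have h := (measurePreserving_subtype_coe (μa := (volume : Measure ℝ))
    (measurableSet_Icc (a := (0 : ℝ)) (b := 1))).measure_preimage
    (measurableSet_Iio (a := p)).nullMeasurableSet
  have h2 : Set.Iio p ∩ Set.Icc (0 : ℝ) 1 = Set.Ico 0 p := by
    ext x; simp only [Set.mem_inter_iff, Set.mem_Iio, Set.mem_Icc, Set.mem_Ico]
    constructor
    · rintro ⟨h1, h2, -⟩; exact ⟨h2, h1⟩
    · rintro ⟨h1, h2⟩; exact ⟨h2, h1, by linarith⟩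
  rw [Measure.restrict_apply measurableSet_Iio, h2, Real.volume_Ico, sub_zero] at h
  rw [measureReal_def]
  change (Measure.comap Subtype.val volume (Subtype.val ⁻¹' Set.Iio p : Set unitInterval)).toReal = p
  rw [h, ENNReal.toReal_ofReal hp₀]

lemma law_pos {m : ℕ} (i : ℕ) {S : Set (Cube m)} (hS : MeasurableSet S) :
    (law m).real {ω | ω.1 i ∈ S} = volume.real S := by
  have h1 := (measurePreserving_eval_infinitePi (fun _ : ℕ => (volume : Measure (Cube m))) i).comp
    (measurePreserving_fst (μ := Measure.infinitePi fun _ : ℕ => (volume : Measure (Cube m)))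
      (ν := Measure.infinitePi fun _ : ℕ × ℕ => (volume : Measure unitInterval)))
  rw [measureReal_def, measureReal_def, ← h1.measure_preimage hS.nullMeasurableSet]
  rfl

lemma law_pos_coin {m : ℕ} (i : ℕ) (e : ℕ × ℕ) {S : Set (Cube m)} (hS : MeasurableSet S) {p : ℝ}
    (hp₀ : 0 ≤ p) (hp₁ : p ≤ 1) :
    (law m).real {ω | ω.1 i ∈ S ∧ (ω.2 e : ℝ) < p} = p * volume.real S := by
  have h1 := measurePreserving_eval_infinitePi (fun _ : ℕ => (volume : Measure (Cube m))) i
  have h2 := measurePreserving_eval_infinitePi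
    (fun _ : ℕ × ℕ => (volume : Measure unitInterval)) e
  have hc : MeasurableSet {c : unitInterval | (c : ℝ) < p} :=
    measurableSet_lt measurable_subtype_coe measurable_const
  have heq : {ω : Sample m | ω.1 i ∈ S ∧ (ω.2 e : ℝ) < p}
      = (Function.eval i ⁻¹' S) ×ˢ (Function.eval e ⁻¹' {c : unitInterval | (c : ℝ) < p}) := rfl
  rw [heq, law, measureReal_def, Measure.prod_prod, h1.measure_preimage hS.nullMeasurableSet,
    h2.measure_preimage hc.nullMeasurableSet, ENNReal.toReal_mul, ← measureReal_def,
    ← measureReal_def, volume_coin_lt hp₀ hp₁, mul_comm]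

open Classical in
lemma mem_edges {m : ℕ} {q : ℝ≥0∞} {p A₁ A₂ : ℝ} {ω : Sample m} {t : ℕ} {e : ℕ × ℕ}
    (h : e ∈ edges q p A₁ A₂ ω t) : 1 ≤ e.2 ∧ e.2 < e.1 ∧ e.1 ≤ t := by
  induction t with
  | zero => simp [edges] at h
  | succ t ih =>
    rw [edges, Finset.mem_union, Finset.mem_image] at h
    rcases h with h | ⟨s, hs, rfl⟩
    · have := ih h; omega
    · have := (Finset.mem_Icc.mp (Finset.mem_filter.mp hs).1); simp only; omega

open Classical in
lemma edges_splice {m : ℕ} (q : ℝ≥0∞) (p A₁ A₂ : ℝ) (ω ω' : Sample m) {s t : ℕ} (h : s ≤ t) :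
    edges q p A₁ A₂ (splice t ω ω') s = edges q p A₁ A₂ ω s := by
  induction s with
  | zero => rfl
  | succ s ih =>
    rw [edges, edges, ih (by omega)]
    congr 2
    refine Finset.filter_congr fun u hu => ?_
    have := (Finset.mem_Icc.mp hu).2
    rw [splice_pos_of_le _ _ h, splice_pos_of_le _ _ (by omega), splice_coin_of_le _ _ h]

/-! ### In-degrees, links and long links of the process. -/

namespace Params

variable (P : Params)

/-- The growth exponent of the degrees. -/
def a : ℝ := P.p * P.A₁

/-- The initial attractiveness, relative to the in-degree. -/
def b : ℝ := P.A₂ / P.A₁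

/-- The nominal volume of the sphere of influence of a vertex of in-degree `k`. -/
def vol (t k : ℕ) : ℝ := (P.A₁ * k + P.A₂) / t

/-- The volume of the sphere of influence of a vertex of in-degree `k`. -/
def infl (t k : ℕ) : ℝ := min 1 (P.vol t k)

/-- The in-degree of `v_u` at time `t`. -/
def deg (u t : ℕ) (ω : Sample P.m) : ℕ := inDegree (edges P.q P.p P.A₁ P.A₂ ω t) u

/-- The sphere of influence of `v_u` at time `t`. -/
def sphere (u t : ℕ) (ω : Sample P.m) : Set (Cube P.m) :=
  ballOfVolume P.q (ω.1 u) (P.vol t (P.deg u t ω))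

/-- The vertex `v_{t+1}` falls into the sphere of influence of `v_u`. -/
def hitSet (u t : ℕ) : Set (Sample P.m) := {ω | ω.1 (t + 1) ∈ P.sphere u t ω}

/-- The vertex `v_{t+1}` links to `v_u`. -/
def linkSet (u t : ℕ) : Set (Sample P.m) :=
  {ω | ω.1 (t + 1) ∈ P.sphere u t ω ∧ (ω.2 (t + 1, u) : ℝ) < P.p}

/-- The vertex `v_{t+1}` links to `v_u` over a distance at least `R`. -/
def longSet (R : ℝ) (u t : ℕ) : Set (Sample P.m) :=
  P.linkSet u t ∩ {ω | R ≤ torusDist P.q (ω.1 (t + 1)) (ω.1 u)}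

open Classical in
/-- The number of edges of `G_t` of length at least `R`. -/
def longCount (R : ℝ) (t : ℕ) (ω : Sample P.m) : ℕ :=
  ((edges P.q P.p P.A₁ P.A₂ ω t).filter fun e => R ≤ torusDist P.q (ω.1 e.1) (ω.1 e.2)).card

open Classical in
lemma deg_succ {u t : ℕ} (hu : 1 ≤ u) (hut : u ≤ t) (ω : Sample P.m) :
    P.deg u (t + 1) ω = P.deg u t ω + if ω ∈ P.linkSet u t then 1 else 0 := by
  have hdisj : Disjoint ((edges P.q P.p P.A₁ P.A₂ ω t).filter fun e => e.2 = u)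
      ((((Finset.Icc 1 t).filter fun s =>
        ω.1 (t + 1) ∈ ballOfVolume P.q (ω.1 s)
            ((P.A₁ * (inDegree (edges P.q P.p P.A₁ P.A₂ ω t) s : ℝ) + P.A₂) / (t : ℝ)) ∧
          (ω.2 (t + 1, s) : ℝ) < P.p).image fun s => (t + 1, s)).filter fun e => e.2 = u) := by
    rw [Finset.disjoint_left]
    intro e he he'
    have h1 := (mem_edges (Finset.mem_filter.mp he).1).2.2
    obtain ⟨s, -, rfl⟩ := Finset.mem_image.mp (Finset.mem_filter.mp he').1
    simp at h1
  rw [deg, edges, inDegree, Finset.filter_union, Finset.card_union_of_disjoint hdisj]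
  congr 1
  rw [Finset.filter_image, Finset.filter_filter,
    Finset.card_image_of_injective _ (fun x y h => (Prod.mk.inj h).2)]
  split_ifs with h
  · rw [Finset.card_eq_one]
    refine ⟨u, ?_⟩
    ext s
    simp only [Finset.mem_filter, Finset.mem_Icc, Finset.mem_singleton]
    constructor
    · rintro ⟨-, -, h⟩; exact h
    · rintro rfl; exact ⟨⟨hu, hut⟩, h, rfl⟩
  · rw [Finset.card_eq_zero, Finset.filter_eq_empty_iff]
    rintro s - ⟨h1, rfl⟩
    exact h h1

lemma deg_eq_zero {u t : ℕ} (h : t ≤ u) (ω : Sample P.m) : P.deg u t ω = 0 := by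
  rw [deg, inDegree, Finset.card_eq_zero, Finset.filter_eq_empty_iff]
  intro e he h'
  have := mem_edges he
  omega

lemma deg_le {u : ℕ} (hu : 1 ≤ u) (t : ℕ) (ω : Sample P.m) : P.deg u t ω ≤ t := by
  induction t with
  | zero => rw [P.deg_eq_zero (Nat.zero_le _)]
  | succ t ih =>
    rcases le_or_gt u t with h | h
    · rw [P.deg_succ hu h]; split_ifs <;> omega
    · rw [P.deg_eq_zero h]; omega

open Classical in
lemma longCount_succ (R : ℝ) (t : ℕ) (ω : Sample P.m) :
    P.longCount R (t + 1) ω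
      = P.longCount R t ω + ∑ u ∈ Finset.Icc 1 t, if ω ∈ P.longSet R u t then 1 else 0 := by
  have hdisj : Disjoint ((edges P.q P.p P.A₁ P.A₂ ω t).filter
        fun e => R ≤ torusDist P.q (ω.1 e.1) (ω.1 e.2))
      ((((Finset.Icc 1 t).filter fun s =>
        ω.1 (t + 1) ∈ ballOfVolume P.q (ω.1 s)
            ((P.A₁ * (inDegree (edges P.q P.p P.A₁ P.A₂ ω t) s : ℝ) + P.A₂) / (t : ℝ)) ∧
          (ω.2 (t + 1, s) : ℝ) < P.p).image fun s => (t + 1, s)).filter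
        fun e => R ≤ torusDist P.q (ω.1 e.1) (ω.1 e.2)) := by
    rw [Finset.disjoint_left]
    intro e he he'
    have h1 := (mem_edges (Finset.mem_filter.mp he).1).2.2
    obtain ⟨s, -, rfl⟩ := Finset.mem_image.mp (Finset.mem_filter.mp he').1
    simp at h1
  rw [longCount, edges, Finset.filter_union, Finset.card_union_of_disjoint hdisj]
  congr 1
  rw [Finset.filter_image, Finset.filter_filter,
    Finset.card_image_of_injective _ (fun x y h => (Prod.mk.inj h).2), Finset.card_filter]
  exact Finset.sum_congr rfl fun u _ => if_congr Iff.rfl rfl rfl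

lemma longCount_zero (R : ℝ) (ω : Sample P.m) : P.longCount R 0 ω = 0 := by
  simp [longCount, edges]

lemma longCount_one (R : ℝ) (ω : Sample P.m) : P.longCount R 1 ω = 0 := by
  rw [longCount_succ, longCount_zero]; simp

lemma deg_splice (u : ℕ) {s t : ℕ} (h : s ≤ t) (ω ω' : Sample P.m) :
    P.deg u s (splice t ω ω') = P.deg u s ω := by
  rw [deg, edges_splice _ _ _ _ _ _ h, deg]

lemma longCount_splice (R : ℝ) {s t : ℕ} (h : s ≤ t) (ω ω' : Sample P.m) :
    P.longCount R s (splice t ω ω') = P.longCount R s ω := by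
  rw [longCount, edges_splice _ _ _ _ _ _ h, longCount]
  congr 1
  refine Finset.filter_congr fun e he => ?_
  have := mem_edges he
  rw [splice_pos_of_le _ _ (by omega), splice_pos_of_le _ _ (by omega)]

lemma sphere_splice {u t : ℕ} (h : u ≤ t) (ω ω' : Sample P.m) :
    P.sphere u t (splice t ω ω') = P.sphere u t ω := by
  rw [sphere, P.deg_splice u le_rfl, splice_pos_of_le _ _ h, sphere]

lemma vol_pos {t : ℕ} (ht : 1 ≤ t) (k : ℕ) : 0 < P.vol t k := by
  have := P.hA₁
  have := P.hA₂
  unfold vol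
  positivity

lemma infl_nonneg {t : ℕ} (ht : 1 ≤ t) (k : ℕ) : 0 ≤ P.infl t k :=
  le_min zero_le_one (P.vol_pos ht k).le

lemma infl_le_one (t k : ℕ) : P.infl t k ≤ 1 := min_le_left _ _

/-- The probability that the next vertex creates a long link, given the in-degree. -/
def reward (R : ℝ) (t k : ℕ) : ℝ := P.p * max 0 (P.infl t k - ballVolume P.m P.q R)

lemma measurableSet_sphere (u t : ℕ) (ω : Sample P.m) : MeasurableSet (P.sphere u t ω) :=
  measurableSet_ballOfVolume P.hq _ _

/-- After splicing at `t` the sphere is a fixed set and the position of v_{t+1} is fresh. The past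
enters only through the in-degree of v_u; the same holds for links and long links. -/
lemma prob_hit {u t : ℕ} (hu : 1 ≤ u) (h : u ≤ t) (ω : Sample P.m) :
    (law P.m).real {ω' | splice t ω ω' ∈ P.hitSet u t} = P.infl t (P.deg u t ω) := by
  simp only [hitSet, Set.mem_ofPred_eq, P.sphere_splice h]
  simp only [splice_pos_of_lt _ _ (Nat.lt_succ_self t)]
  rw [law_pos _ (P.measurableSet_sphere u t ω), sphere,
    volume_ballOfVolume P.hm P.hq _ (P.vol_pos (by omega) _), infl]

lemma prob_link {u t : ℕ} (hu : 1 ≤ u) (h : u ≤ t) (ω : Sample P.m) :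
    (law P.m).real {ω' | splice t ω ω' ∈ P.linkSet u t} = P.p * P.infl t (P.deg u t ω) := by
  simp only [linkSet, Set.mem_ofPred_eq, P.sphere_splice h]
  simp only [splice_pos_of_lt _ _ (Nat.lt_succ_self t),
    splice_coin_of_lt _ _ (Nat.lt_succ_self t)]
  rw [law_pos_coin _ _ (P.measurableSet_sphere u t ω) P.hp₀ P.hp₁, sphere,
    volume_ballOfVolume P.hm P.hq _ (P.vol_pos (by omega) _), infl]

lemma prob_long (R : ℝ) {u t : ℕ} (hu : 1 ≤ u) (h : u ≤ t) (ω : Sample P.m) :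
    (law P.m).real {ω' | splice t ω ω' ∈ P.longSet R u t} = P.reward R t (P.deg u t ω) := by
  have hmeas : MeasurableSet (P.sphere u t ω ∩ {y | R ≤ torusDist P.q (ω.1 u) y}) :=
    (P.measurableSet_sphere u t ω).inter
      (measurableSet_le measurable_const (measurable_torusDist_right P.hq _))
  have heq : {ω' | splice t ω ω' ∈ P.longSet R u t}
      = {ω' : Sample P.m | ω'.1 (t + 1) ∈ P.sphere u t ω ∩ {y | R ≤ torusDist P.q (ω.1 u) y}
          ∧ (ω'.2 (t + 1, u) : ℝ) < P.p} := by
    ext ω'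
    simp only [longSet, linkSet, Set.mem_ofPred_eq, P.sphere_splice h, Set.mem_inter_iff,
      splice_pos_of_lt _ _ (Nat.lt_succ_self t), splice_coin_of_lt _ _ (Nat.lt_succ_self t),
      splice_pos_of_le _ _ h, torusDist_comm P.hq (ω.1 u)]
    tauto
  rw [heq, law_pos_coin _ _ hmeas P.hp₀ P.hp₁, sphere,
    volume_ballOfVolume_far P.hm P.hq _ (P.vol_pos (by omega) _), reward, infl]

lemma measurable_torusDist_vertices (u v : ℕ) :
    Measurable fun ω : Sample P.m => torusDist P.q (ω.1 u) (ω.1 v) :=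
  (measurable_torusDist P.hq).comp (g := fun z : Cube P.m × Cube P.m => torusDist P.q z.1 z.2)
    (f := fun ω : Sample P.m => (ω.1 u, ω.1 v)) (by fun_prop)

/-- Measurability of the in-degree is a hypothesis here because the two facts are proved by one
induction on time: `measurable_deg` at t + 1 uses the link event at t. -/
lemma measurableSet_hitSet_of {u t : ℕ} (h : Measurable (P.deg u t)) :
    MeasurableSet (P.hitSet u t) := by
  have : P.hitSet u t = {ω | 1 < P.vol t (P.deg u t ω)} ∪
      {ω | torusDist P.q (ω.1 u) (ω.1 (t + 1)) ≤ radius P.m P.q (P.vol t (P.deg u t ω))} := by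
    ext ω
    simp only [hitSet, sphere, Set.mem_ofPred_eq, mem_ballOfVolume P.hq, Set.mem_union]
  rw [this]
  have hv : Measurable fun ω => P.vol t (P.deg u t ω) :=
    (measurable_from_nat (f := P.vol t)).comp h
  exact (measurableSet_lt measurable_const hv).union (measurableSet_le
    (P.measurable_torusDist_vertices _ _)
    ((measurable_from_nat (f := fun k => radius P.m P.q (P.vol t k))).comp h))

lemma measurableSet_linkSet_of {u t : ℕ} (h : Measurable (P.deg u t)) :
    MeasurableSet (P.linkSet u t) := by
  have hc : Measurable fun ω : Sample P.m => (ω.2 (t + 1, u) : ℝ) :=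
    measurable_subtype_coe.comp ((measurable_pi_apply _).comp measurable_snd)
  exact (P.measurableSet_hitSet_of h).inter (measurableSet_lt hc measurable_const)

lemma measurable_deg (u t : ℕ) : Measurable (P.deg u t) := by
  rcases Nat.eq_zero_or_pos u with rfl | hu
  · have : P.deg 0 t = fun _ => 0 := by
      funext ω
      rw [deg, inDegree, Finset.card_eq_zero, Finset.filter_eq_empty_iff]
      intro e he h'
      have := mem_edges he
      omega
    rw [this]; exact measurable_const
  induction t with
  | zero =>
    have : P.deg u 0 = fun _ => 0 := funext fun ω => P.deg_eq_zero (Nat.zero_le _) ω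
    rw [this]; exact measurable_const
  | succ t ih =>
    rcases le_or_gt u t with h | h
    · classical
      have : P.deg u (t + 1) = fun ω => P.deg u t ω + if ω ∈ P.linkSet u t then 1 else 0 :=
        funext fun ω => P.deg_succ hu h ω
      rw [this]
      exact ih.add (Measurable.ite (P.measurableSet_linkSet_of ih) measurable_const measurable_const)
    · have : P.deg u (t + 1) = fun _ => 0 := funext fun ω => P.deg_eq_zero h ω
      rw [this]; exact measurable_const

lemma measurableSet_hitSet (u t : ℕ) : MeasurableSet (P.hitSet u t) :=
  P.measurableSet_hitSet_of (P.measurable_deg u t)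

lemma measurableSet_linkSet (u t : ℕ) : MeasurableSet (P.linkSet u t) :=
  P.measurableSet_linkSet_of (P.measurable_deg u t)

lemma measurableSet_longSet (R : ℝ) (u t : ℕ) : MeasurableSet (P.longSet R u t) :=
  (P.measurableSet_linkSet u t).inter
    (measurableSet_le measurable_const (P.measurable_torusDist_vertices _ _))

lemma measurable_longCount (R : ℝ) (t : ℕ) : Measurable (P.longCount R t) := by
  classical
  induction t with
  | zero =>
    have : P.longCount R 0 = fun _ => 0 := funext (P.longCount_zero R)
    rw [this]; exact measurable_const
  | succ t ih =>
    have : P.longCount R (t + 1) = fun ω => P.longCount R t ω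
        + ∑ u ∈ Finset.Icc 1 t, if ω ∈ P.longSet R u t then 1 else 0 :=
      funext (P.longCount_succ R t)
    rw [this]
    exact ih.add (Finset.measurable_sum _ fun u _ =>
      Measurable.ite (P.measurableSet_longSet R u t) measurable_const measurable_const)

lemma longCount_le (R : ℝ) (t : ℕ) (ω : Sample P.m) : P.longCount R t ω ≤ t * t := by
  classical
  induction t with
  | zero => rw [longCount_zero]
  | succ t ih =>
    rw [longCount_succ]
    have : ∑ u ∈ Finset.Icc 1 t, (if ω ∈ P.longSet R u t then 1 else 0) ≤ t := by
      exact (Finset.sum_le_sum (g := fun _ => 1) fun u _ => by split_ifs <;> simp).trans (by simp)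
    nlinarith

/-! ### Growth factors, and the expected number of future long links. -/

lemma a_pos : 0 < P.a := lt_trans (by norm_num) P.hlow

lemma a_lt_one : P.a < 1 := P.hhigh

lemma half_lt_a : 1 / 2 < P.a := P.hlow

lemma p_pos : 0 < P.p := by
  rcases P.hp₀.lt_or_eq with h | h
  · exact h
  · have := P.hlow; rw [← h] at this; norm_num at this

lemma b_pos : 0 < P.b := div_pos P.hA₂ P.hA₁

/-- The expected growth factor of an in-degree from time `1` to time `t`. -/
def growth (t : ℕ) : ℝ := ∏ s ∈ Finset.Ico 1 t, (1 + P.a / s)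

lemma growth_one : P.growth 1 = 1 := by simp [growth]

lemma growth_succ {t : ℕ} (ht : 1 ≤ t) : P.growth (t + 1) = P.growth t * (1 + P.a / t) :=
  Finset.prod_Ico_succ_top ht _

lemma growth_pos (t : ℕ) : 0 < P.growth t :=
  Finset.prod_pos fun s _ => by have := P.a_pos; positivity

lemma growth_le_succ {t : ℕ} (ht : 1 ≤ t) : P.growth t ≤ P.growth (t + 1) := by
  rw [P.growth_succ ht]
  have : 0 ≤ P.a / t := by have := P.a_pos; positivity
  exact le_mul_of_one_le_right (P.growth_pos t).le (by linarith)

lemma growth_mono {s t : ℕ} (hs : 1 ≤ s) (h : s ≤ t) : P.growth s ≤ P.growth t := by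
  induction t, h using Nat.le_induction with
  | base => exact le_rfl
  | succ t hst ih => exact ih.trans (P.growth_le_succ (hs.trans hst))

lemma rpow_le_growth {t : ℕ} (ht : 1 ≤ t) : (t : ℝ) ^ P.a ≤ P.growth t := by
  induction t, ht using Nat.le_induction with
  | base => simp [growth_one]
  | succ t ht ih =>
    have ht0 : (0 : ℝ) < t := by exact_mod_cast ht
    rw [P.growth_succ ht]
    have h1 : ((t + 1 : ℕ) : ℝ) = t * (1 + 1 / t) := by push_cast; field_simp
    rw [h1, Real.mul_rpow ht0.le (by positivity)]
    have h2 := rpow_one_add_le_one_add_mul_self (s := 1 / (t : ℝ))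
      (by have : 0 < 1 / (t : ℝ) := by positivity
          linarith) P.a_pos.le P.a_lt_one.le
    rw [mul_one_div] at h2
    exact mul_le_mul ih h2 (by positivity) (P.growth_pos t).le

/-- With x = 1/(t + 1), Bernoulli's inequality gives (1 − x)^a (1 + ax) ≤ (1 − ax)(1 + ax) ≤ 1, so
the ratio of the two sides does not increase. The shift to `t + 1` on the left makes this work; the
constant 2 covers growth(2) = 1 + a. -/
lemma growth_le_rpow {t : ℕ} (ht : 1 ≤ t) : P.growth (t + 1) ≤ 2 * (t : ℝ) ^ P.a := by
  induction t, ht using Nat.le_induction with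
  | base =>
    rw [P.growth_succ le_rfl, growth_one]
    have := P.a_lt_one
    norm_num; linarith
  | succ t ht ih =>
    have ht0 : (0 : ℝ) < t := by exact_mod_cast ht
    have ha := P.a_pos
    rw [P.growth_succ (by omega)]
    have h1 : ((t + 1 : ℕ) : ℝ) * (1 + -1 / ((t + 1 : ℕ) : ℝ)) = t := by push_cast; field_simp; ring
    have h2 := rpow_one_add_le_one_add_mul_self (s := -1 / ((t + 1 : ℕ) : ℝ))
      (by rw [le_div_iff₀ (by positivity)]; push_cast; linarith) ha.le P.a_lt_one.le
    have h4 : (1 + P.a * (-1 / ((t + 1 : ℕ) : ℝ))) * (1 + P.a / ((t + 1 : ℕ) : ℝ)) ≤ 1 := by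
      have : P.a * (-1 / ((t + 1 : ℕ) : ℝ)) = - (P.a / ((t + 1 : ℕ) : ℝ)) := by ring
      rw [this]; nlinarith [sq_nonneg (P.a / ((t + 1 : ℕ) : ℝ))]
    have h5 : (0 : ℝ) < 1 + P.a / ((t + 1 : ℕ) : ℝ) := by positivity
    have h6 : (0 : ℝ) ≤ 1 + -1 / ((t + 1 : ℕ) : ℝ) := by
      by_contra h
      have h7 : (0 : ℝ) < ((t + 1 : ℕ) : ℝ) := by positivity
      nlinarith [not_le.mp h]
    calc P.growth (t + 1) * (1 + P.a / ((t + 1 : ℕ) : ℝ))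
        ≤ 2 * (t : ℝ) ^ P.a * (1 + P.a / ((t + 1 : ℕ) : ℝ)) := by gcongr
      _ = 2 * ((t + 1 : ℕ) : ℝ) ^ P.a * ((1 + -1 / ((t + 1 : ℕ) : ℝ)) ^ P.a
          * (1 + P.a / ((t + 1 : ℕ) : ℝ))) := by
        rw [← h1, Real.mul_rpow (by positivity) h6]
        ring
      _ ≤ 2 * ((t + 1 : ℕ) : ℝ) ^ P.a * 1 := by
        gcongr
        exact (mul_le_mul_of_nonneg_right h2 h5.le).trans h4
      _ = _ := mul_one _

lemma growth_le {t : ℕ} (ht : 1 ≤ t) : P.growth t ≤ 2 * (t : ℝ) ^ P.a :=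
  (P.growth_le_succ ht).trans (P.growth_le_rpow ht)

lemma vol_eq (t k : ℕ) : P.p * P.vol t k = P.a * (k + P.b) / t := by
  have := P.hA₁.ne'
  unfold vol a b; field_simp

lemma p_infl_le (t k : ℕ) : P.p * P.infl t k ≤ P.a * (k + P.b) / t := by
  rw [← vol_eq]
  exact mul_le_mul_of_nonneg_left (min_le_right _ _) P.hp₀

lemma p_infl_le_one (t k : ℕ) : P.p * P.infl t k ≤ 1 := by
  have := mul_le_mul_of_nonneg_left (P.infl_le_one t k) P.hp₀
  linarith [P.hp₁]

lemma p_infl_nonneg {t : ℕ} (ht : 1 ≤ t) (k : ℕ) : 0 ≤ P.p * P.infl t k :=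
  mul_nonneg P.hp₀ (P.infl_nonneg ht k)

lemma vol_succ (t k : ℕ) : P.vol t (k + 1) = P.vol t k + P.A₁ / t := by
  unfold vol; push_cast; ring

lemma infl_le_infl_succ (t k : ℕ) : P.infl t k ≤ P.infl t (k + 1) := by
  have : 0 ≤ P.A₁ / t := div_nonneg P.hA₁.le (Nat.cast_nonneg t)
  unfold infl
  rw [vol_succ]
  exact min_le_min le_rfl (by linarith)

lemma infl_succ_le (t k : ℕ) : P.infl t (k + 1) ≤ P.infl t k + P.A₁ / t := by
  have : 0 ≤ P.A₁ / t := div_nonneg P.hA₁.le (Nat.cast_nonneg t)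
  unfold infl
  rw [vol_succ, ← min_add_add_right]
  exact min_le_min (by linarith) le_rfl

variable (R : ℝ)

lemma reward_nonneg (t k : ℕ) : 0 ≤ P.reward R t k := mul_nonneg P.hp₀ (le_max_left _ _)

lemma reward_le_p_infl {t : ℕ} (ht : 1 ≤ t) (k : ℕ) : P.reward R t k ≤ P.p * P.infl t k := by
  refine mul_le_mul_of_nonneg_left (max_le (P.infl_nonneg ht k) ?_) P.hp₀
  linarith [ballVolume_nonneg (m := P.m) (q := P.q) R]

lemma reward_le_succ (t k : ℕ) : P.reward R t k ≤ P.reward R t (k + 1) := by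
  have := P.infl_le_infl_succ t k
  exact mul_le_mul_of_nonneg_left (max_le_max le_rfl (by linarith)) P.hp₀

lemma reward_succ_le (t k : ℕ) : P.reward R t (k + 1) ≤ P.reward R t k + P.a / t := by
  have h1 := P.infl_succ_le t k
  have h2 : 0 ≤ P.A₁ / t := div_nonneg P.hA₁.le (Nat.cast_nonneg t)
  have h3 : P.a / t = P.p * (P.A₁ / t) := by unfold a; ring
  unfold reward
  rw [h3, ← mul_add]
  refine mul_le_mul_of_nonneg_left (max_le ?_ ?_) P.hp₀
  · linarith [le_max_left 0 (P.infl t k - ballVolume P.m P.q R)]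
  · linarith [le_max_right 0 (P.infl t k - ballVolume P.m P.q R)]

/-- The expected number of long links received in the last `j` steps before time `n` by a vertex
whose in-degree is `k` at time `n - j`. -/
def valueToGo (n : ℕ) : ℕ → ℕ → ℝ
  | 0, _ => 0
  | j + 1, k => valueToGo n j k
      + P.p * P.infl (n - (j + 1)) k * (valueToGo n j (k + 1) - valueToGo n j k)
      + P.reward R (n - (j + 1)) k

/-- The expected number of long links received between the times `t` and `n` by a vertex whose
in-degree is `k` at time `t`. -/
def value (n t k : ℕ) : ℝ := P.valueToGo R n (n - t) k

/-- The increment of `value` in the in-degree. -/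
def valueDiff (n t k : ℕ) : ℝ := P.value R n t (k + 1) - P.value R n t k

lemma value_self (n k : ℕ) : P.value R n n k = 0 := by simp [value, valueToGo]

lemma value_step {n t : ℕ} (h : t < n) (k : ℕ) :
    P.value R n t k = P.value R n (t + 1) k + P.p * P.infl t k * P.valueDiff R n (t + 1) k
      + P.reward R t k := by
  have h1 : n - t = (n - (t + 1)) + 1 := by omega
  have h2 : n - (n - (t + 1) + 1) = t := by omega
  rw [value, h1, valueToGo, h2]
  rfl

/-- Backward induction. One more unit of in-degree raises the link probability and the reward by at
most a/s each, so an upper bound B at time s + 1 becomes (1 + a/s)(B + 1) − 1 at time s.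
Nonnegativity survives because the link probability is at most 1. -/
lemma valueDiff_bounds {n t : ℕ} (ht : 1 ≤ t) (h : t ≤ n) :
    ∀ k, 0 ≤ P.valueDiff R n t k ∧ P.valueDiff R n t k ≤ P.growth n / P.growth t - 1 := by
  refine Nat.decreasingInduction' (P := fun t => ∀ k, 0 ≤ P.valueDiff R n t k ∧
    P.valueDiff R n t k ≤ P.growth n / P.growth t - 1) ?_ h ?_
  · intro s hsn hts ih k
    have hs : 1 ≤ s := ht.trans hts
    have hs0 : (0 : ℝ) < s := by exact_mod_cast hs
    have e : P.valueDiff R n s k = (1 - P.p * P.infl s k) * P.valueDiff R n (s + 1) k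
        + P.p * P.infl s (k + 1) * P.valueDiff R n (s + 1) (k + 1)
        + (P.reward R s (k + 1) - P.reward R s k) := by
      rw [valueDiff, P.value_step R hsn, P.value_step R hsn]
      unfold valueDiff; ring
    have h1 := P.p_infl_le_one s k
    have h2 := P.p_infl_nonneg hs (k + 1)
    have h3 := P.reward_le_succ R s k
    have h4 := P.reward_succ_le R s k
    obtain ⟨h5, h6⟩ := ih k
    obtain ⟨h7, h8⟩ := ih (k + 1)
    rw [e]
    refine ⟨by have := mul_nonneg (sub_nonneg.mpr h1) h5; have := mul_nonneg h2 h7; linarith, ?_⟩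
    have h9 : P.p * P.infl s (k + 1) ≤ P.p * P.infl s k + P.a / s := by
      have := mul_le_mul_of_nonneg_left (P.infl_succ_le s k) P.hp₀
      have h3 : P.a / s = P.p * (P.A₁ / s) := by unfold a; ring
      rw [h3]; linarith
    set B := P.growth n / P.growth (s + 1) - 1 with hB
    have hB' : P.growth n / P.growth s - 1 = (1 + P.a / s) * (B + 1) - 1 := by
      rw [hB, P.growth_succ hs]
      have h1 := (P.growth_pos s).ne'
      have h2 : (1 + P.a / s) ≠ 0 := by have := P.a_pos; positivity
      rw [sub_add_cancel, mul_div_assoc', mul_comm (P.growth s), mul_div_mul_left _ _ h2]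
    have hB0 : 0 ≤ B := h5.trans h6
    have := mul_le_mul_of_nonneg_left h6 (sub_nonneg.mpr h1)
    have := mul_le_mul_of_nonneg_left h8 h2
    have := mul_le_mul_of_nonneg_right h9 hB0
    rw [hB']
    linarith
  · intro k
    rw [valueDiff, value_self, value_self, div_self (P.growth_pos n).ne']
    simp

/-- Since p·infl ≤ a(k + b)/s, a step multiplies the mean of k + b by at most 1 + a/s; the long
links are among all the links counted this way. -/
lemma value_bounds {n t : ℕ} (ht : 1 ≤ t) (h : t ≤ n) :
    ∀ k, 0 ≤ P.value R n t k ∧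
      P.value R n t k ≤ (k + P.b) * (P.growth n / P.growth t - 1) := by
  refine Nat.decreasingInduction' (P := fun t => ∀ k, 0 ≤ P.value R n t k ∧
    P.value R n t k ≤ (k + P.b) * (P.growth n / P.growth t - 1)) ?_ h ?_
  · intro s hsn hts ih k
    have hs : 1 ≤ s := ht.trans hts
    have hs0 : (0 : ℝ) < s := by exact_mod_cast hs
    obtain ⟨h5, h6⟩ := P.valueDiff_bounds R (n := n) (t := s + 1) (by omega) hsn k
    obtain ⟨h7, h8⟩ := ih k
    have h2 := P.p_infl_nonneg hs k
    rw [P.value_step R hsn]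
    refine ⟨by have := mul_nonneg h2 h5; have := P.reward_nonneg R s k; linarith, ?_⟩
    set B := P.growth n / P.growth (s + 1) - 1 with hB
    have hB' : P.growth n / P.growth s - 1 = (1 + P.a / s) * (B + 1) - 1 := by
      rw [hB, P.growth_succ hs]
      have h1 := (P.growth_pos s).ne'
      have h2 : (1 + P.a / s) ≠ 0 := by have := P.a_pos; positivity
      rw [sub_add_cancel, mul_div_assoc', mul_comm (P.growth s), mul_div_mul_left _ _ h2]
    have hB0 : 0 ≤ B := h5.trans h6
    have h9 := P.p_infl_le s k
    have h10 := P.reward_le_p_infl R hs k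
    have h11 := mul_le_mul h9 h6 h5 (h2.trans h9)
    have h12 : P.a * (k + P.b) / s = (k + P.b) * (P.a / s) := by ring
    rw [hB']
    rw [h12] at h9 h11
    linarith
  · intro k
    rw [value_self, div_self (P.growth_pos n).ne']
    simp

end Params

/-! ### Bounded random variables and their conditional means. -/

/-- Bounded measurable functions. -/
def BddMeas {Ω : Type*} [MeasurableSpace Ω] (f : Ω → ℝ) : Prop :=
  Measurable f ∧ ∃ C, ∀ ω, |f ω| ≤ C

namespace BddMeas

variable {Ω : Type*} [MeasurableSpace Ω] {f g : Ω → ℝ}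

lemma const (c : ℝ) : BddMeas fun _ : Ω => c := ⟨measurable_const, |c|, fun _ => le_rfl⟩

lemma add (hf : BddMeas f) (hg : BddMeas g) : BddMeas fun ω => f ω + g ω := by
  obtain ⟨hf, C, hC⟩ := hf
  obtain ⟨hg, D, hD⟩ := hg
  exact ⟨hf.add hg, C + D, fun ω => (abs_add_le _ _).trans (add_le_add (hC ω) (hD ω))⟩

lemma mul (hf : BddMeas f) (hg : BddMeas g) : BddMeas fun ω => f ω * g ω := by
  obtain ⟨hf, C, hC⟩ := hf
  obtain ⟨hg, D, hD⟩ := hg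
  refine ⟨hf.mul hg, C * D, fun ω => ?_⟩
  rw [abs_mul]
  exact mul_le_mul (hC ω) (hD ω) (abs_nonneg _) ((abs_nonneg _).trans (hC ω))

lemma sub (hf : BddMeas f) (hg : BddMeas g) : BddMeas fun ω => f ω - g ω := by
  simpa [sub_eq_add_neg] using hf.add ((const (-1)).mul hg)

lemma sq (hf : BddMeas f) : BddMeas fun ω => f ω ^ 2 := by
  simpa only [pow_two] using hf.mul hf

lemma sum {ι : Type*} {s : Finset ι} {f : ι → Ω → ℝ} (h : ∀ i ∈ s, BddMeas (f i)) :
    BddMeas fun ω => ∑ i ∈ s, f i ω := by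
  classical
  induction s using Finset.induction_on with
  | empty => simpa using const 0
  | insert i s hi ih =>
    simp only [Finset.sum_insert hi]
    exact (h i (Finset.mem_insert_self i s)).add
      (ih fun j hj => h j (Finset.mem_insert_of_mem hj))

lemma indicator {s : Set Ω} (hs : MeasurableSet s) : BddMeas (s.indicator (1 : Ω → ℝ)) := by
  refine ⟨measurable_one.indicator hs, 1, fun ω => ?_⟩
  by_cases h : ω ∈ s <;> simp [h]

lemma nat_comp {D : Ω → ℕ} (hD : Measurable D) {N : ℕ} (hN : ∀ ω, D ω ≤ N) (g : ℕ → ℝ) :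
    BddMeas fun ω => g (D ω) := by
  refine ⟨(measurable_from_nat (f := g)).comp hD, ∑ k ∈ Finset.range (N + 1), |g k|, fun ω => ?_⟩
  exact Finset.single_le_sum (f := fun k => |g k|) (fun _ _ => abs_nonneg _)
    (Finset.mem_range.mpr (Nat.lt_succ_of_le (hN ω)))

lemma integrable (hf : BddMeas f) (μ : Measure Ω) [IsFiniteMeasure μ] : Integrable f μ := by
  obtain ⟨hf, C, hC⟩ := hf
  exact Integrable.of_bound hf.aestronglyMeasurable C (ae_of_all _ hC)

lemma comp {Ω' : Type*} [MeasurableSpace Ω'] (hf : BddMeas f) {φ : Ω' → Ω} (hφ : Measurable φ) :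
    BddMeas fun ω => f (φ ω) :=
  ⟨hf.1.comp hφ, hf.2.imp fun _ hC _ => hC _⟩

end BddMeas

lemma integral_indicator_one' {Ω : Type*} [MeasurableSpace Ω] (μ : Measure Ω) {s : Set Ω}
    (hs : MeasurableSet s) : ∫ ω, s.indicator (1 : Ω → ℝ) ω ∂μ = μ.real s :=
  integral_indicator_one hs

lemma measurable_splice {m : ℕ} (t : ℕ) :
    Measurable fun z : Sample m × Sample m => splice t z.1 z.2 :=
  (measurePreserving_splice t).measurable

lemma measurable_splice_right {m : ℕ} (t : ℕ) (ω : Sample m) :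
    Measurable fun ω' : Sample m => splice t ω ω' :=
  (measurable_splice t).comp (g := fun z : Sample m × Sample m => splice t z.1 z.2)
    (f := fun ω' : Sample m => (ω, ω')) (measurable_const.prodMk measurable_id)

/-- The conditional expectation given the first `t` steps. -/
def condMean {m : ℕ} (t : ℕ) (f : Sample m → ℝ) (ω : Sample m) : ℝ :=
  ∫ ω', f (splice t ω ω') ∂(law m)

lemma BddMeas.condMean {m : ℕ} {f : Sample m → ℝ} (hf : BddMeas f) (t : ℕ) :
    BddMeas (condMean t f) := by
  refine ⟨?_, ?_⟩
  · have h : StronglyMeasurable (Function.uncurry fun ω ω' => f (splice t ω ω')) :=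
      (hf.1.comp (measurable_splice t)).stronglyMeasurable
    exact (h.integral_prod_right (ν := law m)).measurable
  · obtain ⟨C, hC⟩ := hf.2
    refine ⟨C, fun ω => ?_⟩
    have := norm_integral_le_of_norm_le_const (μ := law m) (f := fun ω' => f (splice t ω ω'))
      (C := C) (ae_of_all _ fun ω' => hC _)
    simpa [SPA.condMean] using this

lemma integral_condMean {m : ℕ} {f : Sample m → ℝ} (hf : BddMeas f) (t : ℕ) :
    ∫ ω, condMean t f ω ∂(law m) = ∫ ω, f ω ∂(law m) := by
  have h := measurePreserving_splice (m := m) t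
  conv_rhs => rw [← h.map_eq]
  rw [integral_map h.measurable.aemeasurable hf.1.aestronglyMeasurable,
    integral_prod _ ((hf.comp (measurable_splice t)).integrable _)]
  rfl

/-- The conditional second moment is the squared conditional mean plus the conditional variance, and
the variance of `g` is at most its second moment. -/
lemma condMean_sq_add_le {m : ℕ} {f g : Sample m → ℝ} (hg : BddMeas g) (t : ℕ)
    (ω : Sample m) (c : ℝ) (hf : ∀ ω', f (splice t ω ω') = (c + g (splice t ω ω')) ^ 2) :
    condMean t f ω ≤ (c + condMean t g ω) ^ 2 + condMean t (fun ω => g ω ^ 2) ω := by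
  have hg' := hg.comp (measurable_splice_right t ω)
  have i1 := hg'.integrable (law m)
  have i2 := hg'.sq.integrable (law m)
  have : condMean t f ω = c ^ 2 + 2 * c * condMean t g ω + condMean t (fun ω => g ω ^ 2) ω := by
    unfold condMean
    simp only [hf, add_sq]
    have i3 : Integrable (fun ω' => c ^ 2 + 2 * c * g (splice t ω ω')) (law m) :=
      (integrable_const _).add (i1.const_mul _)
    rw [integral_add i3 i2, integral_add (integrable_const _) (i1.const_mul _), integral_const_mul]
    simp
  rw [this]
  nlinarith [sq_nonneg (condMean t g ω)]

/-! ### The martingale behind the count of long edges. -/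

namespace Params

variable (P : Params) (R : ℝ)

/-- The long links created in step `t + 1`, each weighted with the change of the expected number of
future long links. -/
def incr (n t : ℕ) (ω : Sample P.m) : ℝ :=
  ∑ u ∈ Finset.Icc 1 t, ((P.longSet R u t).indicator 1 ω
    + (P.linkSet u t).indicator 1 ω * P.valueDiff R n (t + 1) (P.deg u t ω))

/-- The number of long edges at time `t` plus the expected number of future ones that point to the
present vertices. -/
def potential (n t : ℕ) (ω : Sample P.m) : ℝ :=
  P.longCount R t ω + ∑ u ∈ Finset.Icc 1 t, P.value R n t (P.deg u t ω)

/-- The mean of `potential`. -/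
def potentialMean (n t : ℕ) : ℝ := ∑ s ∈ Finset.Icc 1 t, P.value R n s 0

lemma bddMeas_deg {u : ℕ} (hu : 1 ≤ u) (t : ℕ) (g : ℕ → ℝ) :
    BddMeas fun ω => g (P.deg u t ω) :=
  BddMeas.nat_comp (P.measurable_deg u t) (P.deg_le hu t) g

lemma bddMeas_incr (n t : ℕ) : BddMeas (P.incr R n t) :=
  BddMeas.sum fun u hu => (BddMeas.indicator (P.measurableSet_longSet R u t)).add
    ((BddMeas.indicator (P.measurableSet_linkSet u t)).mul
      (P.bddMeas_deg (Finset.mem_Icc.mp hu).1 t _))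

lemma bddMeas_potential (n t : ℕ) : BddMeas (P.potential R n t) :=
  (BddMeas.nat_comp (P.measurable_longCount R t) (P.longCount_le R t) fun k => (k : ℝ)).add
    (BddMeas.sum fun _ hu => P.bddMeas_deg (Finset.mem_Icc.mp hu).1 t _)

lemma deg_succ_comp (g : ℕ → ℝ) {u t : ℕ} (hu : 1 ≤ u) (hut : u ≤ t) (ω : Sample P.m) :
    g (P.deg u (t + 1) ω) = g (P.deg u t ω)
      + (P.linkSet u t).indicator 1 ω * (g (P.deg u t ω + 1) - g (P.deg u t ω)) := by
  classical
  rw [P.deg_succ hu hut]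
  by_cases h : ω ∈ P.linkSet u t <;> simp [h]

lemma potential_succ (n t : ℕ) (ω : Sample P.m) :
    P.potential R n (t + 1) ω = P.longCount R t ω
      + ∑ u ∈ Finset.Icc 1 t, P.value R n (t + 1) (P.deg u t ω) + P.value R n (t + 1) 0
      + P.incr R n t ω := by
  classical
  have h1 : (P.longCount R (t + 1) ω : ℝ) = P.longCount R t ω
      + ∑ u ∈ Finset.Icc 1 t, (P.longSet R u t).indicator 1 ω := by
    rw [P.longCount_succ]; push_cast
    congr 1
  rw [potential, h1, Finset.sum_Icc_succ_top (by omega), P.deg_eq_zero le_rfl, incr,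
    Finset.sum_add_distrib, Finset.sum_congr rfl fun u hu =>
      P.deg_succ_comp (P.value R n (t + 1)) (Finset.mem_Icc.mp hu).1 (Finset.mem_Icc.mp hu).2 ω,
    Finset.sum_add_distrib]
  unfold valueDiff
  ring

lemma condMean_link_mul {u t : ℕ} (hu : 1 ≤ u) (h : u ≤ t) (g : ℕ → ℝ) (ω : Sample P.m) :
    condMean t (fun ω => (P.linkSet u t).indicator 1 ω * g (P.deg u t ω)) ω
      = P.p * P.infl t (P.deg u t ω) * g (P.deg u t ω) := by
  unfold condMean
  simp only [P.deg_splice u le_rfl]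
  rw [integral_mul_const, ← P.prob_link hu h]
  congr 1
  exact integral_indicator_one'
    (s := {ω' | splice t ω ω' ∈ P.linkSet u t}) (law P.m)
    (measurable_splice_right t ω (P.measurableSet_linkSet u t))

lemma condMean_hit_mul {u t : ℕ} (hu : 1 ≤ u) (h : u ≤ t) (g : ℕ → ℝ) (ω : Sample P.m) :
    condMean t (fun ω => (P.hitSet u t).indicator 1 ω * g (P.deg u t ω)) ω
      = P.infl t (P.deg u t ω) * g (P.deg u t ω) := by
  unfold condMean
  simp only [P.deg_splice u le_rfl]
  rw [integral_mul_const, ← P.prob_hit hu h]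
  congr 1
  exact integral_indicator_one'
    (s := {ω' | splice t ω ω' ∈ P.hitSet u t}) (law P.m)
    (measurable_splice_right t ω (P.measurableSet_hitSet u t))

lemma condMean_long {u t : ℕ} (hu : 1 ≤ u) (h : u ≤ t) (ω : Sample P.m) :
    condMean t ((P.longSet R u t).indicator 1) ω = P.reward R t (P.deg u t ω) := by
  rw [← P.prob_long R hu h]
  exact integral_indicator_one'
    (s := {ω' | splice t ω ω' ∈ P.longSet R u t}) (law P.m)
    (measurable_splice_right t ω (P.measurableSet_longSet R u t))

end Params

lemma condMean_sum {m : ℕ} {ι : Type*} {s : Finset ι} {f : ι → Sample m → ℝ}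
    (h : ∀ i ∈ s, BddMeas (f i)) (t : ℕ) (ω : Sample m) :
    condMean t (fun ω => ∑ i ∈ s, f i ω) ω = ∑ i ∈ s, condMean t (f i) ω :=
  integral_finsetSum _ fun i hi => ((h i hi).comp (measurable_splice_right t ω)).integrable _

lemma condMean_add {m : ℕ} {f g : Sample m → ℝ} (hf : BddMeas f) (hg : BddMeas g) (t : ℕ)
    (ω : Sample m) :
    condMean t (fun ω => f ω + g ω) ω = condMean t f ω + condMean t g ω :=
  integral_add ((hf.comp (measurable_splice_right t ω)).integrable _)
    ((hg.comp (measurable_splice_right t ω)).integrable _)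

namespace Params

variable (P : Params) (R : ℝ)

lemma condMean_incr (n t : ℕ) (ω : Sample P.m) :
    condMean t (P.incr R n t) ω = ∑ u ∈ Finset.Icc 1 t, (P.reward R t (P.deg u t ω)
      + P.p * P.infl t (P.deg u t ω) * P.valueDiff R n (t + 1) (P.deg u t ω)) := by
  have h1 : ∀ u, BddMeas ((P.longSet R u t).indicator (1 : Sample P.m → ℝ)) := fun u =>
    BddMeas.indicator (P.measurableSet_longSet R u t)
  have h2 : ∀ u ∈ Finset.Icc 1 t, BddMeas fun ω => (P.linkSet u t).indicator 1 ω
      * P.valueDiff R n (t + 1) (P.deg u t ω) := fun u hu =>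
    (BddMeas.indicator (P.measurableSet_linkSet u t)).mul
      (P.bddMeas_deg (Finset.mem_Icc.mp hu).1 t _)
  unfold incr
  rw [condMean_sum fun u hu => (h1 u).add (h2 u hu)]
  refine Finset.sum_congr rfl fun u hu => ?_
  obtain ⟨hu1, hu2⟩ := Finset.mem_Icc.mp hu
  rw [condMean_add (h1 u) (h2 u hu), P.condMean_link_mul hu1 hu2, P.condMean_long R hu1 hu2]

/-- The martingale property: by `value_step`, the mean of the increment is exactly what the values
of the present vertices lose between t and t + 1. Only the deterministic value of the newborn vertex
remains, and `potentialMean` collects it. -/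
lemma base_add_condMean {n t : ℕ} (h : t < n) (ω : Sample P.m) :
    P.longCount R t ω
      + ∑ u ∈ Finset.Icc 1 t, P.value R n (t + 1) (P.deg u t ω) + P.value R n (t + 1) 0
      + condMean t (P.incr R n t) ω = P.potential R n t ω + P.value R n (t + 1) 0 := by
  rw [condMean_incr, potential, Finset.sum_congr rfl fun u _ => P.value_step R h _,
    Finset.sum_add_distrib, Finset.sum_add_distrib, Finset.sum_add_distrib]
  ring

lemma potential_splice (n t : ℕ) (ω ω' : Sample P.m) :
    P.potential R n (t + 1) (splice t ω ω') = P.longCount R t ω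
      + ∑ u ∈ Finset.Icc 1 t, P.value R n (t + 1) (P.deg u t ω) + P.value R n (t + 1) 0
      + P.incr R n t (splice t ω ω') := by
  rw [potential_succ, P.longCount_splice R le_rfl]
  simp only [P.deg_splice _ le_rfl]

lemma potentialMean_succ (n t : ℕ) :
    P.potentialMean R n (t + 1) = P.potentialMean R n t + P.value R n (t + 1) 0 :=
  Finset.sum_Icc_succ_top (by omega) _

lemma potential_one (n : ℕ) (ω : Sample P.m) :
    P.potential R n 1 ω = P.potentialMean R n 1 := by
  simp [potential, potentialMean, longCount_one, deg_eq_zero]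

/-- Orthogonality of martingale increments. At time 1 the potential is deterministic, and at time n
it is the count of long edges (`potential_self`). -/
lemma integral_potential_sub_sq_le {n t : ℕ} (ht : 1 ≤ t) (h : t ≤ n) :
    ∫ ω, (P.potential R n t ω - P.potentialMean R n t) ^ 2 ∂(law P.m)
      ≤ ∑ s ∈ Finset.Ico 1 t, ∫ ω, P.incr R n s ω ^ 2 ∂(law P.m) := by
  induction t, ht using Nat.le_induction with
  | base => simp [potential_one]
  | succ t ht ih =>
    have hb : ∀ t, BddMeas fun ω => (P.potential R n t ω - P.potentialMean R n t) ^ 2 := fun t =>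
      ((P.bddMeas_potential R n t).sub (BddMeas.const _)).sq
    rw [Finset.sum_Ico_succ_top ht, ← integral_condMean (hb (t + 1)) t,
      ← integral_condMean (P.bddMeas_incr R n t).sq t]
    refine le_trans ?_ (add_le_add_left (ih (by omega)) _)
    rw [← integral_add ((hb t).integrable _)
      (((P.bddMeas_incr R n t).sq.condMean t).integrable _)]
    refine integral_mono (((hb (t + 1)).condMean t).integrable _)
      (((hb t).integrable _).add (((P.bddMeas_incr R n t).sq.condMean t).integrable _)) fun ω => ?_
    refine (condMean_sq_add_le (P.bddMeas_incr R n t) t ω (P.longCount R t ω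
      + ∑ u ∈ Finset.Icc 1 t, P.value R n (t + 1) (P.deg u t ω) + P.value R n (t + 1) 0
      - P.potentialMean R n (t + 1)) fun ω' => ?_).trans (le_of_eq ?_)
    · rw [P.potential_splice]; ring
    · have := P.base_add_condMean R h ω
      congr 2
      rw [potentialMean_succ]; linarith

lemma potential_self (n : ℕ) (ω : Sample P.m) : P.potential R n n ω = P.longCount R n ω := by
  simp [potential, value_self]

/-- The mean of a quadratic function of the in-degree. -/
lemma integral_deg_sq_le {u t : ℕ} (hu : 1 ≤ u) (h : u ≤ t) :
    ∫ ω, ((P.deg u t ω : ℝ) + P.b) * (P.deg u t ω + 1 + P.b) ∂(law P.m)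
      ≤ P.b * (1 + P.b) * (P.growth t / P.growth u) ^ 2 := by
  have ha := P.a_pos
  have hbp := P.b_pos
  induction t, h using Nat.le_induction with
  | base => simp [P.deg_eq_zero le_rfl, div_self (P.growth_pos u).ne']
  | succ t hut ih =>
    have ht0 : (0 : ℝ) < t := by exact_mod_cast hu.trans hut
    -- A rising factorial: its increment is 2(k + 1 + b), so the link probability a(k + b)/t yields
    -- an exact multiple of ψ, and one step costs at most the factor 1 + 2a/t ≤ (1 + a/t)².
    set ψ : ℕ → ℝ := fun k => ((k : ℝ) + P.b) * (k + 1 + P.b) with hψ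
    have hb : ∀ t, BddMeas fun ω => ψ (P.deg u t ω) := fun t => P.bddMeas_deg hu t ψ
    change ∫ ω, ψ (P.deg u (t + 1) ω) ∂(law P.m) ≤ _
    have key : ∀ ω, condMean t (fun ω => ψ (P.deg u (t + 1) ω)) ω
        ≤ ψ (P.deg u t ω) * (1 + 2 * (P.a / t)) := fun ω => by
      have hlink : BddMeas fun ω => (P.linkSet u t).indicator 1 ω
          * (ψ (P.deg u t ω + 1) - ψ (P.deg u t ω)) :=
        (BddMeas.indicator (P.measurableSet_linkSet u t)).mul
          (P.bddMeas_deg hu t fun k => ψ (k + 1) - ψ k)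
      simp only [P.deg_succ_comp ψ hu hut]
      rw [condMean_add (hb t) hlink, P.condMean_link_mul hu hut (fun k => ψ (k + 1) - ψ k)]
      have h1 : condMean t (fun ω => ψ (P.deg u t ω)) ω = ψ (P.deg u t ω) := by
        unfold condMean
        simp only [P.deg_splice u le_rfl]
        simp
      have h2 : ψ (P.deg u t ω + 1) - ψ (P.deg u t ω) = 2 * (P.deg u t ω + 1 + P.b) := by
        simp only [hψ]; push_cast; ring
      rw [h1, h2]
      have h3 := mul_le_mul_of_nonneg_right (P.p_infl_le t (P.deg u t ω))
        (show 0 ≤ 2 * ((P.deg u t ω : ℝ) + 1 + P.b) by positivity)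
      refine (add_le_add_right h3 _).trans (le_of_eq ?_)
      simp only [hψ]; field_simp
    rw [← integral_condMean (hb (t + 1)) t]
    calc ∫ ω, condMean t (fun ω => ψ (P.deg u (t + 1) ω)) ω ∂(law P.m)
        ≤ ∫ ω, ψ (P.deg u t ω) * (1 + 2 * (P.a / t)) ∂(law P.m) :=
          integral_mono (((hb (t + 1)).condMean t).integrable _)
            (((hb t).integrable _).mul_const _) key
      _ = (∫ ω, ψ (P.deg u t ω) ∂(law P.m)) * (1 + 2 * (P.a / t)) := integral_mul_const _ _
      _ ≤ P.b * (1 + P.b) * (P.growth t / P.growth u) ^ 2 * (1 + P.a / t) ^ 2 := by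
          have : 1 + 2 * (P.a / t) ≤ (1 + P.a / t) ^ 2 := by nlinarith [sq_nonneg (P.a / t)]
          exact mul_le_mul ih this (by positivity) (by positivity)
      _ = _ := by rw [P.growth_succ (hu.trans hut)]; ring

end Params

/-! ### The number of spheres of influence hit by a new vertex. -/

lemma BddMeas.prod {Ω ι : Type*} [MeasurableSpace Ω] {s : Finset ι} {f : ι → Ω → ℝ}
    (h : ∀ i ∈ s, BddMeas (f i)) : BddMeas fun ω => ∏ i ∈ s, f i ω := by
  classical
  induction s using Finset.induction_on with
  | empty => simpa using BddMeas.const 1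
  | insert i s hi ih =>
    simp only [Finset.prod_insert hi]
    exact (h i (Finset.mem_insert_self i s)).mul
      (ih fun j hj => h j (Finset.mem_insert_of_mem hj))

/-- Functions of the pairs `(x u, x w)`, `w ∈ s`, whose mean does not depend on `x u`, behave as
if they were independent. -/
lemma integral_prod_pairs {ι X : Type*} [MeasurableSpace X] (μ : Measure X)
    [IsProbabilityMeasure μ] {f : X × X → ℝ} (hf : BddMeas f) {c : ℝ}
    (hc : ∀ z, ∫ y, f (z, y) ∂μ = c) {u : ι} {s : Finset ι} (hu : u ∉ s) :
    ∫ x, ∏ w ∈ s, f (x u, x w) ∂(Measure.infinitePi fun _ : ι => μ) = c ^ s.card := by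
  classical
  induction s using Finset.induction_on with
  | empty => simp
  | insert w s hw ih =>
    have hus : u ∉ s := fun h => hu (Finset.mem_insert_of_mem h)
    have huw : u ≠ w := fun h => hu (h ▸ Finset.mem_insert_self _ _)
    have hpair : ∀ v, BddMeas fun x : ι → X => f (x u, x v) := fun v => hf.comp (by fun_prop)
    have hF : BddMeas fun x : ι → X => ∏ v ∈ insert w s, f (x u, x v) :=
      BddMeas.prod fun v _ => hpair v
    -- Only the coordinate `w` is resampled; its factor integrates to `c` whatever the value at `u`.
    have hS := measurePreserving_piecewise μ ({w}ᶜ : Set ι)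
    conv_lhs => rw [← hS.map_eq]
    rw [integral_map hS.measurable.aemeasurable hF.1.aestronglyMeasurable,
      integral_prod _ ((hF.comp hS.measurable).integrable _)]
    have key : ∀ x : ι → X, ∫ x', ∏ v ∈ insert w s, f ((({w}ᶜ : Set ι).piecewise x x') u,
        (({w}ᶜ : Set ι).piecewise x x') v) ∂(Measure.infinitePi fun _ : ι => μ)
        = c * ∏ v ∈ s, f (x u, x v) := fun x => by
      have h1 : ∀ x' : ι → X, ∏ v ∈ insert w s, f ((({w}ᶜ : Set ι).piecewise x x') u,
          (({w}ᶜ : Set ι).piecewise x x') v) = f (x u, x' w) * ∏ v ∈ s, f (x u, x v) := fun x' => by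
        rw [Finset.prod_insert hw]
        congr 1
        · simp [huw]
        · refine Finset.prod_congr rfl fun v hv => ?_
          have hvw : v ≠ w := fun h => hw (h ▸ hv)
          simp [huw, hvw]
      simp only [h1]
      rw [integral_mul_const, ← hc (x u)]
      congr 1
      have he := measurePreserving_eval_infinitePi (fun _ : ι => μ) w
      have hm : AEStronglyMeasurable (fun y => f (x u, y)) μ :=
        (hf.1.comp (measurable_const.prodMk measurable_id)).aestronglyMeasurable
      conv_rhs => rw [← he.map_eq]
      rw [integral_map he.measurable.aemeasurable (by rw [he.map_eq]; exact hm)]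
    simp only [key]
    rw [integral_const_mul, ih hus, Finset.card_insert_of_notMem hw, pow_succ']

/-- Every ordered pair is counted in at least one of its two orientations. With `d` the in-degree,
each pair of hit spheres is charged to the larger one. -/
lemma card_sq_le_two_mul_sum (s : Finset ℕ) (d : ℕ → ℕ) :
    s.card ^ 2 ≤ 2 * ∑ u ∈ s, (s.filter fun w => d w ≤ d u).card := by
  have h1 : s.card ^ 2 = ∑ u ∈ s, ∑ w ∈ s, 1 := by simp [pow_two]
  have h2 : ∑ u ∈ s, (s.filter fun w => d w ≤ d u).card
      = ∑ u ∈ s, ∑ w ∈ s, if d w ≤ d u then 1 else 0 :=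
    Finset.sum_congr rfl fun u _ => Finset.card_filter _ _
  have h3 : ∑ u ∈ s, ∑ w ∈ s, (if d w ≤ d u then 1 else 0)
      = ∑ u ∈ s, ∑ w ∈ s, if d u ≤ d w then 1 else 0 := Finset.sum_comm
  rw [h1, h2, two_mul]
  nth_rewrite 2 [h3]
  rw [← Finset.sum_add_distrib]
  refine Finset.sum_le_sum fun u _ => ?_
  rw [← Finset.sum_add_distrib]
  refine Finset.sum_le_sum fun w _ => ?_
  split_ifs <;> omega

namespace Params

variable (P : Params)

open Classical in
/-- The number of vertices of `G_t` within twice the radius of influence of `v_u`, if the in-degree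
of `v_u` were `k`. -/
def near (u t k : ℕ) (ω : Sample P.m) : ℕ :=
  ((Finset.Icc 1 t).filter fun w =>
    torusDist P.q (ω.1 u) (ω.1 w) ≤ 2 * radius P.m P.q (P.vol t k)).card

open Classical in
/-- The factor that a pair of points contributes to the exponential of `near`. -/
def nearFactor (r : ℝ) (z : Cube P.m × Cube P.m) : ℝ :=
  if torusDist P.q z.1 z.2 ≤ r then Real.exp 1 else 1

lemma exp_near (u t k : ℕ) (ω : Sample P.m) : Real.exp (P.near u t k ω)
    = ∏ w ∈ Finset.Icc 1 t, P.nearFactor (2 * radius P.m P.q (P.vol t k)) (ω.1 u, ω.1 w) := by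
  classical
  simp only [near, nearFactor]
  rw [Finset.prod_ite, Finset.prod_const, Finset.prod_const_one, mul_one, ← Real.exp_nat_mul,
    mul_one]

lemma bddMeas_nearFactor (r : ℝ) : BddMeas (P.nearFactor r) := by
  classical
  refine ⟨Measurable.ite (measurableSet_le (measurable_torusDist P.hq) measurable_const)
    measurable_const measurable_const, Real.exp 1, fun z => ?_⟩
  have := Real.add_one_le_exp (1 : ℝ)
  unfold nearFactor
  split_ifs
  · rw [abs_of_pos (Real.exp_pos _)]
  · rw [abs_one]; linarith

lemma bddMeas_exp_near (u t k : ℕ) : BddMeas fun ω => Real.exp (P.near u t k ω) := by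
  simp only [exp_near]
  exact BddMeas.prod fun w _ => (P.bddMeas_nearFactor _).comp (by fun_prop)

lemma integral_nearFactor (r : ℝ) (z : Cube P.m) :
    ∫ y, P.nearFactor r (z, y) = 1 + (Real.exp 1 - 1) * ballVolume P.m P.q r := by
  classical
  have hS : MeasurableSet (torusBall P.q z r) :=
    measurableSet_le (measurable_torusDist_right P.hq z) measurable_const
  have : ∀ y, P.nearFactor r (z, y)
      = 1 + (Real.exp 1 - 1) * (torusBall P.q z r).indicator 1 y := fun y => by
    by_cases h : torusDist P.q z y ≤ r
    · have h' : y ∈ torusBall P.q z r := h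
      simp [nearFactor, h, h']
    · have h' : y ∉ torusBall P.q z r := h
      simp [nearFactor, h, h']
  simp only [this]
  rw [integral_add (integrable_const _)
    (((BddMeas.indicator hS).integrable _).const_mul _), integral_const_mul,
    integral_indicator_one' _ hS, volume_torusBall P.hq]
  simp

/-- Exponential moment of a binomial count: given v_u, the other vertices fall within the distance
independently. The vertex u may count itself, at the cost of a factor e < 3, and e − 1 ≤ 2 gives the
exponent. -/
lemma integral_exp_near_le {u t : ℕ} (hu : u ∈ Finset.Icc 1 t) (k : ℕ) :
    ∫ ω, Real.exp (P.near u t k ω) ∂(law P.m)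
      ≤ 3 * Real.exp (2 * t * ballVolume P.m P.q (2 * radius P.m P.q (P.vol t k))) := by
  set r := 2 * radius P.m P.q (P.vol t k) with hr
  set φ := ballVolume P.m P.q r with hφ
  have hφ0 : 0 ≤ φ := ballVolume_nonneg r
  have he := Real.exp_one_lt_d9
  have he' := Real.add_one_le_exp (1 : ℝ)
  have hpos : ∀ z, 0 ≤ P.nearFactor r z := fun z => by
    unfold nearFactor
    split_ifs
    · exact (Real.exp_pos _).le
    · exact zero_le_one
  have hle : ∀ z, P.nearFactor r z ≤ 3 := fun z => by
    unfold nearFactor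
    split_ifs <;> linarith
  have hb : BddMeas fun ω : Sample P.m =>
      ∏ w ∈ (Finset.Icc 1 t).erase u, P.nearFactor r (ω.1 u, ω.1 w) :=
    BddMeas.prod fun w _ => (P.bddMeas_nearFactor _).comp (by fun_prop)
  have hb' : BddMeas fun x : ℕ → Cube P.m =>
      ∏ w ∈ (Finset.Icc 1 t).erase u, P.nearFactor r (x u, x w) :=
    BddMeas.prod fun w _ => (P.bddMeas_nearFactor _).comp (by fun_prop)
  have h1 : ∫ ω, Real.exp (P.near u t k ω) ∂(law P.m) ≤ ∫ ω : Sample P.m,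
      3 * ∏ w ∈ (Finset.Icc 1 t).erase u, P.nearFactor r (ω.1 u, ω.1 w) ∂(law P.m) := by
    refine integral_mono ((P.bddMeas_exp_near u t k).integrable _)
      ((hb.integrable _).const_mul _) fun ω => ?_
    simp only [exp_near]
    rw [← Finset.mul_prod_erase _ _ hu]
    exact mul_le_mul_of_nonneg_right (hle _) (Finset.prod_nonneg fun w _ => hpos _)
  have h2 : ∫ ω : Sample P.m, ∏ w ∈ (Finset.Icc 1 t).erase u, P.nearFactor r (ω.1 u, ω.1 w)
      ∂(law P.m) = (1 + (Real.exp 1 - 1) * φ) ^ (t - 1) := by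
    have hfst := measurePreserving_fst
      (μ := Measure.infinitePi fun _ : ℕ => (volume : Measure (Cube P.m)))
      (ν := Measure.infinitePi fun _ : ℕ × ℕ => (volume : Measure unitInterval))
    have := integral_prod_pairs (volume : Measure (Cube P.m)) (P.bddMeas_nearFactor r)
      (P.integral_nearFactor r) (Finset.notMem_erase u (Finset.Icc 1 t))
    rw [Finset.card_erase_of_mem hu, Nat.card_Icc, Nat.add_sub_cancel] at this
    rw [← this]
    conv_rhs => rw [← hfst.map_eq]
    rw [integral_map hfst.measurable.aemeasurable hb'.1.aestronglyMeasurable]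
    rfl
  rw [integral_const_mul, h2] at h1
  refine h1.trans (mul_le_mul_of_nonneg_left ?_ (by norm_num))
  have hbase : 1 + (Real.exp 1 - 1) * φ ≤ Real.exp (2 * φ) := by
    have := Real.add_one_le_exp (2 * φ)
    nlinarith
  have hbase0 : 0 ≤ 1 + (Real.exp 1 - 1) * φ := by
    have : 0 ≤ (Real.exp 1 - 1) * φ := mul_nonneg (by linarith) hφ0
    linarith
  calc (1 + (Real.exp 1 - 1) * φ) ^ (t - 1) ≤ Real.exp (2 * φ) ^ (t - 1) :=
        pow_le_pow_left₀ hbase0 hbase _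
    _ ≤ Real.exp (2 * φ) ^ t := pow_le_pow_right₀ (Real.one_le_exp (by positivity)) (by omega)
    _ = _ := by rw [← Real.exp_nat_mul]; congr 1; ring

/-- A bound on `near` that is rarely exceeded. -/
def nearBound (n k : ℕ) : ℝ := 2 ^ (P.m + 1) * (P.A₁ * k + P.A₂) + 4 * Real.log n

lemma le_nearBound {n : ℕ} (k : ℕ) : P.A₁ * k + P.A₂ ≤ P.nearBound n k := by
  have h1 : 0 ≤ P.A₁ * k + P.A₂ := by have := P.hA₁; have := P.hA₂; positivity
  have h2 : 0 ≤ Real.log n := Real.log_natCast_nonneg n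
  have h3 : (1 : ℝ) ≤ 2 ^ (P.m + 1) := one_le_pow₀ (by norm_num)
  unfold nearBound
  nlinarith

open Classical in
/-- The contribution of the rare events on which `near` exceeds its bound. -/
def nearExcess (n u t : ℕ) (ω : Sample P.m) : ℝ :=
  ∑ k ∈ Finset.range (t + 1), if P.vol t k ≤ 1 then
    t * (Real.exp (P.near u t k ω) * Real.exp (-P.nearBound n k)) else 0

lemma bddMeas_nearExcess (n u t : ℕ) : BddMeas (P.nearExcess n u t) := by
  refine BddMeas.sum fun k _ => ?_
  split_ifs
  · exact (BddMeas.const _).mul ((P.bddMeas_exp_near u t k).mul (BddMeas.const _))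
  · exact BddMeas.const 0

lemma nearExcess_nonneg (n u t : ℕ) (ω : Sample P.m) : 0 ≤ P.nearExcess n u t ω :=
  Finset.sum_nonneg fun k _ => by split_ifs <;> positivity

lemma integral_nearExcess_le {n u t : ℕ} (hu : u ∈ Finset.Icc 1 t) (hn : 1 ≤ n) :
    ∫ ω, P.nearExcess n u t ω ∂(law P.m) ≤ 3 * t * (t + 1) / (n : ℝ) ^ 4 := by
  classical
  have hn0 : (0 : ℝ) < n := by exact_mod_cast hn
  have ht : 1 ≤ t := (Finset.mem_Icc.mp hu).1.trans (Finset.mem_Icc.mp hu).2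
  have ht0 : (0 : ℝ) < t := by exact_mod_cast ht
  unfold nearExcess
  rw [integral_finsetSum _ fun k _ => by
    split_ifs
    · exact (((BddMeas.const (t : ℝ)).mul
        ((P.bddMeas_exp_near u t k).mul (BddMeas.const _))).integrable _)
    · exact integrable_const _]
  have hterm : ∀ k ∈ Finset.range (t + 1), ∫ ω, (if P.vol t k ≤ 1 then
      t * (Real.exp (P.near u t k ω) * Real.exp (-P.nearBound n k)) else 0) ∂(law P.m)
      ≤ 3 * t / (n : ℝ) ^ 4 := fun k _ => by
    split_ifs with hk
    · rw [integral_const_mul, integral_mul_const]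
      have h1 := P.integral_exp_near_le hu k
      have h2 : ballVolume P.m P.q (2 * radius P.m P.q (P.vol t k)) ≤ 2 ^ P.m * P.vol t k := by
        refine (ballVolume_mul_le P.hq (by norm_num)).trans (le_of_eq ?_)
        rw [ballVolume_radius P.hm P.hq (P.vol_pos ht k) hk]
      -- The two terms of `nearBound` are made for this: the first cancels the exponent after
      -- doubling of the radius, and 4 log n leaves n^{-4}, which outweighs the factor t and the
      -- sums over k and u.
      have h3 : 2 * t * ballVolume P.m P.q (2 * radius P.m P.q (P.vol t k)) - P.nearBound n k
          ≤ -(4 * Real.log n) := by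
        have : 2 * t * (2 ^ P.m * P.vol t k) = 2 ^ (P.m + 1) * (P.A₁ * k + P.A₂) := by
          unfold vol; field_simp; ring
        have h4 := mul_le_mul_of_nonneg_left h2 (show (0 : ℝ) ≤ 2 * t by positivity)
        unfold nearBound
        linarith
      calc (t : ℝ) * ((∫ ω, Real.exp (P.near u t k ω) ∂(law P.m)) * Real.exp (-P.nearBound n k))
          ≤ t * (3 * Real.exp (2 * t * ballVolume P.m P.q (2 * radius P.m P.q (P.vol t k)))
            * Real.exp (-P.nearBound n k)) := by gcongr
        _ = 3 * t * Real.exp (2 * t * ballVolume P.m P.q (2 * radius P.m P.q (P.vol t k))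
            - P.nearBound n k) := by rw [sub_eq_add_neg, Real.exp_add]; ring
        _ ≤ 3 * t * Real.exp (-(4 * Real.log n)) := by gcongr
        _ = 3 * t / (n : ℝ) ^ 4 := by
          rw [Real.exp_neg, show 4 * Real.log n = Real.log ((n : ℝ) ^ 4) by
            rw [Real.log_pow]; norm_num, Real.exp_log (by positivity), div_eq_mul_inv]
    · rw [integral_zero]; positivity
  refine (Finset.sum_le_sum hterm).trans (le_of_eq ?_)
  rw [Finset.sum_const, Finset.card_range, nsmul_eq_mul]
  push_cast; ring

lemma vol_mono {t k l : ℕ} (h : k ≤ l) : P.vol t k ≤ P.vol t l := by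
  have := P.hA₁
  unfold vol
  gcongr

open Classical in
/-- A bound on the number of spheres of influence that contain `v_{t+1}` and are not larger than the
sphere of `v_u`. -/
lemma card_hit_le {n u t : ℕ} (hu : u ∈ Finset.Icc 1 t) (ω : Sample P.m)
    (hhit : ω ∈ P.hitSet u t) :
    (((((Finset.Icc 1 t).filter fun w => ω ∈ P.hitSet w t).filter
      fun w => P.deg w t ω ≤ P.deg u t ω).card : ℕ) : ℝ)
      ≤ P.nearBound n (P.deg u t ω) + P.nearExcess n u t ω := by
  obtain ⟨hu1, hut⟩ := Finset.mem_Icc.mp hu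
  have ht0 : (0 : ℝ) < t := by exact_mod_cast hu1.trans hut
  set N := (((Finset.Icc 1 t).filter fun w => ω ∈ P.hitSet w t).filter
      fun w => P.deg w t ω ≤ P.deg u t ω).card with hN
  have hNt : (N : ℝ) ≤ t := by
    have : N ≤ (Finset.Icc 1 t).card :=
      Finset.card_le_card ((Finset.filter_subset _ _).trans (Finset.filter_subset _ _))
    rw [Nat.card_Icc, Nat.add_sub_cancel] at this
    exact_mod_cast this
  have hex := P.nearExcess_nonneg n u t ω
  rcases le_or_gt (P.vol t (P.deg u t ω)) 1 with hv | hv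
  · have hnear : N ≤ P.near u t (P.deg u t ω) ω := by
      refine Finset.card_le_card fun w hw => ?_
      simp only [Finset.mem_filter] at hw ⊢
      obtain ⟨⟨hw1, hw2⟩, hw3⟩ := hw
      refine ⟨hw1, ?_⟩
      have hvw := P.vol_mono (t := t) hw3
      have h1 : torusDist P.q (ω.1 u) (ω.1 (t + 1)) ≤ radius P.m P.q (P.vol t (P.deg u t ω)) :=
        ((mem_ballOfVolume P.hq _ _ _).mp hhit).resolve_left (by linarith)
      have h2 : torusDist P.q (ω.1 w) (ω.1 (t + 1)) ≤ radius P.m P.q (P.vol t (P.deg w t ω)) :=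
        ((mem_ballOfVolume P.hq _ _ _).mp hw2).resolve_left (by linarith)
      have h3 := radius_mono (m := P.m) P.hq hvw hv
      have h4 := torusDist_triangle P.hq (ω.1 u) (ω.1 (t + 1)) (ω.1 w)
      rw [torusDist_comm P.hq (ω.1 (t + 1))] at h4
      linarith
    have hnear' : (N : ℝ) ≤ P.near u t (P.deg u t ω) ω := by exact_mod_cast hnear
    rcases le_or_gt (N : ℝ) (P.nearBound n (P.deg u t ω)) with h | h
    · linarith
    · have hb0 : 0 ≤ P.nearBound n (P.deg u t ω) := by
        refine le_trans ?_ (P.le_nearBound _)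
        have := P.hA₁; have := P.hA₂; positivity
      -- The in-degree depends on the positions counted by `near`, so the exponential moment is
      -- available only for fixed k. For this reason `nearExcess` sums over all k, and the actual
      -- in-degree is one of the terms. Above the bound its exponential is at least 1, so the term
      -- is at least t ≥ N.
      have h5 : (t : ℝ) * (Real.exp (P.near u t (P.deg u t ω) ω)
          * Real.exp (-P.nearBound n (P.deg u t ω))) ≤ P.nearExcess n u t ω := by
        have := Finset.single_le_sum (s := Finset.range (t + 1))
          (f := fun k => if P.vol t k ≤ 1 then
            t * (Real.exp (P.near u t k ω) * Real.exp (-P.nearBound n k)) else 0)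
          (fun k _ => by split_ifs <;> positivity)
          (Finset.mem_range.mpr (Nat.lt_succ_of_le (P.deg_le hu1 t ω)))
        simp only [hv, if_true] at this
        exact this
      rw [← Real.exp_add] at h5
      have h6 : 1 ≤ Real.exp (P.near u t (P.deg u t ω) ω + -P.nearBound n (P.deg u t ω)) :=
        Real.one_le_exp (by linarith)
      nlinarith
  · have h1 : (t : ℝ) ≤ P.A₁ * P.deg u t ω + P.A₂ := by
      unfold vol at hv
      rw [lt_div_iff₀ ht0] at hv
      linarith
    have h2 := P.le_nearBound (n := n) (P.deg u t ω)
    linarith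

-- A link counts at most 1 as a long edge and adds `valueDiff`, which is at most the growth ratio
-- minus 1. Forgetting the coins turns links into hits.
open Classical in
lemma incr_bounds (R : ℝ) {n t : ℕ} (ht : 1 ≤ t) (htn : t < n) (ω : Sample P.m) :
    0 ≤ P.incr R n t ω ∧ P.incr R n t ω ≤ P.growth n / P.growth (t + 1)
      * ((Finset.Icc 1 t).filter fun w => ω ∈ P.hitSet w t).card := by
  have hterm : ∀ u, 0 ≤ (P.longSet R u t).indicator (1 : Sample P.m → ℝ) ω
      + (P.linkSet u t).indicator 1 ω * P.valueDiff R n (t + 1) (P.deg u t ω) ∧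
      (P.longSet R u t).indicator (1 : Sample P.m → ℝ) ω
      + (P.linkSet u t).indicator 1 ω * P.valueDiff R n (t + 1) (P.deg u t ω)
      ≤ P.growth n / P.growth (t + 1) * (if ω ∈ P.hitSet u t then 1 else 0) := fun u => by
    obtain ⟨h1, h2⟩ := P.valueDiff_bounds R (n := n) (t := t + 1) (by omega) htn (P.deg u t ω)
    have h3 : 0 < P.growth n / P.growth (t + 1) := div_pos (P.growth_pos _) (P.growth_pos _)
    by_cases hl : ω ∈ P.linkSet u t
    · have hh : ω ∈ P.hitSet u t := hl.1
      by_cases hL : ω ∈ P.longSet R u t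
      · simp only [hl, hh, hL, Set.indicator_of_mem, Pi.one_apply, if_true]
        constructor <;> linarith
      · simp only [hl, hh, hL, Set.indicator_of_mem, Set.indicator_of_notMem, Pi.one_apply, if_true,
          not_false_eq_true]
        constructor <;> linarith
    · have hL : ω ∉ P.longSet R u t := fun h => hl h.1
      simp only [hl, hL, Set.indicator_of_notMem, not_false_eq_true, zero_mul, add_zero, le_refl,
        true_and]
      split_ifs <;> simp [h3.le]
  refine ⟨Finset.sum_nonneg fun u _ => (hterm u).1, ?_⟩
  refine (Finset.sum_le_sum fun u _ => (hterm u).2).trans (le_of_eq ?_)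
  rw [← Finset.mul_sum, Finset.card_filter]
  push_cast; rfl

/-- Brings the expected charge of a vertex into the quadratic form whose mean `integral_deg_sq_le`
bounds. -/
lemma infl_mul_nearBound_le {n t : ℕ} (ht : 1 ≤ t) (k : ℕ) :
    P.infl t k * P.nearBound n k ≤ P.A₁ * (2 ^ (P.m + 1) * P.A₁ + 4 * Real.log n) / t
      * ((k + P.b) * (k + 1 + P.b)) := by
  have ht0 : (0 : ℝ) < t := by exact_mod_cast ht
  have hA := P.hA₁
  have hb := P.b_pos
  have hlog : 0 ≤ Real.log n := Real.log_natCast_nonneg n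
  have hvol : P.A₁ * k + P.A₂ = P.A₁ * (k + P.b) := by unfold b; field_simp
  have h0 : 0 ≤ P.nearBound n k := by
    refine le_trans ?_ (P.le_nearBound _)
    rw [hvol]; positivity
  have h1 : P.infl t k ≤ P.A₁ * (k + P.b) / t := by
    rw [← hvol]; exact min_le_right _ _
  refine (mul_le_mul_of_nonneg_right h1 h0).trans ?_
  have h2 : P.nearBound n k ≤ (2 ^ (P.m + 1) * P.A₁ + 4 * Real.log n) * (k + 1 + P.b) := by
    unfold nearBound
    rw [hvol]
    have h3 : (0 : ℝ) ≤ 2 ^ (P.m + 1) * P.A₁ := by positivity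
    have h4 : 0 ≤ Real.log n * (k + P.b) := by positivity
    nlinarith
  calc P.A₁ * (k + P.b) / t * P.nearBound n k
      ≤ P.A₁ * (k + P.b) / t * ((2 ^ (P.m + 1) * P.A₁ + 4 * Real.log n) * (k + 1 + P.b)) := by
        gcongr
    _ = _ := by ring

/-- The squared number of hits is at most twice the total charge; given the past, v_u is hit with
probability `infl`, so its charge has mean `infl * nearBound` plus the contribution of the rare
events. -/
lemma integral_incr_sq_le (R : ℝ) {n t : ℕ} (ht : 1 ≤ t) (htn : t < n) :
    ∫ ω, P.incr R n t ω ^ 2 ∂(law P.m) ≤ 2 * (P.growth n / P.growth (t + 1)) ^ 2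
      * ∑ u ∈ Finset.Icc 1 t, (P.A₁ * (2 ^ (P.m + 1) * P.A₁ + 4 * Real.log n) / t
        * (P.b * (1 + P.b) * (P.growth t / P.growth u) ^ 2)
        + 3 * t * (t + 1) / (n : ℝ) ^ 4) := by
  classical
  set G := P.growth n / P.growth (t + 1) with hG
  have hG0 : 0 ≤ G := (div_pos (P.growth_pos _) (P.growth_pos _)).le
  have hK : ∀ u ∈ Finset.Icc 1 t, BddMeas fun ω => (P.hitSet u t).indicator 1 ω
      * P.nearBound n (P.deg u t ω) := fun u hu =>
    (BddMeas.indicator (P.measurableSet_hitSet u t)).mul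
      (P.bddMeas_deg (Finset.mem_Icc.mp hu).1 t (P.nearBound n))
  have hterm : ∀ u ∈ Finset.Icc 1 t, BddMeas fun ω => (P.hitSet u t).indicator 1 ω
      * P.nearBound n (P.deg u t ω) + P.nearExcess n u t ω := fun u hu =>
    (hK u hu).add (P.bddMeas_nearExcess n u t)
  have hpath : ∀ ω, P.incr R n t ω ^ 2 ≤ 2 * G ^ 2 * ∑ u ∈ Finset.Icc 1 t,
      ((P.hitSet u t).indicator 1 ω * P.nearBound n (P.deg u t ω) + P.nearExcess n u t ω) := by
    intro ω
    obtain ⟨h1, h2⟩ := P.incr_bounds R ht htn ω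
    set H := (Finset.Icc 1 t).filter fun w => ω ∈ P.hitSet w t with hH
    have h3 : ((H.card : ℕ) : ℝ) ^ 2
        ≤ 2 * ∑ u ∈ H, ((H.filter fun w => P.deg w t ω ≤ P.deg u t ω).card : ℝ) := by
      exact_mod_cast card_sq_le_two_mul_sum H fun w => P.deg w t ω
    have h4 : ∑ u ∈ H, ((H.filter fun w => P.deg w t ω ≤ P.deg u t ω).card : ℝ)
        ≤ ∑ u ∈ Finset.Icc 1 t, ((P.hitSet u t).indicator 1 ω
          * P.nearBound n (P.deg u t ω) + P.nearExcess n u t ω) := by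
      rw [hH, Finset.sum_filter]
      refine Finset.sum_le_sum fun u hu => ?_
      split_ifs with hhit
      · simpa [hhit] using P.card_hit_le hu ω hhit
      · simpa [hhit] using P.nearExcess_nonneg n u t ω
    calc P.incr R n t ω ^ 2 ≤ (G * H.card) ^ 2 := pow_le_pow_left₀ h1 h2 2
      _ = G ^ 2 * (H.card : ℝ) ^ 2 := by ring
      _ ≤ G ^ 2 * (2 * ∑ u ∈ Finset.Icc 1 t, ((P.hitSet u t).indicator 1 ω
          * P.nearBound n (P.deg u t ω) + P.nearExcess n u t ω)) := by gcongr; linarith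
      _ = _ := by ring
  refine (integral_mono ((P.bddMeas_incr R n t).sq.integrable _)
    (((BddMeas.sum hterm).integrable _).const_mul _) hpath).trans ?_
  rw [integral_const_mul, integral_finsetSum _ fun u hu => (hterm u hu).integrable _]
  refine mul_le_mul_of_nonneg_left (Finset.sum_le_sum fun u hu => ?_) (by positivity)
  obtain ⟨hu1, hut⟩ := Finset.mem_Icc.mp hu
  rw [integral_add ((hK u hu).integrable _) ((P.bddMeas_nearExcess n u t).integrable _)]
  refine add_le_add ?_ (P.integral_nearExcess_le hu (by omega))
  rw [← integral_condMean (hK u hu) t]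
  simp only [P.condMean_hit_mul hu1 hut (P.nearBound n)]
  have hlog : 0 ≤ Real.log n := Real.log_natCast_nonneg n
  have hA := P.hA₁
  refine (integral_mono ((P.bddMeas_deg hu1 t fun k => P.infl t k * P.nearBound n k).integrable _)
    (((P.bddMeas_deg hu1 t fun k => ((k : ℝ) + P.b) * (k + 1 + P.b)).integrable _).const_mul _)
    fun ω => P.infl_mul_nearBound_le ht (P.deg u t ω)).trans ?_
  rw [integral_const_mul]
  exact mul_le_mul_of_nonneg_left (P.integral_deg_sq_le hu1 hut) (by positivity)

/-! ### The variance bound. -/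

lemma one_div_growth_sq_le {u : ℕ} (hu : 1 ≤ u) :
    1 / P.growth u ^ 2 ≤ 1 / (u : ℝ) ^ (2 * P.a) := by
  have hu0 : (0 : ℝ) < u := by exact_mod_cast hu
  have h := P.rpow_le_growth hu
  have h1 : (u : ℝ) ^ (2 * P.a) = ((u : ℝ) ^ P.a) ^ 2 := by
    rw [mul_comm, Real.rpow_mul hu0.le]; norm_cast
  rw [h1]
  gcongr

/-- Here 1/2 < a enters the variance: since 2a > 1, the series converges. -/
lemma sum_one_div_growth_sq_le (t : ℕ) :
    ∑ u ∈ Finset.Icc 1 t, 1 / P.growth u ^ 2 ≤ ∑' u : ℕ, 1 / (u : ℝ) ^ (2 * P.a) := by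
  have hs : Summable fun u : ℕ => 1 / (u : ℝ) ^ (2 * P.a) :=
    Real.summable_one_div_nat_rpow.mpr (by have := P.half_lt_a; linarith)
  exact (Finset.sum_le_sum fun u hu => P.one_div_growth_sq_le (Finset.mem_Icc.mp hu).1).trans
    (hs.sum_le_tsum _ fun _ _ => by positivity)

lemma sum_Ico_one_div_le (n : ℕ) :
    ∑ t ∈ Finset.Ico 1 n, 1 / (t : ℝ) ≤ 1 + Real.log n := by
  refine le_trans ?_ (harmonic_le_one_add_log n)
  rw [harmonic_eq_sum_Icc]
  push_cast
  simp only [one_div]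
  exact Finset.sum_le_sum_of_subset_of_nonneg (fun x hx => by simp at hx ⊢; omega)
    fun _ _ _ => by positivity

/-- The number of long edges has variance at most `n ^ (2 * a)`, up to logarithmic factors. -/
lemma exists_variance_bound : ∃ C : ℝ, 0 < C ∧ ∀ (R : ℝ) (n : ℕ), 1 ≤ n →
    ∫ ω, ((P.longCount R n ω : ℝ) - P.potentialMean R n n) ^ 2 ∂(law P.m)
      ≤ C * ((n : ℝ) ^ P.a * (1 + Real.log n)) ^ 2 := by
  have hA := P.hA₁
  have hb := P.b_pos
  set S := ∑' u : ℕ, 1 / (u : ℝ) ^ (2 * P.a) with hS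
  have hS0 : 0 ≤ S := tsum_nonneg fun _ => by positivity
  set D := P.A₁ * (2 ^ (P.m + 1) * P.A₁ + 4) * (P.b * (1 + P.b)) * S + 3 with hD
  have hD0 : 0 < D := by positivity
  refine ⟨8 * D, by positivity, fun R n hn => ?_⟩
  have hn0 : (0 : ℝ) < n := by exact_mod_cast hn
  have hlog : 0 ≤ Real.log n := Real.log_natCast_nonneg n
  have h0 := P.integral_potential_sub_sq_le R hn (le_refl n)
  simp only [potential_self] at h0
  refine h0.trans ?_
  -- The growth of in-degrees up to t and the growth from t + 1 to n combine to at most growth(n)².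
  -- What remains is (1 + log n)/t, and the sum of 1/t supplies the second logarithm.
  have hterm : ∀ t ∈ Finset.Ico 1 n, ∫ ω, P.incr R n t ω ^ 2 ∂(law P.m)
      ≤ 2 * P.growth n ^ 2 * (D * (1 + Real.log n)) * (1 / t) := fun t ht => by
    obtain ⟨ht1, htn⟩ := Finset.mem_Ico.mp ht
    have ht0 : (0 : ℝ) < t := by exact_mod_cast ht1
    refine (P.integral_incr_sq_le R ht1 htn).trans ?_
    have hg := P.growth_pos t
    have hg' := P.growth_pos (t + 1)
    have hgn := P.growth_pos n
    have hgg := P.growth_le_succ ht1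
    set c := P.A₁ * (2 ^ (P.m + 1) * P.A₁ + 4 * Real.log n) with hc
    have hc0 : 0 ≤ c := by positivity
    have hcle : c ≤ P.A₁ * (2 ^ (P.m + 1) * P.A₁ + 4) * (1 + Real.log n) := by
      have h1 : (0 : ℝ) ≤ 2 ^ (P.m + 1) * P.A₁ * Real.log n := by positivity
      rw [hc, mul_assoc]
      gcongr
      nlinarith
    have hsum := P.sum_one_div_growth_sq_le t
    have e1 : ∑ u ∈ Finset.Icc 1 t, (c / t * (P.b * (1 + P.b) * (P.growth t / P.growth u) ^ 2)
        + 3 * t * (t + 1) / (n : ℝ) ^ 4)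
        = c / t * (P.b * (1 + P.b)) * P.growth t ^ 2 * ∑ u ∈ Finset.Icc 1 t, 1 / P.growth u ^ 2
          + t * (3 * t * (t + 1) / (n : ℝ) ^ 4) := by
      rw [Finset.sum_add_distrib, Finset.sum_const, Nat.card_Icc, Nat.add_sub_cancel, nsmul_eq_mul,
        Finset.mul_sum]
      congr 1
      refine Finset.sum_congr rfl fun u _ => ?_
      rw [div_pow]; ring
    have e2 : (t : ℝ) * (3 * t * (t + 1) / (n : ℝ) ^ 4) ≤ 3 * (1 / t) := by
      have h1 : (t : ℝ) ≤ n := by exact_mod_cast htn.le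
      have h2 : (t : ℝ) + 1 ≤ n := by exact_mod_cast htn
      rw [mul_one_div, le_div_iff₀ ht0, ← mul_div_assoc, div_mul_eq_mul_div, div_le_iff₀ (by positivity)]
      calc (t : ℝ) * (3 * t * (t + 1)) * t = 3 * (t * t * (t + 1) * t) := by ring
        _ ≤ 3 * (n * n * n * n) := by gcongr
        _ = _ := by ring
    have e3 : (P.growth n / P.growth (t + 1)) ^ 2 * P.growth t ^ 2 ≤ P.growth n ^ 2 := by
      rw [← mul_pow]
      gcongr
      rw [div_mul_eq_mul_div, div_le_iff₀ hg']
      gcongr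
    have e4 : (P.growth n / P.growth (t + 1)) ^ 2 ≤ P.growth n ^ 2 := by
      gcongr
      refine div_le_self hgn.le ?_
      rw [← P.growth_one]; exact P.growth_mono le_rfl (by omega)
    rw [e1]
    calc 2 * (P.growth n / P.growth (t + 1)) ^ 2
          * (c / t * (P.b * (1 + P.b)) * P.growth t ^ 2 * ∑ u ∈ Finset.Icc 1 t, 1 / P.growth u ^ 2
          + t * (3 * t * (t + 1) / (n : ℝ) ^ 4))
        ≤ 2 * (P.growth n / P.growth (t + 1)) ^ 2
          * (c / t * (P.b * (1 + P.b)) * P.growth t ^ 2 * S + 3 * (1 / t)) := by gcongr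
      _ = 2 * ((P.growth n / P.growth (t + 1)) ^ 2 * P.growth t ^ 2)
          * (c * (P.b * (1 + P.b)) * S * (1 / t))
          + 2 * (P.growth n / P.growth (t + 1)) ^ 2 * (3 * (1 / t)) := by ring
      _ ≤ 2 * P.growth n ^ 2 * (P.A₁ * (2 ^ (P.m + 1) * P.A₁ + 4) * (1 + Real.log n)
          * (P.b * (1 + P.b)) * S * (1 / t)) + 2 * P.growth n ^ 2 * (3 * (1 / t)) := by gcongr
      _ ≤ 2 * P.growth n ^ 2 * (P.A₁ * (2 ^ (P.m + 1) * P.A₁ + 4) * (1 + Real.log n)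
          * (P.b * (1 + P.b)) * S * (1 / t))
          + 2 * P.growth n ^ 2 * (3 * (1 + Real.log n) * (1 / t)) := by
        have : 3 * (1 / (t : ℝ)) ≤ 3 * (1 + Real.log n) * (1 / t) := by
          have : 0 ≤ Real.log n * (1 / (t : ℝ)) := by positivity
          nlinarith
        gcongr
      _ = _ := by rw [hD]; ring
  refine (Finset.sum_le_sum hterm).trans ?_
  rw [← Finset.mul_sum]
  have hg := P.growth_le hn
  have hg0 := (P.growth_pos n).le
  calc 2 * P.growth n ^ 2 * (D * (1 + Real.log n)) * ∑ t ∈ Finset.Ico 1 n, 1 / (t : ℝ)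
      ≤ 2 * (2 * (n : ℝ) ^ P.a) ^ 2 * (D * (1 + Real.log n)) * (1 + Real.log n) := by
        have := sum_Ico_one_div_le n
        gcongr
    _ = _ := by ring

/-! ### The limiting in-degree distribution. -/

/-- The limiting fraction of vertices of in-degree at least `k`. -/
def tail (k : ℕ) : ℝ := ∏ j ∈ Finset.range k, (j + P.b) / (j + P.b + 1 / P.a)

/-- The limiting fraction of vertices of in-degree `k`. -/
def frac (k : ℕ) : ℝ := P.tail k - P.tail (k + 1)

lemma tail_zero : P.tail 0 = 1 := by simp [tail]

lemma tail_succ (k : ℕ) : P.tail (k + 1) = P.tail k * ((k + P.b) / (k + P.b + 1 / P.a)) :=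
  Finset.prod_range_succ _ _

lemma tail_pos (k : ℕ) : 0 < P.tail k :=
  Finset.prod_pos fun j _ => by have := P.a_pos; have := P.b_pos; positivity

lemma tail_mul (k : ℕ) : (k + P.b) * P.tail k = (k + P.b + 1 / P.a) * P.tail (k + 1) := by
  have := P.a_pos
  have := P.b_pos
  rw [tail_succ]
  field_simp

/-- Stationarity: the flow from in-degree k to k + 1 sustains the tail beyond k. With summation by
parts, the mean of a(k + b)(g(k + 1) − g(k)) is the mean of g minus g(0). -/
lemma frac_mul (k : ℕ) : P.a * (k + P.b) * P.frac k = P.tail (k + 1) := by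
  have := P.a_pos.ne'
  have h := P.tail_mul k
  unfold frac
  field_simp at h
  linarith

lemma frac_nonneg (k : ℕ) : 0 ≤ P.frac k := by
  have h1 := P.a_pos
  have h2 := P.b_pos
  have h3 := P.frac_mul k
  have h4 := P.tail_pos (k + 1)
  by_contra h
  have : P.a * (k + P.b) * P.frac k ≤ 0 :=
    mul_nonpos_of_nonneg_of_nonpos (by positivity) (not_le.mp h).le
  linarith

/-- The exponent `1 / a - 1`. -/
def s : ℝ := 1 / P.a - 1

lemma s_pos : 0 < P.s := by
  have := P.a_pos
  have h : 1 < 1 / P.a := by rw [lt_div_iff₀ this]; linarith [P.a_lt_one]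
  unfold s; linarith

lemma s_lt_one : P.s < 1 := by
  have := P.a_pos
  have h : 1 / P.a < 2 := by rw [div_lt_iff₀ this]; linarith [P.half_lt_a]
  unfold s; linarith

lemma a_mul_s : P.a * P.s = 1 - P.a := by
  have := P.a_pos.ne'
  unfold s; field_simp

/-- The constant of the power law of the in-degrees. -/
def gammaRatio : ℝ := Real.Gamma (P.b + 1 / P.a) / Real.Gamma P.b

/-- The tail is a quotient of two rising factorials, hence of two of Euler's sequences for Gamma;
their common factors n! and n^b cancel and leave n^{1/a}. -/
lemma tendsto_rpow_mul_tail_succ :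
    Tendsto (fun n : ℕ => (n : ℝ) ^ (1 / P.a) * P.tail (n + 1)) atTop (𝓝 P.gammaRatio) := by
  have ha := P.a_pos
  have hb := P.b_pos
  have h1 := Real.GammaSeq_tendsto_Gamma (P.b + 1 / P.a)
  have h2 := Real.GammaSeq_tendsto_Gamma P.b
  refine (h1.div h2 (Real.Gamma_pos_of_pos hb).ne').congr' ?_
  filter_upwards [eventually_ge_atTop 1] with n hn
  have hn0 : (0 : ℝ) < n := by exact_mod_cast hn
  have hp1 : 0 < ∏ j ∈ Finset.range (n + 1), (P.b + j) := Finset.prod_pos fun j _ => by positivity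
  have hp2 : 0 < ∏ j ∈ Finset.range (n + 1), (P.b + 1 / P.a + j) :=
    Finset.prod_pos fun j _ => by positivity
  have ht : P.tail (n + 1) = (∏ j ∈ Finset.range (n + 1), (P.b + j))
      / ∏ j ∈ Finset.range (n + 1), (P.b + 1 / P.a + j) := by
    rw [tail, ← Finset.prod_div_distrib]
    refine Finset.prod_congr rfl fun j _ => ?_
    congr 1 <;> ring
  have hf : (0 : ℝ) < n.factorial := by exact_mod_cast Nat.factorial_pos n
  have hr := Real.rpow_pos_of_pos hn0 P.b
  simp only [Pi.div_apply]
  rw [ht, Real.GammaSeq, Real.GammaSeq, Real.rpow_add hn0]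
  field_simp

/-- The sum of the tails beyond `K`. -/
def tailSum (K : ℕ) : ℝ := P.a / (1 - P.a) * ((K + P.b) * P.tail K)

/-- By `tail_mul` the products (K + b)·tail(K) telescope, so sums of tails have a closed form. -/
lemma tailSum_sub (K : ℕ) : P.tailSum K - P.tailSum (K + 1) = P.tail (K + 1) := by
  have h1 := P.a_pos.ne'
  have h2 : 1 - P.a ≠ 0 := by linarith [P.a_lt_one]
  unfold tailSum
  rw [tail_mul]
  push_cast
  field_simp
  ring

lemma tendsto_rpow_mul_tailSum :
    Tendsto (fun n : ℕ => ((n : ℝ) ^ P.s) * P.tailSum (n + 1)) atTop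
      (𝓝 (P.a / (1 - P.a) * P.gammaRatio)) := by
  have h1 := P.tendsto_rpow_mul_tail_succ
  have h2 : Tendsto (fun n : ℕ => 1 + (1 + P.b) * (1 / (n : ℝ))) atTop (𝓝 1) := by
    simpa using (tendsto_one_div_atTop_nhds_zero_nat (𝕜 := ℝ)).const_mul (1 + P.b) |>.const_add 1
  have h3 := (h2.mul h1).const_mul (P.a / (1 - P.a))
  rw [one_mul] at h3
  refine h3.congr' ?_
  filter_upwards [eventually_ge_atTop 1] with n hn
  have hn0 : (0 : ℝ) < n := by exact_mod_cast hn
  have : (n : ℝ) ^ (1 / P.a) = (n : ℝ) ^ P.s * n := by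
    rw [s, Real.rpow_sub_one hn0.ne']; field_simp
  rw [this, tailSum]
  push_cast
  field_simp
  ring

lemma tendsto_tailSum : Tendsto P.tailSum atTop (𝓝 0) := by
  rw [← tendsto_add_atTop_iff_nat 1]
  have h1 : Tendsto (fun n : ℕ => ((n : ℝ) ^ P.s)⁻¹) atTop (𝓝 0) :=
    ((tendsto_rpow_atTop P.s_pos).comp tendsto_natCast_atTop_atTop).inv_tendsto_atTop
  have h2 := h1.mul P.tendsto_rpow_mul_tailSum
  rw [zero_mul] at h2
  refine h2.congr' ?_
  filter_upwards [eventually_ge_atTop 1] with n hn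
  have hn0 : (0 : ℝ) < n := by exact_mod_cast hn
  rw [inv_mul_cancel_left₀ (Real.rpow_pos_of_pos hn0 _).ne']

lemma hasSum_tail (K : ℕ) : HasSum (fun j => P.tail (K + j + 1)) (P.tailSum K) := by
  rw [hasSum_iff_tendsto_nat_of_nonneg fun j => (P.tail_pos _).le]
  have : ∀ N, ∑ j ∈ Finset.range N, P.tail (K + j + 1) = P.tailSum K - P.tailSum (K + N) := by
    intro N
    induction N with
    | zero => simp
    | succ N ih => rw [Finset.sum_range_succ, ih, ← P.tailSum_sub (K + N)]; simp only [← add_assoc]; ring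
  simp only [this]
  have h : Tendsto (fun N => P.tailSum (K + N)) atTop (𝓝 0) := by
    simp only [add_comm K]
    exact (tendsto_add_atTop_iff_nat K).mpr P.tendsto_tailSum
  simpa using h.const_sub (P.tailSum K)

lemma summable_tail : Summable fun k => P.tail (k + 1) := by
  simpa using (P.hasSum_tail 0).summable

/-- Functions of at most linear growth. -/
def LinGrowth (g : ℕ → ℝ) : Prop := ∃ M, ∀ k : ℕ, |g k| ≤ M * (k + P.b)

variable {P} in
lemma LinGrowth.summable {g : ℕ → ℝ} (hg : P.LinGrowth g) : Summable fun k => P.frac k * g k := by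
  obtain ⟨M, hM⟩ := hg
  refine Summable.of_norm_bounded (P.summable_tail.mul_left (M / P.a)) fun k => ?_
  rw [Real.norm_eq_abs, abs_mul, abs_of_nonneg (P.frac_nonneg k), ← frac_mul]
  have := mul_le_mul_of_nonneg_left (hM k) (P.frac_nonneg k)
  have h := P.a_pos.ne'
  refine this.trans (le_of_eq ?_)
  field_simp

variable {P} in
lemma LinGrowth.add {f g : ℕ → ℝ} (hf : P.LinGrowth f) (hg : P.LinGrowth g) :
    P.LinGrowth fun k => f k + g k := by
  obtain ⟨M, hM⟩ := hf
  obtain ⟨N, hN⟩ := hg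
  exact ⟨M + N, fun k => (abs_add_le _ _).trans ((add_le_add (hM k) (hN k)).trans
    (le_of_eq (by ring)))⟩

variable {P} in
lemma LinGrowth.mul_bdd {f g : ℕ → ℝ} (hf : P.LinGrowth f) {B : ℝ} (hg : ∀ k, |g k| ≤ B) :
    P.LinGrowth fun k => f k * g k := by
  obtain ⟨M, hM⟩ := hf
  refine ⟨M * B, fun k => ?_⟩
  rw [abs_mul]
  calc |f k| * |g k| ≤ (M * (k + P.b)) * B :=
        mul_le_mul (hM k) (hg k) (abs_nonneg _) ((abs_nonneg _).trans (hM k))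
    _ = _ := by ring

lemma linGrowth_of_bdd {g : ℕ → ℝ} {B : ℝ} (hg : ∀ k, |g k| ≤ B) : P.LinGrowth g := by
  have hb := P.b_pos
  refine ⟨B / P.b, fun k => (hg k).trans ?_⟩
  have hB : 0 ≤ B := (abs_nonneg _).trans (hg 0)
  rw [div_mul_eq_mul_div, le_div_iff₀ hb]
  have : 0 ≤ B * k := by positivity
  linarith

lemma linGrowth_of_diff_bdd {g : ℕ → ℝ} {B : ℝ} (hg : ∀ k, |g (k + 1) - g k| ≤ B) :
    P.LinGrowth g := by
  have hb := P.b_pos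
  have hB : 0 ≤ B := (abs_nonneg _).trans (hg 0)
  refine ⟨|g 0| / P.b + B, fun k => ?_⟩
  have h1 : |g k| ≤ |g 0| + B * k := by
    induction k with
    | zero => simp
    | succ k ih =>
      have := abs_add_le (g (k + 1) - g k) (g k)
      rw [sub_add_cancel] at this
      push_cast
      linarith [hg k]
  refine h1.trans ?_
  have h2 : |g 0| / P.b * (k + P.b) = |g 0| + |g 0| / P.b * k := by field_simp; ring
  rw [add_mul, h2]
  have : 0 ≤ |g 0| / P.b * k := by positivity
  have : 0 ≤ B * P.b := by positivity
  linarith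

/-- The mean of a function under the limiting in-degree distribution. -/
def lim (g : ℕ → ℝ) : ℝ := ∑' k, P.frac k * g k

variable {P} in
lemma lim_add {f g : ℕ → ℝ} (hf : P.LinGrowth f) (hg : P.LinGrowth g) :
    P.lim (fun k => f k + g k) = P.lim f + P.lim g := by
  unfold lim
  rw [← hf.summable.tsum_add hg.summable]
  simp only [mul_add]

lemma lim_mul_left (c : ℝ) (g : ℕ → ℝ) : P.lim (fun k => c * g k) = c * P.lim g := by
  unfold lim
  rw [← tsum_mul_left]
  congr 1; funext k; ring

lemma lim_nonneg {g : ℕ → ℝ} (hg : ∀ k, 0 ≤ g k) : 0 ≤ P.lim g :=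
  tsum_nonneg fun k => mul_nonneg (P.frac_nonneg k) (hg k)

variable {P} in
lemma lim_mono {f g : ℕ → ℝ} (hf : P.LinGrowth f) (hg : P.LinGrowth g) (h : ∀ k, f k ≤ g k) :
    P.lim f ≤ P.lim g :=
  hf.summable.tsum_le_tsum (fun k => mul_le_mul_of_nonneg_left (h k) (P.frac_nonneg k)) hg.summable

/-- Summation by parts. -/
lemma lim_eq_of_diff_bdd {g : ℕ → ℝ} {B : ℝ} (hg : ∀ k, |g (k + 1) - g k| ≤ B) :
    P.lim g = g 0 + ∑' k, P.tail (k + 1) * (g (k + 1) - g k) := by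
  have hlin := P.linGrowth_of_diff_bdd hg
  have hsum : Summable fun k => P.tail (k + 1) * (g (k + 1) - g k) := by
    refine Summable.of_norm_bounded (P.summable_tail.mul_left B) fun k => ?_
    rw [Real.norm_eq_abs, abs_mul, abs_of_pos (P.tail_pos _), mul_comm]
    exact mul_le_mul_of_nonneg_right (hg k) (P.tail_pos _).le
  have hpart : ∀ N, ∑ k ∈ Finset.range N, P.frac k * g k
      = g 0 - P.tail N * g N + ∑ k ∈ Finset.range N, P.tail (k + 1) * (g (k + 1) - g k) := by
    intro N
    induction N with
    | zero => simp [tail_zero]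
    | succ N ih => rw [Finset.sum_range_succ, Finset.sum_range_succ, ih, frac]; ring
  -- Since g grows at most linearly, the boundary term is at most a constant times `tailSum N`.
  have hbd : Tendsto (fun N => P.tail N * g N) atTop (𝓝 0) := by
    obtain ⟨M, hM⟩ := hlin
    have h1 := P.tendsto_tailSum.const_mul (M * ((1 - P.a) / P.a))
    rw [mul_zero] at h1
    refine squeeze_zero_norm (fun N => ?_) h1
    have ha := P.a_pos.ne'
    have ha' : 1 - P.a ≠ 0 := by linarith [P.a_lt_one]
    rw [Real.norm_eq_abs, abs_mul, abs_of_pos (P.tail_pos _), tailSum]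
    refine (mul_le_mul_of_nonneg_left (hM N) (P.tail_pos N).le).trans (le_of_eq ?_)
    field_simp
  have h1 := hlin.summable.hasSum.tendsto_sum_nat
  have h2 := ((hbd.const_sub (g 0)).add hsum.hasSum.tendsto_sum_nat)
  simp only [← hpart, sub_zero] at h2
  exact tendsto_nhds_unique h1 h2

/-! ### The excess function and its power law. -/

/-- The mean of `(A₁ k + A₂ - θ)₊`. -/
def excess (θ : ℝ) : ℝ := P.lim fun k => max 0 (P.A₁ * k + P.A₂ - θ)

lemma A_eq (k : ℕ) : P.A₁ * k + P.A₂ = P.A₁ * (k + P.b) := by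
  have := P.hA₁.ne'
  unfold b; field_simp

lemma excess_diff_le (θ : ℝ) (k : ℕ) :
    |max 0 (P.A₁ * ((k + 1 : ℕ) : ℝ) + P.A₂ - θ) - max 0 (P.A₁ * k + P.A₂ - θ)| ≤ P.A₁ := by
  refine (abs_max_sub_max_le_max _ _ _ _).trans ?_
  have : P.A₁ * ((k + 1 : ℕ) : ℝ) + P.A₂ - θ - (P.A₁ * k + P.A₂ - θ) = P.A₁ := by push_cast; ring
  rw [this, sub_zero, abs_zero, abs_of_pos P.hA₁]
  exact max_le P.hA₁.le le_rfl

lemma linGrowth_excess (θ : ℝ) : P.LinGrowth fun k => max 0 (P.A₁ * k + P.A₂ - θ) :=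
  P.linGrowth_of_diff_bdd (P.excess_diff_le θ)

lemma excess_nonneg (θ : ℝ) : 0 ≤ P.excess θ := P.lim_nonneg fun _ => le_max_left _ _

lemma excess_antitone : Antitone P.excess := fun x y h =>
  lim_mono (P.linGrowth_excess y) (P.linGrowth_excess x) fun k =>
    max_le_max le_rfl (by linarith)

/-- For this θ the kink of the positive part sits at the integer K: the differences are 0 below K
and `A₁` from K on, and summation by parts leaves a sum of tails. -/
lemma excess_nat (K : ℕ) : P.excess (P.A₁ * (K + P.b)) = P.A₁ * P.tailSum K := by
  have hA := P.hA₁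
  have hb := P.b_pos
  rw [excess, P.lim_eq_of_diff_bdd (P.excess_diff_le _)]
  have h0 : max 0 (P.A₁ * ((0 : ℕ) : ℝ) + P.A₂ - P.A₁ * (K + P.b)) = 0 := by
    rw [A_eq]
    refine max_eq_left ?_
    have : 0 ≤ P.A₁ * (K : ℝ) := by positivity
    push_cast; linarith
  rw [h0, zero_add]
  have h1 : ∀ k : ℕ, k < K → max 0 (P.A₁ * ((k + 1 : ℕ) : ℝ) + P.A₂ - P.A₁ * (K + P.b))
      - max 0 (P.A₁ * (k : ℝ) + P.A₂ - P.A₁ * (K + P.b)) = 0 := fun k hk => by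
    have h2 : (k : ℝ) + 1 ≤ K := by exact_mod_cast hk
    rw [A_eq, A_eq, max_eq_left, max_eq_left, sub_zero]
    · nlinarith
    · push_cast; nlinarith
  have h2 : ∀ j : ℕ, max 0 (P.A₁ * ((K + j + 1 : ℕ) : ℝ) + P.A₂ - P.A₁ * (K + P.b))
      - max 0 (P.A₁ * ((K + j : ℕ) : ℝ) + P.A₂ - P.A₁ * (K + P.b)) = P.A₁ := fun j => by
    have h3 : 0 ≤ P.A₁ * (j : ℝ) := by positivity
    rw [A_eq, A_eq, max_eq_right, max_eq_right]
    · push_cast; ring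
    · push_cast; linarith
    · push_cast; linarith
  have h3 : HasSum (fun j => P.tail (j + K + 1)
      * (max 0 (P.A₁ * ((j + K + 1 : ℕ) : ℝ) + P.A₂ - P.A₁ * (K + P.b))
      - max 0 (P.A₁ * ((j + K : ℕ) : ℝ) + P.A₂ - P.A₁ * (K + P.b)))) (P.A₁ * P.tailSum K) := by
    simp only [add_comm _ K, h2]
    simpa [mul_comm] using (P.hasSum_tail K).mul_left P.A₁
  have h4 := (hasSum_nat_add_iff (f := fun k => P.tail (k + 1)
      * (max 0 (P.A₁ * ((k + 1 : ℕ) : ℝ) + P.A₂ - P.A₁ * (K + P.b))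
      - max 0 (P.A₁ * (k : ℝ) + P.A₂ - P.A₁ * (K + P.b)))) K).mp h3
  rw [h4.tsum_eq, Finset.sum_eq_zero, add_zero]
  intro k hk
  rw [h1 k (Finset.mem_range.mp hk), mul_zero]

lemma excess_zero : P.excess 0 = P.A₂ / (1 - P.a) := by
  have hA := P.hA₁
  have hb := P.b_pos
  have ha := P.a_pos.ne'
  have ha' : 1 - P.a ≠ 0 := by linarith [P.a_lt_one]
  have h1 : ∀ k : ℕ, P.frac k * max 0 (P.A₁ * k + P.A₂ - 0)
      = P.A₁ / P.a * P.tail (0 + k + 1) := fun k => by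
    rw [A_eq, sub_zero, max_eq_right (by positivity), zero_add, ← frac_mul]
    field_simp
  rw [excess, lim]
  simp only [h1]
  rw [((P.hasSum_tail 0).mul_left _).tsum_eq, tailSum, tail_zero]
  have : P.A₂ = P.A₁ * P.b := by unfold b; field_simp
  rw [this]
  push_cast
  field_simp
  ring

lemma lim_one : P.lim (fun _ => 1) = 1 := by
  rw [P.lim_eq_of_diff_bdd (B := 0) (by simp)]
  simp

lemma excess_zero_sub_le {θ : ℝ} (hθ : 0 ≤ θ) : P.excess 0 - θ ≤ P.excess θ := by
  have h1 : P.LinGrowth fun _ => θ * 1 := P.linGrowth_of_bdd (B := |θ|) (by simp)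
  have h2 : P.excess 0 ≤ P.lim (fun k => max 0 (P.A₁ * k + P.A₂ - θ) + θ * 1) := by
    refine lim_mono (P.linGrowth_excess 0) ((P.linGrowth_excess θ).add h1) fun k => ?_
    refine max_le (add_nonneg (le_max_left _ _) (by linarith)) ?_
    linarith [le_max_right 0 (P.A₁ * k + P.A₂ - θ)]
  rw [lim_add (P.linGrowth_excess θ) h1, lim_mul_left, lim_one] at h2
  unfold excess at h2 ⊢
  linarith

/-- The constant in the power law of `excess`. -/
def kappa : ℝ := P.A₁ ^ P.s * (P.A₁ * (P.a / (1 - P.a) * P.gammaRatio))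

/-- By monotonicity the excess at θ lies between its values at the neighbouring points A₁(K + b),
where `excess_nat` is exact. -/
lemma tendsto_excess : Tendsto (fun θ : ℝ => θ ^ P.s * P.excess θ) atTop (𝓝 P.kappa) := by
  have hA := P.hA₁
  have hb := P.b_pos
  have hs := P.s_pos
  set F : ℝ → ℕ := fun θ => ⌊θ / P.A₁ - P.b⌋₊ with hF
  have hdiv : Tendsto (fun θ : ℝ => θ / P.A₁ - P.b) atTop atTop :=
    tendsto_atTop_add_const_right _ _ (tendsto_id.atTop_div_const hA)
  have hFt : Tendsto F atTop atTop := tendsto_nat_floor_atTop.comp hdiv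
  have hratio : ∀ d : ℝ, Tendsto (fun θ : ℝ => (((F θ : ℕ) : ℝ) + d) / θ) atTop (𝓝 P.A₁⁻¹) := by
    intro d
    have h1 : Tendsto (fun θ : ℝ => ((F θ : ℕ) : ℝ) / (θ / P.A₁ - P.b)) atTop (𝓝 1) :=
      (tendsto_nat_floor_div_atTop (R := ℝ)).comp hdiv
    have h2 : Tendsto (fun θ : ℝ => (θ / P.A₁ - P.b) / θ) atTop (𝓝 P.A₁⁻¹) := by
      have : Tendsto (fun θ : ℝ => P.A₁⁻¹ - P.b * θ⁻¹) atTop (𝓝 P.A₁⁻¹) := by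
        simpa using (tendsto_inv_atTop_zero.const_mul P.b).const_sub P.A₁⁻¹
      refine this.congr' ?_
      filter_upwards [eventually_gt_atTop 0] with θ hθ
      field_simp
    have h3 : Tendsto (fun θ : ℝ => d * θ⁻¹) atTop (𝓝 0) := by
      simpa using tendsto_inv_atTop_zero.const_mul d
    have h4 := (h1.mul h2).add h3
    rw [one_mul, add_zero] at h4
    refine h4.congr' ?_
    filter_upwards [hdiv.eventually_gt_atTop 0, eventually_gt_atTop 0] with θ h0 hθ
    rw [div_mul_div_cancel₀ h0.ne', ← div_eq_mul_inv, ← add_div]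
  have hlimS : ∀ d : ℕ, Tendsto (fun θ : ℝ => θ ^ P.s * (P.A₁ * P.tailSum (F θ + d))) atTop
      (𝓝 P.kappa) := by
    intro d
    have h0 : Tendsto (fun N : ℕ => ((N : ℝ) + ((d : ℝ) - 1)) ^ P.s * P.tailSum (N + d)) atTop
        (𝓝 (P.a / (1 - P.a) * P.gammaRatio)) := by
      have h1 : Tendsto (fun N : ℕ => N + d - 1) atTop atTop := by
        refine tendsto_atTop_mono (fun N => ?_) (tendsto_sub_atTop_nat 1)
        omega
      refine (P.tendsto_rpow_mul_tailSum.comp h1).congr' ?_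
      filter_upwards [eventually_ge_atTop 1] with N hN
      have h2 : N + d - 1 + 1 = N + d := by omega
      have h3 : ((N + d - 1 : ℕ) : ℝ) = (N : ℝ) + ((d : ℝ) - 1) := by
        rw [Nat.cast_sub (by omega)]; push_cast; ring
      simp only [Function.comp_apply, h2, h3]
    have h1 := h0.comp hFt
    have h2 : Tendsto (fun θ : ℝ => ((((F θ : ℕ) : ℝ) + ((d : ℝ) - 1)) / θ) ^ (-P.s)) atTop
        (𝓝 (P.A₁⁻¹ ^ (-P.s))) :=
      (hratio _).rpow_const (Or.inl (by positivity))
    have h3 := (h2.mul h1).const_mul P.A₁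
    have h4 : P.A₁ * (P.A₁⁻¹ ^ (-P.s) * (P.a / (1 - P.a) * P.gammaRatio)) = P.kappa := by
      rw [kappa, Real.inv_rpow hA.le, Real.rpow_neg hA.le, inv_inv]; ring
    rw [h4] at h3
    refine h3.congr' ?_
    filter_upwards [hFt.eventually_ge_atTop 2, eventually_gt_atTop 0] with θ hN hθ
    have hN' : (2 : ℝ) ≤ (F θ : ℕ) := by exact_mod_cast hN
    have hx : 0 < ((F θ : ℕ) : ℝ) + ((d : ℝ) - 1) := by
      have : (0 : ℝ) ≤ d := Nat.cast_nonneg d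
      linarith
    have hxs := Real.rpow_pos_of_pos hx P.s
    have hts := Real.rpow_pos_of_pos hθ P.s
    simp only [Function.comp_apply]
    rw [Real.div_rpow hx.le hθ.le, Real.rpow_neg hx.le, Real.rpow_neg hθ.le]
    field_simp
  refine tendsto_of_tendsto_of_tendsto_of_le_of_le' (hlimS 1) (hlimS 0) ?_ ?_
  · filter_upwards [eventually_gt_atTop 0] with θ hθ
    refine mul_le_mul_of_nonneg_left ?_ (Real.rpow_nonneg hθ.le _)
    rw [← excess_nat]
    refine P.excess_antitone ?_
    have := (Nat.lt_floor_add_one (θ / P.A₁ - P.b)).le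
    rw [sub_le_iff_le_add, div_le_iff₀ hA] at this
    push_cast
    linarith
  · filter_upwards [eventually_gt_atTop 0, hdiv.eventually_ge_atTop 0] with θ hθ h0
    refine mul_le_mul_of_nonneg_left ?_ (Real.rpow_nonneg hθ.le _)
    rw [add_zero, ← excess_nat]
    refine P.excess_antitone ?_
    have := Nat.floor_le h0
    rw [le_sub_iff_add_le, le_div_iff₀ hA] at this
    linarith

end Params

/-! ### The mean number of long edges. -/

namespace Params

variable (P : Params) (R : ℝ)

lemma lim_congr {f g : ℕ → ℝ} (h : ∀ k, f k = g k) : P.lim f = P.lim g := by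
  rw [funext h]

/-- Separates the linear rate, to which stationarity applies, from the truncation at volume 1, which
ends up in `loss`. -/
lemma mul_p_infl {t : ℕ} (ht : 1 ≤ t) (k : ℕ) : t * (P.p * P.infl t k)
    = P.a * (k + P.b) + -P.p * max 0 (P.A₁ * k + P.A₂ - t) := by
  have ht0 : (0 : ℝ) < t := by exact_mod_cast ht
  have h1 : t * P.infl t k = min (t : ℝ) (P.A₁ * k + P.A₂) := by
    rw [infl, vol, mul_min_of_nonneg _ _ ht0.le, mul_one, mul_div_cancel₀ _ ht0.ne']
  have h2 : min (t : ℝ) (P.A₁ * k + P.A₂)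
      = P.A₁ * k + P.A₂ - max 0 (P.A₁ * k + P.A₂ - t) := by
    rcases le_total (t : ℝ) (P.A₁ * k + P.A₂) with h | h
    · rw [min_eq_left h, max_eq_right (by linarith)]; ring
    · rw [min_eq_right h, max_eq_left (by linarith)]; ring
  rw [mul_left_comm, h1, h2, A_eq, a]
  ring

lemma mul_reward {t : ℕ} (ht : 1 ≤ t) (k : ℕ) : t * P.reward R t k
    = P.p * max 0 (P.A₁ * k + P.A₂ - t * ballVolume P.m P.q R)
      + -P.p * max 0 (P.A₁ * k + P.A₂ - t) := by
  have ht0 : (0 : ℝ) < t := by exact_mod_cast ht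
  have hν := ballVolume_le_one (m := P.m) (q := P.q) R
  have hν' : t * ballVolume P.m P.q R ≤ t := by nlinarith
  have h1 : t * P.infl t k = min (t : ℝ) (P.A₁ * k + P.A₂) := by
    rw [infl, vol, mul_min_of_nonneg _ _ ht0.le, mul_one, mul_div_cancel₀ _ ht0.ne']
  have h2 : max 0 (min (t : ℝ) (P.A₁ * k + P.A₂) - t * ballVolume P.m P.q R)
      = max 0 (P.A₁ * k + P.A₂ - t * ballVolume P.m P.q R)
        - max 0 (P.A₁ * k + P.A₂ - t) := by
    rcases le_total (t : ℝ) (P.A₁ * k + P.A₂) with h | h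
    · rw [min_eq_left h, max_eq_right (by linarith), max_eq_right (by linarith),
        max_eq_right (by linarith)]; ring
    · rw [min_eq_right h, max_eq_left (show P.A₁ * k + P.A₂ - t ≤ 0 by linarith)]; ring
  rw [reward, mul_left_comm, mul_max_of_nonneg _ _ ht0.le, mul_zero, mul_sub, h1, h2]
  ring

lemma valueDiff_abs_le {n t : ℕ} (ht : 1 ≤ t) (h : t ≤ n) (k : ℕ) :
    |P.valueDiff R n t k| ≤ P.growth n / P.growth t := by
  obtain ⟨h1, h2⟩ := P.valueDiff_bounds R ht h k
  rw [abs_of_nonneg h1]; linarith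

lemma linGrowth_value {n t : ℕ} (ht : 1 ≤ t) (h : t ≤ n) : P.LinGrowth (P.value R n t) :=
  P.linGrowth_of_diff_bdd (P.valueDiff_abs_le R ht h)

lemma linGrowth_shift : P.LinGrowth fun k : ℕ => (k : ℝ) + P.b :=
  ⟨1, fun k => by rw [one_mul, abs_of_nonneg]; have := P.b_pos; positivity⟩

lemma LinGrowth.const_mul {P : Params} {f : ℕ → ℝ} (hf : P.LinGrowth f) (c : ℝ) :
    P.LinGrowth fun k => c * f k := by
  simpa only [mul_comm c] using hf.mul_bdd (g := fun _ => c) (B := |c|) fun _ => le_rfl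

/-- The loss caused by spheres of influence that would exceed the cube. -/
def loss (n t : ℕ) : ℝ :=
  P.p * P.lim fun k => max 0 (P.A₁ * k + P.A₂ - t) * P.valueDiff R n (t + 1) k

/-- The recursion `value_step`, multiplied by t and averaged over `frac`. Stationarity turns the
linear part of the drift into the mean of the value at t + 1 minus `value R n (t + 1) 0`. This
raises the factor t to t + 1 and produces exactly the newborn term of `potentialMean_succ`, so the
sum telescopes. -/
lemma lim_value_step {n t : ℕ} (ht : 1 ≤ t) (htn : t < n) :
    t * P.lim (P.value R n t) = ((t + 1 : ℕ) : ℝ) * P.lim (P.value R n (t + 1))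
      - P.value R n (t + 1) 0 - P.loss R n t
      + P.p * (P.excess (t * ballVolume P.m P.q R) - P.excess t) := by
  have hd := P.valueDiff_abs_le R (n := n) (t := t + 1) (by omega) htn
  have l1 := P.linGrowth_value R (n := n) (t := t + 1) (by omega) htn
  have l2 : P.LinGrowth fun k => P.a * ((k + P.b) * P.valueDiff R n (t + 1) k) :=
    (P.linGrowth_shift.mul_bdd hd).const_mul P.a
  have l3 : P.LinGrowth fun k =>
      -P.p * (max 0 (P.A₁ * k + P.A₂ - t) * P.valueDiff R n (t + 1) k) :=
    ((P.linGrowth_excess t).mul_bdd hd).const_mul (-P.p)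
  have l4 := (P.linGrowth_excess (t * ballVolume P.m P.q R)).const_mul P.p
  have l5 := (P.linGrowth_excess t).const_mul (-P.p)
  have hparts : P.lim (fun k => P.a * ((k + P.b) * P.valueDiff R n (t + 1) k))
      = P.lim (P.value R n (t + 1)) - P.value R n (t + 1) 0 := by
    rw [P.lim_eq_of_diff_bdd hd, add_sub_cancel_left, lim]
    congr 1; funext k
    rw [← frac_mul, valueDiff]; ring
  have key : t * P.lim (P.value R n t) = P.lim fun k => t * P.value R n (t + 1) k
      + (P.a * ((k + P.b) * P.valueDiff R n (t + 1) k)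
      + (-P.p * (max 0 (P.A₁ * k + P.A₂ - t) * P.valueDiff R n (t + 1) k)
      + (P.p * max 0 (P.A₁ * k + P.A₂ - t * ballVolume P.m P.q R)
      + -P.p * max 0 (P.A₁ * k + P.A₂ - t)))) := by
    rw [← lim_mul_left]
    refine P.lim_congr fun k => ?_
    rw [P.value_step R htn, mul_add, mul_add, mul_reward P R ht, ← mul_assoc (t : ℝ),
      P.mul_p_infl ht]
    ring
  rw [key, lim_add (l1.const_mul t) (l2.add (l3.add (l4.add l5))),
    lim_add l2 (l3.add (l4.add l5)), lim_add l3 (l4.add l5), lim_add l4 l5, hparts,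
    lim_mul_left, lim_mul_left, lim_mul_left, lim_mul_left, loss]
  unfold excess
  push_cast
  ring

lemma loss_bounds {n t : ℕ} (htn : t < n) :
    0 ≤ P.loss R n t ∧ P.loss R n t ≤ P.p * (P.growth n / P.growth (t + 1) * P.excess t) := by
  have hd := P.valueDiff_abs_le R (n := n) (t := t + 1) (by omega) htn
  have hb := fun k => P.valueDiff_bounds R (n := n) (t := t + 1) (by omega) htn k
  refine ⟨mul_nonneg P.hp₀ (P.lim_nonneg fun k => mul_nonneg (le_max_left _ _) (hb k).1), ?_⟩
  refine mul_le_mul_of_nonneg_left ?_ P.hp₀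
  rw [excess, ← lim_mul_left]
  refine lim_mono ((P.linGrowth_excess t).mul_bdd hd) ((P.linGrowth_excess t).const_mul _)
    fun k => ?_
  rw [mul_comm]
  exact mul_le_mul_of_nonneg_right (by linarith [(hb k).2]) (le_max_left _ _)

lemma potentialMean_eq {n : ℕ} (hn : 1 ≤ n) : P.potentialMean R n n
    = ∑ t ∈ Finset.Ico 1 n, P.p * (P.excess (t * ballVolume P.m P.q R) - P.excess t)
      + P.value R n 1 0 - ∑ t ∈ Finset.Ico 1 n, P.loss R n t - P.lim (P.value R n 1) := by
  have h : ∀ t, 1 ≤ t → t ≤ n → P.potentialMean R n t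
      = ∑ t ∈ Finset.Ico 1 t, P.p * (P.excess (t * ballVolume P.m P.q R) - P.excess t)
      + P.value R n 1 0 - ∑ t ∈ Finset.Ico 1 t, P.loss R n t - P.lim (P.value R n 1)
      + t * P.lim (P.value R n t) := by
    intro t ht
    induction t, ht using Nat.le_induction with
    | base => intro _; simp [potentialMean]
    | succ t ht ih =>
      intro htn
      rw [potentialMean_succ, ih (by omega), Finset.sum_Ico_succ_top ht,
        Finset.sum_Ico_succ_top ht, P.lim_value_step R ht htn]
      ring
  have h0 : P.lim (P.value R n n) = 0 := by
    unfold lim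
    simp [value_self]
  rw [h n hn le_rfl, h0, mul_zero, add_zero]

lemma exists_excess_le : ∃ C : ℝ, 0 < C ∧ ∀ θ : ℝ, 0 < θ → P.excess θ ≤ C * θ ^ (-P.s) := by
  have hs := P.s_pos
  obtain ⟨Θ, hΘ⟩ := ((P.tendsto_excess.eventually_lt_const (lt_add_one P.kappa)).and
    (eventually_gt_atTop 0)).exists_forall_of_atTop
  have hΘ0 : 0 < Θ := (hΘ Θ le_rfl).2
  have he0 := P.excess_nonneg 0
  refine ⟨max (P.kappa + 1) 1 + P.excess 0 * Θ ^ P.s, by positivity, fun θ hθ => ?_⟩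
  have hθs := Real.rpow_pos_of_pos hθ P.s
  have hpos : 0 ≤ P.excess 0 * Θ ^ P.s := by positivity
  rw [Real.rpow_neg hθ.le, ← div_eq_mul_inv, le_div_iff₀ hθs, mul_comm]
  rcases le_total Θ θ with h | h
  · linarith [(hΘ θ h).1, le_max_left (P.kappa + 1) 1]
  · have h1 : θ ^ P.s * P.excess θ ≤ Θ ^ P.s * P.excess 0 :=
      mul_le_mul (Real.rpow_le_rpow hθ.le h hs.le) (P.excess_antitone hθ.le)
        (P.excess_nonneg _) (by positivity)
    have h2 := le_max_right (P.kappa + 1) 1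
    linarith

/-- The mean number of long edges, up to an error of order `n ^ a`. -/
lemma exists_mean_bound : ∃ C : ℝ, 0 < C ∧ ∀ (R : ℝ) (n : ℕ), 1 ≤ n →
    |P.potentialMean R n n
      - ∑ t ∈ Finset.Ico 1 n, P.p * (P.excess (t * ballVolume P.m P.q R) - P.excess t)|
      ≤ C * (n : ℝ) ^ P.a := by
  obtain ⟨C, hC, hexc⟩ := P.exists_excess_le
  have hb := P.b_pos
  have hA := P.hA₁
  have hp := P.p_pos
  have ha := P.a_pos
  set S := ∑' t : ℕ, 1 / (t : ℝ) ^ (P.a + P.s) with hS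
  -- From as = 1 − a one gets a(a + s − 1) = (1 − a)² > 0. Hence the losses sum to O(growth(n)).
  have has : 1 < P.a + P.s := by
    have h1 := P.a_mul_s
    nlinarith [P.a_lt_one, mul_pos (sub_pos.mpr P.a_lt_one) (sub_pos.mpr P.a_lt_one)]
  have hsum : Summable fun t : ℕ => 1 / (t : ℝ) ^ (P.a + P.s) :=
    Real.summable_one_div_nat_rpow.mpr has
  have hS0 : 0 ≤ S := tsum_nonneg fun _ => by positivity
  set L := P.lim (fun k : ℕ => (k : ℝ) + P.b) with hL
  have hL0 : 0 ≤ L := P.lim_nonneg fun k => by positivity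
  refine ⟨2 * (P.b + P.p * C * S + L), by positivity, fun R n hn => ?_⟩
  have hg := P.growth_pos n
  have hg1 : 1 ≤ P.growth n := by rw [← P.growth_one]; exact P.growth_mono le_rfl hn
  have v0 := P.value_bounds R le_rfl hn
  rw [P.growth_one, div_one] at v0
  have h1 : P.value R n 1 0 ≤ P.b * P.growth n := by
    have := (v0 0).2
    push_cast at this
    nlinarith
  have h2 : P.lim (P.value R n 1) ≤ L * P.growth n := by
    rw [hL, mul_comm, ← lim_mul_left]
    refine lim_mono (P.linGrowth_value R le_rfl hn) (P.linGrowth_shift.const_mul _) fun k => ?_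
    have := (v0 k).2
    have hk : (0 : ℝ) ≤ k + P.b := by positivity
    nlinarith
  have h2' : 0 ≤ P.lim (P.value R n 1) := P.lim_nonneg fun k => (v0 k).1
  have h3 : ∑ t ∈ Finset.Ico 1 n, P.loss R n t ≤ P.p * C * S * P.growth n := by
    have hterm : ∀ t ∈ Finset.Ico 1 n, P.loss R n t
        ≤ P.p * C * P.growth n * (1 / (t : ℝ) ^ (P.a + P.s)) := fun t ht => by
      obtain ⟨ht1, htn⟩ := Finset.mem_Ico.mp ht
      have ht0 : (0 : ℝ) < t := by exact_mod_cast ht1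
      have e1 := hexc t ht0
      have e2 : (t : ℝ) ^ P.a ≤ P.growth (t + 1) :=
        (P.rpow_le_growth ht1).trans (P.growth_le_succ ht1)
      have e3 := Real.rpow_pos_of_pos ht0 P.a
      calc P.loss R n t ≤ P.p * (P.growth n / P.growth (t + 1) * P.excess t) :=
            (P.loss_bounds R htn).2
        _ ≤ P.p * (P.growth n / (t : ℝ) ^ P.a * (C * (t : ℝ) ^ (-P.s))) := by
            have := P.excess_nonneg t
            gcongr
        _ = _ := by
            rw [Real.rpow_add ht0, Real.rpow_neg ht0.le]
            field_simp
    refine (Finset.sum_le_sum hterm).trans ?_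
    rw [← Finset.mul_sum]
    have := hsum.sum_le_tsum (Finset.Ico 1 n) fun _ _ => by positivity
    calc P.p * C * P.growth n * ∑ t ∈ Finset.Ico 1 n, 1 / (t : ℝ) ^ (P.a + P.s)
        ≤ P.p * C * P.growth n * S := by gcongr
      _ = _ := by ring
  have h3' : 0 ≤ ∑ t ∈ Finset.Ico 1 n, P.loss R n t :=
    Finset.sum_nonneg fun t ht => (P.loss_bounds R (Finset.mem_Ico.mp ht).2).1
  have h4 := (v0 0).1
  have h5 := P.growth_le hn
  have h6 : (P.b + P.p * C * S + L) * P.growth n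
      ≤ 2 * (P.b + P.p * C * S + L) * (n : ℝ) ^ P.a := by
    have : 0 ≤ P.b + P.p * C * S + L := by positivity
    nlinarith
  have h7 : 0 ≤ P.b * P.growth n := by positivity
  have h8 : 0 ≤ P.p * C * S * P.growth n := by positivity
  have h9 : 0 ≤ L * P.growth n := by positivity
  rw [P.potentialMean_eq R hn, abs_le]
  constructor <;> linarith

end Params

/-! ### Sums of powers, and Chebyshev's inequality. -/

lemma sum_rpow_neg_le {σ : ℝ} (h0 : 0 < σ) (h1 : σ < 1) (N : ℕ) :
    (1 - σ) * ∑ t ∈ Finset.Ico 1 (N + 1), (t : ℝ) ^ (-σ) ≤ (N : ℝ) ^ (1 - σ) := by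
  induction N with
  | zero => simp [Real.zero_rpow (by linarith : 1 - σ ≠ 0)]
  | succ N ih =>
    rw [Finset.sum_Ico_succ_top (by omega), mul_add]
    have hx : (0 : ℝ) < ((N + 1 : ℕ) : ℝ) := by positivity
    have h2 : (N : ℝ) = ((N + 1 : ℕ) : ℝ) * (1 + -1 / ((N + 1 : ℕ) : ℝ)) := by
      push_cast; field_simp; ring
    have h3 := rpow_one_add_le_one_add_mul_self (s := -1 / ((N + 1 : ℕ) : ℝ))
      (by rw [le_div_iff₀ hx]; push_cast; linarith [(Nat.cast_nonneg N : (0 : ℝ) ≤ N)])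
      (sub_nonneg.mpr h1.le) (by linarith : 1 - σ ≤ 1)
    have h4 : (0 : ℝ) ≤ 1 + -1 / ((N + 1 : ℕ) : ℝ) := by
      by_contra h
      nlinarith [not_le.mp h, (Nat.cast_nonneg N : (0 : ℝ) ≤ N)]
    -- Bernoulli's inequality replaces the comparison with an integral.
    have h5 : (N : ℝ) ^ (1 - σ) ≤ ((N + 1 : ℕ) : ℝ) ^ (1 - σ)
        * (1 + (1 - σ) * (-1 / ((N + 1 : ℕ) : ℝ))) := by
      conv_lhs => rw [h2]
      rw [Real.mul_rpow hx.le h4]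
      gcongr
    have h6 : ((N + 1 : ℕ) : ℝ) ^ (1 - σ) = ((N + 1 : ℕ) : ℝ) * ((N + 1 : ℕ) : ℝ) ^ (-σ) := by
      rw [sub_eq_add_neg, Real.rpow_add hx, Real.rpow_one]
    have h7 : ((N + 1 : ℕ) : ℝ) ^ (1 - σ) * (1 + (1 - σ) * (-1 / ((N + 1 : ℕ) : ℝ)))
        = ((N + 1 : ℕ) : ℝ) ^ (1 - σ) - (1 - σ) * ((N + 1 : ℕ) : ℝ) ^ (-σ) := by
      rw [h6]; field_simp; ring
    linarith

lemma sum_Ico_rpow_neg_le {σ : ℝ} (h0 : 0 < σ) (h1 : σ < 1) {n : ℕ} (hn : 1 ≤ n) :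
    ∑ t ∈ Finset.Ico 1 n, (t : ℝ) ^ (-σ) ≤ (n : ℝ) ^ (1 - σ) / (1 - σ) := by
  obtain ⟨N, rfl⟩ : ∃ N, n = N + 1 := ⟨n - 1, by omega⟩
  have h2 : 0 < 1 - σ := by linarith
  rw [le_div_iff₀ h2, mul_comm]
  refine (sum_rpow_neg_le h0 h1 N).trans (Real.rpow_le_rpow (by positivity) ?_ h2.le)
  push_cast; linarith

lemma le_sum_Ico_rpow_neg {σ : ℝ} (h0 : 0 < σ) (h1 : σ < 1) {n : ℕ} (hn : 1 ≤ n) :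
    (n : ℝ) ^ (1 - σ) - 1 ≤ (1 - σ) * ∑ t ∈ Finset.Ico 1 n, (t : ℝ) ^ (-σ) := by
  induction n, hn using Nat.le_induction with
  | base => simp
  | succ n hn ih =>
    have hx : (0 : ℝ) < n := by exact_mod_cast hn
    rw [Finset.sum_Ico_succ_top hn, mul_add]
    have h2 : ((n + 1 : ℕ) : ℝ) = n * (1 + 1 / n) := by push_cast; field_simp
    have h3 := rpow_one_add_le_one_add_mul_self (s := 1 / (n : ℝ))
      (by have : 0 < 1 / (n : ℝ) := by positivity
          linarith) (sub_nonneg.mpr h1.le) (by linarith : 1 - σ ≤ 1)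
    have h5 : ((n + 1 : ℕ) : ℝ) ^ (1 - σ) ≤ (n : ℝ) ^ (1 - σ) * (1 + (1 - σ) * (1 / n)) := by
      rw [h2, Real.mul_rpow hx.le (by positivity)]
      gcongr
    have h6 : (n : ℝ) ^ (1 - σ) = n * (n : ℝ) ^ (-σ) := by
      rw [sub_eq_add_neg, Real.rpow_add hx, Real.rpow_one]
    have h7 : (n : ℝ) ^ (1 - σ) * (1 + (1 - σ) * (1 / n))
        = (n : ℝ) ^ (1 - σ) + (1 - σ) * (n : ℝ) ^ (-σ) := by
      rw [h6]; field_simp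
    linarith

lemma tendsto_natCast_rpow_neg {δ : ℝ} (hδ : 0 < δ) :
    Tendsto (fun n : ℕ => (n : ℝ) ^ (-δ)) atTop (𝓝 0) :=
  (tendsto_rpow_neg_atTop hδ).comp tendsto_natCast_atTop_atTop

lemma tendsto_sum_rpow_neg_div {σ : ℝ} (h0 : 0 < σ) (h1 : σ < 1) :
    Tendsto (fun n : ℕ => (∑ t ∈ Finset.Ico 1 n, (t : ℝ) ^ (-σ)) / (n : ℝ) ^ (1 - σ)) atTop
      (𝓝 (1 / (1 - σ))) := by
  have h2 : 0 < 1 - σ := by linarith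
  have hl : Tendsto (fun n : ℕ => 1 / (1 - σ) * (1 - (n : ℝ) ^ (-(1 - σ)))) atTop
      (𝓝 (1 / (1 - σ))) := by
    simpa using ((tendsto_natCast_rpow_neg h2).const_sub 1).const_mul (1 / (1 - σ))
  refine tendsto_of_tendsto_of_tendsto_of_le_of_le' hl tendsto_const_nhds ?_ ?_
  · filter_upwards [eventually_ge_atTop 1] with n hn
    have hx : (0 : ℝ) < n := by exact_mod_cast hn
    have h3 := le_sum_Ico_rpow_neg h0 h1 hn
    have h4 := Real.rpow_pos_of_pos hx (1 - σ)
    rw [Real.rpow_neg hx.le, le_div_iff₀ h4]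
    have h5 : 1 / (1 - σ) * (1 - ((n : ℝ) ^ (1 - σ))⁻¹) * (n : ℝ) ^ (1 - σ)
        = ((n : ℝ) ^ (1 - σ) - 1) / (1 - σ) := by field_simp
    rw [h5, div_le_iff₀ h2]
    linarith
  · filter_upwards [eventually_ge_atTop 1] with n hn
    have hx : (0 : ℝ) < n := by exact_mod_cast hn
    have h4 := Real.rpow_pos_of_pos hx (1 - σ)
    rw [div_le_iff₀ h4]
    refine (sum_Ico_rpow_neg_le h0 h1 hn).trans (le_of_eq (by ring))

/-- Chebyshev's inequality in the form needed for `AASEquivalent`. -/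
lemma aasEquivalent_of_moments {Ω : Type*} [MeasurableSpace Ω] (μ : Measure Ω)
    [IsProbabilityMeasure μ] {X : ℕ → Ω → ℝ} (hX : ∀ n, BddMeas (X n)) {ν f v : ℕ → ℝ}
    (hf : ∀ᶠ n in atTop, 0 < f n) (hv : ∀ᶠ n in atTop, ∫ ω, (X n ω - ν n) ^ 2 ∂μ ≤ v n)
    (hmean : Tendsto (fun n => ν n / f n) atTop (𝓝 1))
    (hvar : Tendsto (fun n => v n / f n ^ 2) atTop (𝓝 0)) : AASEquivalent μ X f := by
  intro ε hε
  -- Half of the tolerance εf is spent on the distance from ν to f, the other half in Chebyshev's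
  -- inequality; hence 4/ε².
  have hlow : Tendsto (fun n => ENNReal.ofReal (1 - 4 / ε ^ 2 * (v n / f n ^ 2))) atTop (𝓝 1) := by
    have := (hvar.const_mul (4 / ε ^ 2)).const_sub 1
    rw [mul_zero, sub_zero] at this
    simpa using ENNReal.tendsto_ofReal this
  refine tendsto_of_tendsto_of_tendsto_of_le_of_le' hlow tendsto_const_nhds ?_
    (Eventually.of_forall fun n => prob_le_one)
  have hm : ∀ᶠ n in atTop, |ν n / f n - 1| < ε / 2 := by
    have := hmean.eventually (Metric.ball_mem_nhds 1 (half_pos hε))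
    simpa [Real.dist_eq] using this
  filter_upwards [hf, hv, hm] with n hfn hvn hmn
  have hsq : BddMeas fun ω => (X n ω - ν n) ^ 2 := ((hX n).sub (BddMeas.const _)).sq
  have hgood : MeasurableSet {ω | |X n ω - f n| ≤ ε * f n} := by
    have h1 : Measurable fun ω => |X n ω - f n| := by
      have := (hX n).1
      fun_prop
    exact measurableSet_le h1 measurable_const
  have hdev : |ν n - f n| ≤ ε / 2 * f n := by
    have h1 : ν n - f n = (ν n / f n - 1) * f n := by field_simp
    rw [h1, abs_mul, abs_of_pos hfn]
    exact mul_le_mul_of_nonneg_right hmn.le hfn.le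
  have hmarkov := mul_meas_ge_le_integral_of_nonneg (μ := μ)
    (ae_of_all _ fun ω => sq_nonneg (X n ω - ν n)) (hsq.integrable μ) ((ε / 2 * f n) ^ 2)
  have hsub : {ω | |X n ω - f n| ≤ ε * f n}ᶜ ⊆ {ω | (ε / 2 * f n) ^ 2 ≤ (X n ω - ν n) ^ 2} := by
    intro ω hω
    have h1 : ε * f n < |X n ω - f n| := not_le.mp hω
    have h2 := abs_sub_le (X n ω) (ν n) (f n)
    have h3 : ε / 2 * f n ≤ |X n ω - ν n| := by linarith
    have h4 : (ε / 2 * f n) ^ 2 ≤ |X n ω - ν n| ^ 2 := pow_le_pow_left₀ (by positivity) h3 2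
    rwa [sq_abs] at h4
  have hbad : μ.real {ω | |X n ω - f n| ≤ ε * f n}ᶜ ≤ 4 / ε ^ 2 * (v n / f n ^ 2) := by
    have h1 : μ.real {ω | |X n ω - f n| ≤ ε * f n}ᶜ
        ≤ μ.real {ω | (ε / 2 * f n) ^ 2 ≤ (X n ω - ν n) ^ 2} := measureReal_mono hsub
    have h2 : (ε / 2 * f n) ^ 2 * μ.real {ω | |X n ω - f n| ≤ ε * f n}ᶜ ≤ v n :=
      ((mul_le_mul_of_nonneg_left h1 (by positivity)).trans hmarkov).trans hvn
    have h3 : 4 / ε ^ 2 * (v n / f n ^ 2) = v n / (ε / 2 * f n) ^ 2 := by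
      field_simp; ring
    rw [h3, le_div_iff₀ (by positivity), mul_comm]
    exact h2
  rw [probReal_compl_eq_one_sub hgood] at hbad
  exact ENNReal.ofReal_le_of_le_toReal (by rw [← measureReal_def]; linarith)

/-! ### From the deterministic sum to the two ranges of α. -/

namespace Params

variable (P : Params)

/-- Reduction of the theorem to the asymptotics of a deterministic sum. -/
lemma aasEquivalent_of_tendsto {α c e : ℝ} (hα : 0 < α) (hc : 0 < c) (hea : P.a < e)
    (hes : 1 - P.s < e)
    (hlim : Tendsto (fun n : ℕ => (∑ t ∈ Finset.Ico 1 n, P.excess (t * (n : ℝ) ^ (-α)))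
      / (n : ℝ) ^ e) atTop (𝓝 (c / P.p))) :
    AASEquivalent (law P.m) (fun n ω => (longEdges P.q P.p P.A₁ P.A₂ α n ω : ℝ))
      (fun n => c * (n : ℝ) ^ e) := by
  obtain ⟨C, hC, hvar⟩ := P.exists_variance_bound
  obtain ⟨D, hD, hmean⟩ := P.exists_mean_bound
  obtain ⟨E, hE, hexc⟩ := P.exists_excess_le
  have hp := P.p_pos
  have hs0 := P.s_pos
  have hs1 := P.s_lt_one
  set R : ℕ → ℝ := fun n => longRadius P.m P.q α n with hR
  refine aasEquivalent_of_moments (law P.m) (ν := fun n => P.potentialMean (R n) n n)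
    (v := fun n => C * ((n : ℝ) ^ P.a * (1 + Real.log n)) ^ 2) (fun n => ?_) ?_ ?_ ?_ ?_
  · exact BddMeas.nat_comp (P.measurable_longCount (R n) n) (P.longCount_le (R n) n)
      fun k => (k : ℝ)
  · filter_upwards [eventually_ge_atTop 1] with n hn
    have hx : (0 : ℝ) < n := by exact_mod_cast hn
    positivity
  · filter_upwards [eventually_ge_atTop 1] with n hn
    exact hvar (R n) n hn
  -- Two errors: O(n^a) from `exists_mean_bound`, killed by `hea`, and the sum of excess(t), of
  -- order at most n^{1−s}, killed by `hes`.
  · have herr : Tendsto (fun n : ℕ => (P.potentialMean (R n) n n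
        - P.p * ∑ t ∈ Finset.Ico 1 n, P.excess (t * (n : ℝ) ^ (-α))) / (n : ℝ) ^ e) atTop (𝓝 0) := by
      have hb : Tendsto (fun n : ℕ => D * (n : ℝ) ^ (-(e - P.a))
          + P.p * E / (1 - P.s) * (n : ℝ) ^ (-(e - (1 - P.s)))) atTop (𝓝 0) := by
        simpa using ((tendsto_natCast_rpow_neg (sub_pos.mpr hea)).const_mul D).add
          ((tendsto_natCast_rpow_neg (sub_pos.mpr hes)).const_mul (P.p * E / (1 - P.s)))
      refine squeeze_zero_norm' ?_ hb
      filter_upwards [eventually_ge_atTop 1, eventually_ballVolume_longRadius P.hm P.hq hα]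
        with n hn hvol
      have hx : (0 : ℝ) < n := by exact_mod_cast hn
      have h1 := hmean (R n) n hn
      rw [hvol] at h1
      have h2 : ∑ t ∈ Finset.Ico 1 n, P.excess t ≤ E * ((n : ℝ) ^ (1 - P.s) / (1 - P.s)) := by
        have h3 : ∀ t ∈ Finset.Ico 1 n, P.excess t ≤ E * (t : ℝ) ^ (-P.s) := fun t ht =>
          hexc t (by exact_mod_cast (Finset.mem_Ico.mp ht).1)
        refine (Finset.sum_le_sum h3).trans ?_
        rw [← Finset.mul_sum]
        exact mul_le_mul_of_nonneg_left (sum_Ico_rpow_neg_le hs0 hs1 hn) hE.le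
      have h2' : 0 ≤ ∑ t ∈ Finset.Ico 1 n, P.excess t :=
        Finset.sum_nonneg fun t _ => P.excess_nonneg _
      rw [← Finset.mul_sum, Finset.sum_sub_distrib, abs_le] at h1
      have hne := Real.rpow_pos_of_pos hx e
      rw [Real.norm_eq_abs, abs_div, abs_of_pos hne, div_le_iff₀ hne, add_mul, mul_assoc, mul_assoc,
        ← Real.rpow_add hx, ← Real.rpow_add hx]
      have e1 : -(e - P.a) + e = P.a := by ring
      have e2 : -(e - (1 - P.s)) + e = 1 - P.s := by ring
      rw [e1, e2]
      have h3 : P.p * E / (1 - P.s) * (n : ℝ) ^ (1 - P.s)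
          = P.p * (E * ((n : ℝ) ^ (1 - P.s) / (1 - P.s))) := by ring
      rw [h3]
      have h4 := mul_le_mul_of_nonneg_left h2 hp.le
      have h5 := mul_nonneg hp.le h2'
      rw [abs_le]
      constructor <;> linarith [h1.1, h1.2]
    have hsum := (herr.add (hlim.const_mul P.p)).const_mul c⁻¹
    have h1 : c⁻¹ * (0 + P.p * (c / P.p)) = 1 := by field_simp; ring
    rw [h1] at hsum
    refine hsum.congr' ?_
    filter_upwards [eventually_ge_atTop 1] with n hn
    have hx : (0 : ℝ) < n := by exact_mod_cast hn
    have hne := Real.rpow_pos_of_pos hx e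
    generalize ∑ t ∈ Finset.Ico 1 n, P.excess (t * (n : ℝ) ^ (-α)) = T
    field_simp
    ring
  · have hlog : Tendsto (fun n : ℕ => (n : ℝ) ^ (-(e - P.a))
        + Real.log n / (n : ℝ) ^ (e - P.a)) atTop (𝓝 0) := by
      have h1 := ((isLittleO_log_rpow_atTop (sub_pos.mpr hea)).tendsto_div_nhds_zero).comp
        (tendsto_natCast_atTop_atTop (R := ℝ))
      simpa using (tendsto_natCast_rpow_neg (sub_pos.mpr hea)).add h1
    have h2 := (hlog.pow 2).const_mul (C / c ^ 2)
    rw [zero_pow (by norm_num), mul_zero] at h2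
    refine h2.congr' ?_
    filter_upwards [eventually_ge_atTop 1] with n hn
    have hx : (0 : ℝ) < n := by exact_mod_cast hn
    have h3 := Real.rpow_pos_of_pos hx e
    have h4 := Real.rpow_pos_of_pos hx P.a
    rw [Real.rpow_neg hx.le, Real.rpow_sub hx]
    field_simp

/-- The sum in the range `α > 1`. -/
lemma tendsto_sum_excess_of_one_lt {α : ℝ} (hα : 1 < α) :
    Tendsto (fun n : ℕ => (∑ t ∈ Finset.Ico 1 n, P.excess (t * (n : ℝ) ^ (-α)))
      / (n : ℝ) ^ (1 : ℝ)) atTop (𝓝 (P.excess 0)) := by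
  -- All arguments are at most n^{1−α}, and the excess drops from its value at 0 by at most its
  -- argument.
  have hl : Tendsto (fun n : ℕ => (1 - 1 / (n : ℝ)) * (P.excess 0 - (n : ℝ) ^ (-(α - 1)))) atTop
      (𝓝 (P.excess 0)) := by
    simpa using ((tendsto_one_div_atTop_nhds_zero_nat (𝕜 := ℝ)).const_sub 1).mul
      ((tendsto_natCast_rpow_neg (sub_pos.mpr hα)).const_sub (P.excess 0))
  refine tendsto_of_tendsto_of_tendsto_of_le_of_le' hl tendsto_const_nhds ?_ ?_
  · filter_upwards [eventually_ge_atTop 1] with n hn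
    have hx : (0 : ℝ) < n := by exact_mod_cast hn
    rw [Real.rpow_one, le_div_iff₀ hx]
    have h1 : ∀ t ∈ Finset.Ico 1 n, P.excess 0 - (n : ℝ) ^ (-(α - 1))
        ≤ P.excess (t * (n : ℝ) ^ (-α)) := fun t ht => by
      have h2 := P.excess_zero_sub_le (θ := t * (n : ℝ) ^ (-α)) (by positivity)
      have h3 : (n : ℝ) ^ (-(α - 1)) = n * (n : ℝ) ^ (-α) := by
        rw [neg_sub, sub_eq_add_neg, Real.rpow_add hx, Real.rpow_one]
      have h4 : (t : ℝ) * (n : ℝ) ^ (-α) ≤ n * (n : ℝ) ^ (-α) := by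
        have : (t : ℝ) ≤ n := by exact_mod_cast (Finset.mem_Ico.mp ht).2.le
        gcongr
      linarith
    refine le_trans (le_of_eq ?_) (Finset.card_nsmul_le_sum _ _ _ h1)
    rw [Nat.card_Ico, nsmul_eq_mul, Nat.cast_sub hn]
    field_simp
    push_cast
    ring
  · filter_upwards [eventually_ge_atTop 1] with n hn
    have hx : (0 : ℝ) < n := by exact_mod_cast hn
    rw [Real.rpow_one, div_le_iff₀ hx]
    refine (Finset.sum_le_card_nsmul _ _ (P.excess 0) fun t _ =>
      P.excess_antitone (by positivity)).trans ?_
    rw [Nat.card_Ico, nsmul_eq_mul, Nat.cast_sub hn]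
    have := P.excess_nonneg 0
    push_cast
    nlinarith

/-- The power law of `excess`, with an error term that is summable uniformly. -/
lemma exists_excess_sub_le {ε σ : ℝ} (hε : 0 < ε) (hσ : P.s < σ) :
    ∃ D : ℝ, 0 ≤ D ∧ ∀ θ : ℝ, 0 < θ →
      |P.excess θ - P.kappa * θ ^ (-P.s)| ≤ ε * θ ^ (-P.s) + D * θ ^ (-σ) := by
  obtain ⟨C, hC, hexc⟩ := P.exists_excess_le
  have h0 : ∀ᶠ θ in atTop, |θ ^ P.s * P.excess θ - P.kappa| < ε := by
    have := P.tendsto_excess.eventually (Metric.ball_mem_nhds P.kappa hε)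
    simpa [Real.dist_eq] using this
  obtain ⟨Θ, hΘ⟩ := (h0.and (eventually_gt_atTop 0)).exists_forall_of_atTop
  have hΘ0 : 0 < Θ := (hΘ Θ le_rfl).2
  -- For θ ≤ Θ, where the limit says nothing, θ^{-s} ≤ Θ^{σ−s} θ^{-σ}.
  refine ⟨(C + |P.kappa|) * Θ ^ (σ - P.s), by positivity, fun θ hθ => ?_⟩
  have hθs := Real.rpow_pos_of_pos hθ P.s
  have hθn := Real.rpow_pos_of_pos hθ (-P.s)
  have hθσ := Real.rpow_pos_of_pos hθ (-σ)
  have hΘσ := Real.rpow_pos_of_pos hΘ0 (σ - P.s)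
  rcases le_total Θ θ with h | h
  · have h1 := (hΘ θ h).1
    have h2 : P.excess θ - P.kappa * θ ^ (-P.s)
        = (θ ^ P.s * P.excess θ - P.kappa) * θ ^ (-P.s) := by
      rw [Real.rpow_neg hθ.le]; field_simp
    rw [h2, abs_mul, abs_of_pos hθn]
    have h3 := mul_le_mul_of_nonneg_right h1.le hθn.le
    have h4 : 0 ≤ (C + |P.kappa|) * Θ ^ (σ - P.s) * θ ^ (-σ) := by positivity
    linarith
  · have h1 : |P.excess θ - P.kappa * θ ^ (-P.s)| ≤ (C + |P.kappa|) * θ ^ (-P.s) := by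
      refine (abs_sub _ _).trans ?_
      rw [abs_of_nonneg (P.excess_nonneg θ), abs_mul, abs_of_pos hθn, add_mul]
      linarith [hexc θ hθ]
    have h2 : θ ^ (-P.s) = θ ^ (σ - P.s) * θ ^ (-σ) := by
      rw [← Real.rpow_add hθ]; congr 1; ring
    have h3 : θ ^ (σ - P.s) ≤ Θ ^ (σ - P.s) := Real.rpow_le_rpow hθ.le h (by linarith)
    have h4 : (C + |P.kappa|) * θ ^ (-P.s) ≤ (C + |P.kappa|) * Θ ^ (σ - P.s) * θ ^ (-σ) := by
      rw [h2, mul_assoc]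
      gcongr
    have h5 : 0 ≤ ε * θ ^ (-P.s) := by positivity
    linarith

/-- The sum in the range `α < 1`. -/
lemma tendsto_sum_excess_of_lt_one {α : ℝ} (hα : α < 1) :
    Tendsto (fun n : ℕ => (∑ t ∈ Finset.Ico 1 n, P.excess (t * (n : ℝ) ^ (-α)))
      / (n : ℝ) ^ (1 - P.s + α * P.s)) atTop (𝓝 (P.kappa / (1 - P.s))) := by
  have hs0 := P.s_pos
  have hs1 := P.s_lt_one
  have h1s : 0 < 1 - P.s := by linarith
  -- Any σ strictly between s and 1 serves: σ < 1 keeps the sum of t^{-σ} of order n^{1−σ}, and σ >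
  -- s makes the error smaller than the main term by n^{-(1−α)(σ−s)}.
  set σ := (1 + P.s) / 2 with hσ
  have hσ0 : 0 < σ := by rw [hσ]; linarith
  have hσ1 : σ < 1 := by rw [hσ]; linarith
  have hsσ : P.s < σ := by rw [hσ]; linarith
  have h1σ : 0 < 1 - σ := by linarith
  set S : ℝ → ℕ → ℝ := fun τ n => ∑ t ∈ Finset.Ico 1 n, (t : ℝ) ^ (-τ) with hS
  have hmain : Tendsto (fun n : ℕ => P.kappa * (S P.s n / (n : ℝ) ^ (1 - P.s))) atTop
      (𝓝 (P.kappa / (1 - P.s))) := by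
    simpa [div_eq_mul_inv] using (tendsto_sum_rpow_neg_div hs0 hs1).const_mul P.kappa
  have hdiff : Tendsto (fun n : ℕ => (∑ t ∈ Finset.Ico 1 n, P.excess (t * (n : ℝ) ^ (-α)))
      / (n : ℝ) ^ (1 - P.s + α * P.s) - P.kappa * (S P.s n / (n : ℝ) ^ (1 - P.s)))
      atTop (𝓝 0) := by
    rw [Metric.tendsto_atTop']
    intro δ hδ
    obtain ⟨D, hD0, hD⟩ := P.exists_excess_sub_le (ε := δ * (1 - P.s) / 2) (by positivity) hsσ
    have hgap : 0 < (1 - α) * (σ - P.s) := mul_pos (by linarith) (by linarith)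
    have hsmall : Tendsto (fun n : ℕ => D / (1 - σ) * (n : ℝ) ^ (-((1 - α) * (σ - P.s)))) atTop
        (𝓝 0) := by
      simpa using (tendsto_natCast_rpow_neg hgap).const_mul (D / (1 - σ))
    have hev := hsmall.eventually_lt_const (half_pos hδ)
    obtain ⟨N, hN⟩ := (hev.and (eventually_ge_atTop 1)).exists_forall_of_atTop
    refine ⟨N, fun n hn => ?_⟩
    obtain ⟨hsm, hn1⟩ := hN n (le_of_lt hn)
    have hx : (0 : ℝ) < n := by exact_mod_cast hn1
    have hpow : ∀ τ : ℝ, ∀ t : ℕ, ((t : ℝ) * (n : ℝ) ^ (-α)) ^ (-τ)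
        = (n : ℝ) ^ (α * τ) * (t : ℝ) ^ (-τ) := fun τ t => by
      rw [Real.mul_rpow (by positivity) (by positivity), ← Real.rpow_mul hx.le, neg_mul_neg,
        mul_comm]
    have hne := Real.rpow_pos_of_pos hx (1 - P.s + α * P.s)
    have hsplit : (n : ℝ) ^ (1 - P.s + α * P.s) = (n : ℝ) ^ (1 - P.s) * (n : ℝ) ^ (α * P.s) :=
      Real.rpow_add hx _ _
    have hbound : |∑ t ∈ Finset.Ico 1 n, P.excess (t * (n : ℝ) ^ (-α))
        - P.kappa * (n : ℝ) ^ (α * P.s) * S P.s n|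
        ≤ δ * (1 - P.s) / 2 * ((n : ℝ) ^ (α * P.s) * S P.s n)
          + D * ((n : ℝ) ^ (α * σ) * S σ n) := by
      have e1 : ∑ t ∈ Finset.Ico 1 n, P.excess (t * (n : ℝ) ^ (-α))
          - P.kappa * (n : ℝ) ^ (α * P.s) * S P.s n
          = ∑ t ∈ Finset.Ico 1 n, (P.excess (t * (n : ℝ) ^ (-α))
            - P.kappa * ((t : ℝ) * (n : ℝ) ^ (-α)) ^ (-P.s)) := by
        rw [Finset.sum_sub_distrib, hS, Finset.mul_sum]
        congr 1
        refine Finset.sum_congr rfl fun t _ => ?_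
        rw [hpow]; ring
      rw [e1]
      refine (Finset.abs_sum_le_sum_abs _ _).trans ?_
      refine (Finset.sum_le_sum fun t ht => hD _ ?_).trans (le_of_eq ?_)
      · have : (0 : ℝ) < t := by exact_mod_cast (Finset.mem_Ico.mp ht).1
        positivity
      · simp only [hpow]
        rw [Finset.sum_add_distrib, hS, Finset.mul_sum, Finset.mul_sum, Finset.mul_sum,
          Finset.mul_sum]
    have hSs := sum_Ico_rpow_neg_le hs0 hs1 hn1
    have hSσ := sum_Ico_rpow_neg_le hσ0 hσ1 hn1
    have e2 : (∑ t ∈ Finset.Ico 1 n, P.excess (t * (n : ℝ) ^ (-α)))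
        / (n : ℝ) ^ (1 - P.s + α * P.s) - P.kappa * (S P.s n / (n : ℝ) ^ (1 - P.s))
        = (∑ t ∈ Finset.Ico 1 n, P.excess (t * (n : ℝ) ^ (-α))
          - P.kappa * (n : ℝ) ^ (α * P.s) * S P.s n) / (n : ℝ) ^ (1 - P.s + α * P.s) := by
      have h3 := Real.rpow_pos_of_pos hx (1 - P.s)
      have h4 := Real.rpow_pos_of_pos hx (α * P.s)
      rw [hsplit]
      generalize ∑ t ∈ Finset.Ico 1 n, P.excess (t * (n : ℝ) ^ (-α)) = T
      field_simp
    rw [Real.dist_eq, sub_zero, e2, abs_div, abs_of_pos hne, div_lt_iff₀ hne]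
    refine hbound.trans_lt ?_
    have h3 : δ * (1 - P.s) / 2 * ((n : ℝ) ^ (α * P.s) * S P.s n)
        ≤ δ / 2 * (n : ℝ) ^ (1 - P.s + α * P.s) := by
      calc δ * (1 - P.s) / 2 * ((n : ℝ) ^ (α * P.s) * S P.s n)
          ≤ δ * (1 - P.s) / 2 * ((n : ℝ) ^ (α * P.s) * ((n : ℝ) ^ (1 - P.s) / (1 - P.s))) := by
            gcongr
        _ = _ := by rw [hsplit]; field_simp
    have h4 : D * ((n : ℝ) ^ (α * σ) * S σ n)
        ≤ D / (1 - σ) * (n : ℝ) ^ (-((1 - α) * (σ - P.s))) * (n : ℝ) ^ (1 - P.s + α * P.s) := by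
      calc D * ((n : ℝ) ^ (α * σ) * S σ n)
          ≤ D * ((n : ℝ) ^ (α * σ) * ((n : ℝ) ^ (1 - σ) / (1 - σ))) := by gcongr
        _ = D / (1 - σ) * ((n : ℝ) ^ (α * σ) * (n : ℝ) ^ (1 - σ)) := by ring
        _ = _ := by
          rw [mul_assoc, ← Real.rpow_add hx, ← Real.rpow_add hx]
          congr 2; ring
    have h5 := mul_lt_mul_of_pos_right hsm hne
    linarith
  have := hdiff.add hmain
  simpa using this

end Params

end SPA

end

theorem theorem4p1 (m : ℕ) (hm : 1 ≤ m) (q : ℝ≥0∞) (hq : 1 ≤ q) (p A₁ A₂ : ℝ)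
    (hp₀ : 0 ≤ p) (hp₁ : p ≤ 1) (hA₁ : 0 < A₁) (hA₂ : 0 < A₂)
    (hlow : 1 / 2 < p * A₁) (hhigh : p * A₁ < 1) (α : ℝ) :
    (1 < α →
      SPA.AASEquivalent (SPA.law m) (fun n ω => (SPA.longEdges q p A₁ A₂ α n ω : ℝ))
        (fun n => p * A₂ / (1 - p * A₁) * (n : ℝ))) ∧
    (1 - p * A₁ / (4 * (p * A₁) + 2) < α → α < 1 →
      SPA.AASEquivalent (SPA.law m) (fun n ω => (SPA.longEdges q p A₁ A₂ α n ω : ℝ))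
        (fun n => SPA.midConstant p A₁ A₂ *
          (n : ℝ) ^ (2 - 1 / (p * A₁) + α * ((1 - p * A₁) / (p * A₁))))) := by
  let P : SPA.Params := ⟨m, hm, q, hq, p, A₁, A₂, hp₀, hp₁, hA₁, hA₂, hlow, hhigh⟩
  have hp : 0 < p := P.p_pos
  have ha : P.a = p * A₁ := rfl
  have hb : P.b = A₂ / A₁ := rfl
  have ha0 : 0 < p * A₁ := P.a_pos
  have ha1 : 0 < 1 - p * A₁ := by linarith
  have hs : P.s = (1 - p * A₁) / (p * A₁) := by
    rw [SPA.Params.s, ha]; field_simp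
  have hs0 := P.s_pos
  have has := P.a_mul_s
  rw [ha] at has
  constructor
  · intro hα
    have h := P.aasEquivalent_of_tendsto (α := α) (c := p * A₂ / (1 - p * A₁)) (e := 1)
      (by linarith) (by positivity) P.a_lt_one (by linarith) (by
        have h1 := P.tendsto_sum_excess_of_one_lt hα
        rw [P.excess_zero] at h1
        have h2 : p * A₂ / (1 - p * A₁) / P.p = P.A₂ / (1 - P.a) := by
          change p * A₂ / (1 - p * A₁) / p = A₂ / (1 - p * A₁)
          field_simp
        rw [h2]; exact h1)
    simpa only [Real.rpow_one] using h
  · intro hα0 hα1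
    have hfrac : p * A₁ / (4 * (p * A₁) + 2) < p * A₁ := by
      rw [div_lt_iff₀ (by positivity)]; nlinarith
    have hα : 0 < α := by linarith
    have hexp : 2 - 1 / (p * A₁) + α * ((1 - p * A₁) / (p * A₁)) = 1 - P.s + α * P.s := by
      rw [hs]; field_simp; ring
    have h1s : 1 - P.s = (2 * (p * A₁) - 1) / (p * A₁) := by
      rw [hs]; field_simp; ring
    have h2a : 0 < 2 * (p * A₁) - 1 := by linarith
    have hΓ1 : 0 < Real.Gamma (A₂ / A₁ + 1 / (p * A₁)) := Real.Gamma_pos_of_pos (by positivity)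
    have hΓ2 : 0 < Real.Gamma (A₂ / A₁) := Real.Gamma_pos_of_pos (by positivity)
    -- The last factor of the constant collapses because (1 − a)³ + (2a − 1)(1 − a + a²) = a³; it is
    -- then visibly positive.
    have hcube : (1 - p * A₁) ^ 3 / (2 * (p * A₁) - 1) + 1 - p * A₁ * (1 - p * A₁)
        = (p * A₁) ^ 3 / (2 * (p * A₁) - 1) := by
      rw [eq_div_iff h2a.ne', sub_mul, add_mul, div_mul_cancel₀ _ h2a.ne']
      ring
    have hc : 0 < SPA.midConstant p A₁ A₂ := by
      unfold SPA.midConstant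
      rw [hcube]
      positivity
    simp only [hexp]
    refine P.aasEquivalent_of_tendsto hα hc ?_ ?_ ?_
    -- By as = 1 − a, the exponent minus a equals s(α − (1 − a)); `hfrac` and `hα0` give α > 1 − a.
    · rw [ha]; nlinarith
    · have := mul_pos hα hs0; linarith
    · have h1 := P.tendsto_sum_excess_of_lt_one hα1
      have h2 : SPA.midConstant p A₁ A₂ / P.p = P.kappa / (1 - P.s) := by
        have hpow := Real.rpow_pos_of_pos hA₁ ((1 - p * A₁) / (p * A₁))
        change SPA.midConstant p A₁ A₂ / p = _
        rw [h1s, SPA.Params.kappa, SPA.Params.gammaRatio, SPA.midConstant, hcube, hs, ha, hb]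
        change _ = A₁ ^ ((1 - p * A₁) / (p * A₁)) * (A₁ * _) / _
        field_simp
      rw [h2]; exact h1
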